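/- Let $n\ge 1$. A \emph{classical subsolution} (resp. \emph{supersolution}) on $\mathbb R^n$ of the free boundary problem $$\Delta w=0 \text{ in } \{|w|<1\},\qquad w=\pm1 \text{ elsewhere},\qquad |\nabla w|=1 \text{ on the free boundary}$$ is a continuous function $w:\mathbb R^n\to[-1,1]$ such that: $w$ is $C^2$ in the open set $\{|w|<1\}$ and its derivatives of order at most $2$ extend continuously to $\overline{\{|w|<1\}}$; $\Delta w\ge 0$ (resp. $\Delta w\le 0$) in $\{|w|<1\}$; the sets $F^{\pm}(w)=\partial\{w=\pm1\}$ are (possibly empty) embedded $C^2$ hypersurfaces; and, for the gradient taken from inside $\{|w|<1\}$, $|\nabla w|\ge 1$ (resp. $0<|\nabla w|\le 1$) on $F^-(w)$ and $|\nabla w|\le 1$ (resp. $|\nabla w|\ge 1$) on $F^+(w)$. Let $V$ be a classical subsolution and $W$ a classical supersolution on $\mathbb R^n$ with $V\le W$. Let $\Omega=\{x=(x',x_n)\in\mathbb R^{n-1}\times\mathbb R: |x'|<R,\ |x_n|<h\}$ with $R,h>0$, and let $$S(\Omega)=\{v\in H^1(\Omega): V\le v\le W \text{ a.e. in }\Omega\},\qquad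 I(v,\Omega)=\int_\Omega |\nabla v|^2+\chi_{\{|v|<1\}},$$ $$\mathcal B_{V,W}=\{x\in\Omega: |V(x)|<1\}\cup\{x\in\Omega:|W(x)|<1\}.$$ Let $u\in S(\Omega)$ be any minimizer of $I(\cdot,\Omega)$ over $S(\Omega)$. Then, after modification on a null set, $u$ is continuous in $\Omega$, satisfies $V\le u\le W$ everywhere in $\Omega$, and has the following properties. 1. For every set $D$ whose closure is compact and contained in $\mathcal B_{V,W}$, the function $u$ is Hölder continuous on $D$ with some exponent $\alpha\in(0,1)$ depending only on $n$ and $D$. In particular, $u$ is continuous in $\mathcal B_{V,W}$. 2. $u$ is harmonic in $\{x\in\Omega: |u(x)|<1\}$, subharmonic in $\{x\in\Omega: u(x)<1\}$ and superharmonic in $\{x\in\Omega: u(x)>-1\}$. -/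

import Mathlib

open Set Filter Topology MeasureTheory
open scoped NNReal ContDiff Gradient Laplacian

namespace FreeBdry

/-- Euclidean space of dimension `d + 1`; the last coordinate is singled out. -/
abbrev Space (d : ℕ) : Type := EuclideanSpace ℝ (Fin (d + 1))

/-- The cylinder of all `x = (x', t)` with `|x'| < R` and `|t| < h`, where `t` is the last
coordinate and `x'` consists of the other `d` coordinates. -/
def cylinder (d : ℕ) (R h : ℝ) : Set (Space d) :=
  {x | Real.sqrt (∑ i : Fin d, x i.castSucc ^ 2) < R ∧ |x (Fin.last d)| < h}

section Classical

variable {d : ℕ}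

/-- The interphase of `w` in `U`, that is, the set of points of `U` at which `|w| < 1`. -/
def interphase (U : Set (Space d)) (w : Space d → ℝ) : Set (Space d) :=
  {x | x ∈ U ∧ |w x| < 1}

/-- The upper free boundary, `∂{w = 1} ∩ U`. -/
def freeBdryPlus (U : Set (Space d)) (w : Space d → ℝ) : Set (Space d) :=
  frontier {x | x ∈ U ∧ w x = 1} ∩ U

/-- The lower free boundary, `∂{w = -1} ∩ U`. -/
def freeBdryMinus (U : Set (Space d)) (w : Space d → ℝ) : Set (Space d) :=
  frontier {x | x ∈ U ∧ w x = -1} ∩ U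

/-- `S` is an embedded hypersurface of class `C²`: near each of its points it is the zero set of
a `C²` function without critical points. The empty set is allowed. -/
def IsC2Hypersurface (S : Set (Space d)) : Prop :=
  ∀ p ∈ S, ∃ (N : Set (Space d)) (f : Space d → ℝ), IsOpen N ∧ p ∈ N ∧ ContDiffOn ℝ 2 f N ∧
    (∀ x ∈ N, ∇ f x ≠ 0) ∧ S ∩ N = {x | x ∈ N ∧ f x = 0}

/-- `w` is of class `C²` in the open set `A`, and all its derivatives of order at most two
extend continuously to the closure of `A` in `U`. -/
def IsC2UpToBoundary (U A : Set (Space d)) (w : Space d → ℝ) : Prop :=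
  ContDiffOn ℝ 2 w A ∧
    ∀ k : ℕ, k ≤ 2 → ∀ x ∈ closure A ∩ U, ∃ L, Tendsto (iteratedFDeriv ℝ k w) (𝓝[A] x) (𝓝 L)

/-- At `x`, the gradient of `w`, taken from inside the open set `A`, has a limit whose norm
satisfies `P`. -/
def BdryGradient (A : Set (Space d)) (w : Space d → ℝ) (x : Space d) (P : ℝ → Prop) : Prop :=
  ∃ g : Space d, Tendsto (∇ w) (𝓝[A] x) (𝓝 g) ∧ P ‖g‖

/-- Classical subsolutions in `U` of the free boundary problem `Δw = 0` in `{|w| < 1}`,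
`w = ±1` elsewhere, `|∇w| = 1` on the free boundary. -/
structure IsClassicalSubsolution (U : Set (Space d)) (w : Space d → ℝ) : Prop where
  continuousOn : ContinuousOn w U
  abs_le_one : ∀ x ∈ U, |w x| ≤ 1
  smooth : IsC2UpToBoundary U (interphase U w) w
  laplacian_nonneg : ∀ x ∈ interphase U w, 0 ≤ Δ w x
  surface_plus : IsC2Hypersurface (freeBdryPlus U w)
  surface_minus : IsC2Hypersurface (freeBdryMinus U w)
  gradient_minus : ∀ x ∈ freeBdryMinus U w, BdryGradient (interphase U w) w x fun s => 1 ≤ s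
  gradient_plus : ∀ x ∈ freeBdryPlus U w, BdryGradient (interphase U w) w x fun s => s ≤ 1

/-- Classical supersolutions in `U` of the same free boundary problem. -/
structure IsClassicalSupersolution (U : Set (Space d)) (w : Space d → ℝ) : Prop where
  continuousOn : ContinuousOn w U
  abs_le_one : ∀ x ∈ U, |w x| ≤ 1
  smooth : IsC2UpToBoundary U (interphase U w) w
  laplacian_nonpos : ∀ x ∈ interphase U w, Δ w x ≤ 0
  surface_plus : IsC2Hypersurface (freeBdryPlus U w)
  surface_minus : IsC2Hypersurface (freeBdryMinus U w)
  gradient_minus : ∀ x ∈ freeBdryMinus U w,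
    BdryGradient (interphase U w) w x fun s => 0 < s ∧ s ≤ 1
  gradient_plus : ∀ x ∈ freeBdryPlus U w, BdryGradient (interphase U w) w x fun s => 1 ≤ s

/-- A function is subharmonic in `G` if it is upper semicontinuous there and its value at the
centre of any closed ball contained in `G` is at most its average over the ball. -/
def SubharmonicOn (u : Space d → ℝ) (G : Set (Space d)) : Prop :=
  UpperSemicontinuousOn u G ∧
    ∀ x r, 0 < r → Metric.closedBall x r ⊆ G →
      IntegrableOn u (Metric.ball x r) ∧ u x ≤ ⨍ y in Metric.ball x r, u y

/-- A function is superharmonic in `G` if its negative is subharmonic in `G`. -/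
def SuperharmonicOn (u : Space d → ℝ) (G : Set (Space d)) : Prop :=
  SubharmonicOn (fun x => -u x) G

end Classical

section Sobolev

variable {d : ℕ}

/-- `g` is the weak gradient of `u` in the open set `Ω`. -/
def IsWeakGradient (Ω : Set (Space d)) (u : Space d → ℝ) (g : Space d → Space d) : Prop :=
  LocallyIntegrableOn u Ω ∧ LocallyIntegrableOn g Ω ∧
    ∀ φ : Space d → ℝ, ContDiff ℝ ∞ φ → HasCompactSupport φ → tsupport φ ⊆ Ω →
      ∀ e : Space d, ∫ x in Ω, u x * fderiv ℝ φ x e = -∫ x in Ω, φ x * inner ℝ (g x) e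

/-- The Sobolev space `H¹(Ω)`. -/
def MemH1 (Ω : Set (Space d)) (u : Space d → ℝ) : Prop :=
  MemLp u 2 (volume.restrict Ω) ∧
    ∃ g : Space d → Space d, MemLp g 2 (volume.restrict Ω) ∧ IsWeakGradient Ω u g

open Classical in
/-- The weak gradient of `u` in `Ω` (unique up to null sets), or zero if there is none. -/
noncomputable def weakGradient (Ω : Set (Space d)) (u : Space d → ℝ) : Space d → Space d :=
  if h : ∃ g, IsWeakGradient Ω u g then h.choose else 0

/-- The energy `I(u, Ω)`, the integral over `Ω` of `|∇u|² + χ_{(-1, 1)}(u)`, for `u ∈ H¹(Ω)`. -/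
noncomputable def energy (Ω : Set (Space d)) (u : Space d → ℝ) : ℝ :=
  ∫ x in Ω, (‖weakGradient Ω u x‖ ^ 2 + (Ioo (-1 : ℝ) 1).indicator 1 (u x))

/-- The functions of class `H¹(Ω)` with `V ≤ v ≤ W` almost everywhere in `Ω`. -/
def admissible (V W : Space d → ℝ) (Ω : Set (Space d)) : Set (Space d → ℝ) :=
  {v | MemH1 Ω v ∧ ∀ᵐ x ∂volume.restrict Ω, V x ≤ v x ∧ v x ≤ W x}

/-- `u` minimizes the energy on `Ω` among all admissible functions. -/
def IsConstrainedMinimizer (V W : Space d → ℝ) (Ω : Set (Space d)) (u : Space d → ℝ) : Prop :=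
  u ∈ admissible V W Ω ∧ ∀ v ∈ admissible V W Ω, energy Ω u ≤ energy Ω v

end Sobolev

end FreeBdry

/-! Let `G` be the part of the cylinder where `V < 1` and `-1 < W`. It contains $\mathcal B_{V,W}$,
and on its complement in the cylinder both obstacles equal the same constant 1 or -1, so there $u$
is forced and continuity follows by squeezing. In `G` the obstacle `V` is subharmonic and `W`
superharmonic as distributions: `V` is subharmonic where $|V|<1$, and the value -1 is its minimum
(`distSub_of_laplacian_nonneg`).

The central estimate is the variational inequality `IsObstacleMinimizer.two_mul_integral_le`: for
smooth $\varphi\ge 0$ and a cutoff $\eta$ in `G`, equal to 1 wherever $\varphi\ne 0$, one has $2\int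
u\,\Delta\varphi\le\int|\nabla\varphi|^2+|\{\eta\text{-support}\}\cap\{|u|=1\}|$. Formally one
compares $u$ with $\min(u+\varphi,W)$; truncating by a superharmonic function does not raise the
Dirichlet integral, and the penalty changes only on the support of the cutoff. To avoid truncating
Sobolev functions, $u$ and `W` are first replaced by mollifications $u_s$, $W_s$ near the support of
$\varphi$. Sub- and superharmonicity give $V\le u_s\le W_s\le W$ there, so $\min(u_s+\varphi,W_s)$
is admissible, and then $s\to0$. The reflection $u\mapsto-u$, which exchanges the obstacles, gives
the opposite inequality.

Regularity follows by testing with one bump. For a radial kernel $k_s$ there is a nonnegative bump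
$T_s$ supported in the ball of radius $s$ with $\partial_s k_s=s^{-(d+1)}\Delta T_s$
(`hasDerivAt_kern`). Inserting $T_s$ bounds $|\partial_s u_s(p)|$ by a constant (`abs_moll_sub_le`).
Hence $u_s\to\bar u$ at every point of `G` with error $O(s)$, while $u_s$ is Lipschitz with constant
$O(1/s)$; choosing $s=|x-y|^{1/2}$ gives Hölder continuity with exponent 1/2
(`exists_holderOnWith_precise`).

Where $|\bar u|<1$ the measure term vanishes. Applying the inequality to $t\varphi$, dividing by $t$
and letting $t\to0$, for $u$ and $-u$, shows that $u$ is harmonic as a distribution; mollifications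
then do not depend on the scale, so $\bar u$ is smooth. Finally -1 is the minimum of $\bar u$, so
harmonicity in $\{|\bar u|<1\}$ gives subharmonicity in $\{\bar u<1\}$ by the same lemma as for `V`,
and reflection gives superharmonicity. -/

namespace FreeBdry

/-! ### Second derivatives, Green's identities against test functions, and radial Laplacians. -/

section

variable {d : ℕ}

/-- The `i`-th vector of the standard basis. -/
noncomputable abbrev stdVec (i : Fin (d + 1)) : Space d := EuclideanSpace.single i (1 : ℝ)

/-- Second derivatives in a fixed direction. -/
noncomputable def dd (f : Space d → ℝ) (e x : Space d) : ℝ :=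
  fderiv ℝ (fun y => fderiv ℝ f y e) x e

lemma iteratedFDeriv_two_eq_dd {f : Space d → ℝ} {x : Space d} (hf : ContDiffAt ℝ 2 f x)
    (e : Space d) : iteratedFDeriv ℝ 2 f x ![e, e] = dd f e x := by
  rw [iteratedFDeriv_two_apply, dd]
  have h : DifferentiableAt ℝ (fderiv ℝ f) x :=
    (hf.fderiv_right (m := 1) (by norm_num)).differentiableAt (by norm_num)
  rw [fderiv_clm_apply h (differentiableAt_const e)]
  simp

lemma laplacian_eq_sum_dd {f : Space d → ℝ} {x : Space d} (hf : ContDiffAt ℝ 2 f x) :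
    Δ f x = ∑ i, dd f (stdVec i) x := by
  rw [InnerProductSpace.laplacian_eq_iteratedFDeriv_orthonormalBasis f
    (EuclideanSpace.basisFun (Fin (d + 1)) ℝ)]
  refine Finset.sum_congr rfl fun i _ => ?_
  rw [iteratedFDeriv_two_eq_dd hf, EuclideanSpace.basisFun_apply]

lemma inner_eq_sum_stdVec (a b : Space d) :
    inner ℝ a b = ∑ i, inner ℝ a (stdVec i) * inner ℝ b (stdVec i) := by
  simp [PiLp.inner_apply, mul_comm, stdVec]

lemma norm_sq_eq_sum_stdVec (a : Space d) : ‖a‖ ^ 2 = ∑ i, (inner ℝ a (stdVec i)) ^ 2 := by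
  rw [← real_inner_self_eq_norm_sq, inner_eq_sum_stdVec]
  simp [sq]

lemma integrable_mul_of_continuousOn {f φ : Space d → ℝ} {U : Set (Space d)}
    (hf : ContinuousOn f U) (hφ : Continuous φ) (hc : HasCompactSupport φ) (hs : tsupport φ ⊆ U) :
    Integrable (fun x => f x * φ x) := by
  rw [← integrableOn_iff_integrable_of_support_subset (s := tsupport φ)]
  · exact ((hf.mono hs).mul hφ.continuousOn).integrableOn_compact hc
  · intro x hx
    exact subset_tsupport _ (fun h => hx (by simp [h]))

lemma hasCompactSupport_fderiv_apply {φ : Space d → ℝ} (hc : HasCompactSupport φ) (e : Space d) :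
    HasCompactSupport fun x => fderiv ℝ φ x e := hc.fderiv_apply (𝕜 := ℝ) e

lemma tsupport_partial_subset {φ : Space d → ℝ} (e : Space d) :
    tsupport (fun x => fderiv ℝ φ x e) ⊆ tsupport φ := tsupport_fderiv_apply_subset ℝ e

lemma contDiff_fderiv_apply {φ : Space d → ℝ} (h : ContDiff ℝ ∞ φ) (e : Space d) :
    ContDiff ℝ ∞ fun x => fderiv ℝ φ x e :=
  (h.fderiv_right (m := ∞) (by simp)).clm_apply contDiff_const

lemma contDiffOn_fderiv_apply {f : Space d → ℝ} {U : Set (Space d)} {n : ℕ} (hU : IsOpen U)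
    (h : ContDiffOn ℝ (n + 1) f U) (e : Space d) :
    ContDiffOn ℝ n (fun x => fderiv ℝ f x e) U :=
  (h.fderiv_of_isOpen hU le_rfl).clm_apply contDiffOn_const

/-- Integration by parts against a test function. -/
lemma integral_mul_fderiv_test {f φ : Space d → ℝ} {U : Set (Space d)} (hU : IsOpen U)
    (hf : ContDiffOn ℝ 1 f U) (hφ : ContDiff ℝ ∞ φ) (hc : HasCompactSupport φ)
    (hs : tsupport φ ⊆ U) (e : Space d) :
    ∫ x, f x * fderiv ℝ φ x e = -∫ x, fderiv ℝ f x e * φ x := by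
  have h0 : ContDiffOn ℝ ((0 : ℕ) : WithTop ℕ∞) (fun x => fderiv ℝ f x e) U :=
    contDiffOn_fderiv_apply hU (by simpa using hf) e
  refine integral_mul_fderiv_eq_neg_fderiv_mul_of_integrable
    (integrable_mul_of_continuousOn h0.continuousOn hφ.continuous hc hs)
    (integrable_mul_of_continuousOn hf.continuousOn (contDiff_fderiv_apply hφ e).continuous
      (hasCompactSupport_fderiv_apply hc e) ((tsupport_partial_subset e).trans hs))
    (integrable_mul_of_continuousOn hf.continuousOn hφ.continuous hc hs) ?_ ?_
  · intro x hx
    exact (hf.contDiffAt (hU.mem_nhds (hs hx))).differentiableAt (by norm_num)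
  · intro x _
    exact hφ.differentiable (by simp) x

lemma contDiff_dd {φ : Space d → ℝ} (h : ContDiff ℝ ∞ φ) (e : Space d) :
    ContDiff ℝ ∞ (dd φ e) := contDiff_fderiv_apply (contDiff_fderiv_apply h e) e

lemma tsupport_dd_subset {φ : Space d → ℝ} (e : Space d) : tsupport (dd φ e) ⊆ tsupport φ :=
  (tsupport_partial_subset e).trans (tsupport_partial_subset e)

lemma hasCompactSupport_dd {φ : Space d → ℝ} (hc : HasCompactSupport φ) (e : Space d) :
    HasCompactSupport (dd φ e) :=
  hasCompactSupport_fderiv_apply (hasCompactSupport_fderiv_apply hc e) e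

lemma laplacian_eq_sum_dd_of_smooth {φ : Space d → ℝ} (h : ContDiff ℝ ∞ φ) :
    Δ φ = fun x => ∑ i, dd φ (stdVec i) x := by
  ext x
  exact laplacian_eq_sum_dd (h.contDiffAt.of_le (by norm_cast))

lemma contDiff_laplacian {φ : Space d → ℝ} (h : ContDiff ℝ ∞ φ) : ContDiff ℝ ∞ (Δ φ) := by
  rw [laplacian_eq_sum_dd_of_smooth h]
  exact ContDiff.sum fun i _ => contDiff_dd h _

lemma laplacian_eq_zero_of_notMem_tsupport {φ : Space d → ℝ} {x : Space d}
    (hx : x ∉ tsupport φ) : Δ φ x = 0 := by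
  have h : φ =ᶠ[𝓝 x] fun _ => (0 : ℝ) := notMem_tsupport_iff_eventuallyEq.1 hx
  rw [InnerProductSpace.laplacian_congr_nhds h |>.self_of_nhds]
  simp

lemma tsupport_laplacian_subset (φ : Space d → ℝ) : tsupport (Δ φ) ⊆ tsupport φ :=
  closure_minimal (fun _ hx => by_contra fun h => hx (laplacian_eq_zero_of_notMem_tsupport h))
    (isClosed_tsupport φ)

lemma hasCompactSupport_laplacian {φ : Space d → ℝ} (hc : HasCompactSupport φ) :
    HasCompactSupport (Δ φ) := hc.mono' (subset_trans subset_closure (tsupport_laplacian_subset φ))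

/-- Green's second identity against a test function. -/
lemma integral_mul_laplacian {f φ : Space d → ℝ} {U : Set (Space d)} (hU : IsOpen U)
    (hf : ContDiffOn ℝ 2 f U) (hφ : ContDiff ℝ ∞ φ) (hc : HasCompactSupport φ)
    (hs : tsupport φ ⊆ U) : ∫ x, f x * Δ φ x = ∫ x, Δ f x * φ x := by
  have h1 (i : Fin (d + 1)) : ContDiffOn ℝ 1 (fun x => fderiv ℝ f x (stdVec i)) U :=
    contDiffOn_fderiv_apply (n := 1) hU (by norm_num; exact hf) _
  have h2 (i : Fin (d + 1)) : ContinuousOn (dd f (stdVec i)) U :=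
    (contDiffOn_fderiv_apply (n := 0) hU (by simpa using h1 i) (stdVec i)).continuousOn
  have hl : ∫ x, Δ f x * φ x = ∫ x, ∑ i, dd f (stdVec i) x * φ x := by
    refine integral_congr_ae (Eventually.of_forall fun x => ?_)
    by_cases hx : x ∈ tsupport φ
    · change Δ f x * φ x = _
      rw [laplacian_eq_sum_dd (hf.contDiffAt (hU.mem_nhds (hs hx))), Finset.sum_mul]
    · simp [image_eq_zero_of_notMem_tsupport hx]
  rw [hl, laplacian_eq_sum_dd_of_smooth hφ]
  simp_rw [Finset.mul_sum]
  rw [integral_finsetSum, integral_finsetSum]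
  · refine Finset.sum_congr rfl fun i _ => ?_
    have ha := integral_mul_fderiv_test hU (hf.of_le (by norm_num))
      (contDiff_fderiv_apply hφ (stdVec i)) (hasCompactSupport_fderiv_apply hc (stdVec i))
      ((tsupport_partial_subset _).trans hs) (stdVec i)
    have hb := integral_mul_fderiv_test hU (h1 i) hφ hc hs (stdVec i)
    unfold dd
    rw [ha, hb, neg_neg]
  · intro i _
    exact integrable_mul_of_continuousOn (h2 i) hφ.continuous hc hs
  · intro i _
    exact integrable_mul_of_continuousOn hf.continuousOn (contDiff_dd hφ _).continuous
      (hasCompactSupport_dd hc _) ((tsupport_dd_subset _).trans hs)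

/-- Green's first identity against a test function. -/
lemma integral_inner_gradient {f φ : Space d → ℝ} (hf : ContDiff ℝ ∞ f) (hφ : ContDiff ℝ ∞ φ)
    (hc : HasCompactSupport φ) :
    ∫ x, inner ℝ (∇ f x) (∇ φ x) = -∫ x, Δ f x * φ x := by
  rw [laplacian_eq_sum_dd_of_smooth hf]
  simp_rw [fun x => inner_eq_sum_stdVec (∇ f x) (∇ φ x), inner_gradient_left, Finset.sum_mul]
  rw [integral_finsetSum, integral_finsetSum, ← Finset.sum_neg_distrib]
  · refine Finset.sum_congr rfl fun i _ => ?_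
    exact integral_mul_fderiv_test isOpen_univ
      ((contDiff_fderiv_apply hf (stdVec i)).of_le (by simp)).contDiffOn hφ hc
      (subset_univ _) (stdVec i)
  · intro i _
    exact integrable_mul_of_continuousOn (contDiff_dd hf _).continuous.continuousOn hφ.continuous
      hc (subset_univ _)
  · intro i _
    exact integrable_mul_of_continuousOn (contDiff_fderiv_apply hf _).continuous.continuousOn
      (contDiff_fderiv_apply hφ _).continuous (hasCompactSupport_fderiv_apply hc _) (subset_univ _)

lemma continuous_gradient {f : Space d → ℝ} (hf : ContDiff ℝ ∞ f) : Continuous (∇ f) :=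
  (InnerProductSpace.toDual ℝ (Space d)).symm.continuous.comp
    (hf.continuous_fderiv (by simp))

lemma tsupport_gradient_subset (φ : Space d → ℝ) : tsupport (∇ φ) ⊆ tsupport φ := by
  refine closure_minimal (fun x hx => ?_) (isClosed_tsupport φ)
  by_contra h
  have h2 : fderiv ℝ φ x = 0 := by
    by_contra h3
    exact h (support_fderiv_subset ℝ h3)
  exact hx (by simp [gradient, h2])

lemma hasCompactSupport_gradient {φ : Space d → ℝ} (hc : HasCompactSupport φ) :
    HasCompactSupport (∇ φ) := hc.mono' (subset_trans subset_closure (tsupport_gradient_subset φ))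

lemma ext_inner_stdVec {a b : Space d} (h : ∀ e, inner ℝ a e = (inner ℝ b e : ℝ)) : a = b :=
  ext_inner_right ℝ h

lemma gradient_fun_add {f g : Space d → ℝ} {x : Space d} (hf : DifferentiableAt ℝ f x)
    (hg : DifferentiableAt ℝ g x) : ∇ (fun y => f y + g y) x = ∇ f x + ∇ g x := by
  refine ext_inner_stdVec fun e => ?_
  rw [inner_add_left, inner_gradient_left, inner_gradient_left, inner_gradient_left,
    fderiv_fun_add hf hg, add_apply]

lemma gradient_fun_sub {f g : Space d → ℝ} {x : Space d} (hf : DifferentiableAt ℝ f x)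
    (hg : DifferentiableAt ℝ g x) : ∇ (fun y => f y - g y) x = ∇ f x - ∇ g x := by
  refine ext_inner_stdVec fun e => ?_
  rw [inner_sub_left, inner_gradient_left, inner_gradient_left, inner_gradient_left,
    fderiv_fun_sub hf hg, sub_apply]

lemma gradient_fun_mul {f g : Space d → ℝ} {x : Space d} (hf : DifferentiableAt ℝ f x)
    (hg : DifferentiableAt ℝ g x) :
    ∇ (fun y => f y * g y) x = f x • ∇ g x + g x • ∇ f x := by
  refine ext_inner_stdVec fun e => ?_
  rw [inner_add_left, inner_smul_left, inner_smul_left, inner_gradient_left, inner_gradient_left,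
    inner_gradient_left, fderiv_fun_mul hf hg]
  simp

lemma gradient_fun_comp {f : Space d → ℝ} {F : ℝ → ℝ} {x : Space d} (hf : DifferentiableAt ℝ f x)
    (hF : DifferentiableAt ℝ F (f x)) :
    ∇ (fun y => F (f y)) x = deriv F (f x) • ∇ f x := by
  refine ext_inner_stdVec fun e => ?_
  rw [inner_smul_left, inner_gradient_left, inner_gradient_left,
    fderiv_fun_comp x hF hf]
  simp [mul_comm]

/-- The Laplacian of a radial function. -/
lemma laplacian_radial {ϑ : ℝ → ℝ} (h : ContDiff ℝ ∞ ϑ) (p x : Space d) :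
    Δ (fun y => ϑ (‖y - p‖ ^ 2)) x =
      4 * ‖x - p‖ ^ 2 * deriv (deriv ϑ) (‖x - p‖ ^ 2) + 2 * (d + 1) * deriv ϑ (‖x - p‖ ^ 2) := by
  have hq (y : Space d) : HasFDerivAt (fun y => ‖y - p‖ ^ 2) (2 • innerSL ℝ (y - p)) y := by
    simpa using ((hasFDerivAt_id y).sub_const p).norm_sq
  have hd : ContDiff ℝ ∞ (deriv ϑ) := (contDiff_infty_iff_deriv.1 h).2
  have h1 (e y : Space d) : fderiv ℝ (fun y => ϑ (‖y - p‖ ^ 2)) y e =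
      deriv ϑ (‖y - p‖ ^ 2) * (2 * inner ℝ (y - p) e) := by
    have := ((h.differentiable (by simp) (‖y - p‖ ^ 2)).hasDerivAt).comp_hasFDerivAt y (hq y)
    have h2 := this.fderiv
    rw [show (fun y => ϑ (‖y - p‖ ^ 2)) = ϑ ∘ fun y => ‖y - p‖ ^ 2 from rfl, h2]
    simp [inner_sub_left]
  have h2 (e : Space d) : dd (fun y => ϑ (‖y - p‖ ^ 2)) e x =
      4 * inner ℝ (x - p) e ^ 2 * deriv (deriv ϑ) (‖x - p‖ ^ 2)
        + 2 * deriv ϑ (‖x - p‖ ^ 2) * ‖e‖ ^ 2 := by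
    unfold dd
    simp_rw [h1]
    have ha := ((hd.differentiable (by simp) (‖x - p‖ ^ 2)).hasDerivAt).comp_hasFDerivAt x (hq x)
    have hb : HasFDerivAt (fun y : Space d => 2 * inner ℝ (y - p) e)
        ((2 : ℝ) • innerSL ℝ e) x := by
      have := ((innerSL ℝ e).hasFDerivAt (x := x - p)).comp x ((hasFDerivAt_id x).sub_const p)
      have h3 := this.const_mul 2
      refine (h3.congr_fderiv ?_).congr_of_eventuallyEq (Eventually.of_forall fun y => ?_)
      · ext; simp
      · simp [real_inner_comm]
    have hab := (ha.mul hb).fderiv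
    have : (fun y => deriv ϑ (‖y - p‖ ^ 2) * (2 * inner ℝ (y - p) e)) =
      ((deriv ϑ) ∘ fun y => ‖y - p‖ ^ 2) * fun y => 2 * inner ℝ (y - p) e := rfl
    rw [this, hab]
    simp only [add_apply, smul_apply, innerSL_apply_apply,
      Function.comp, smul_eq_mul, real_inner_self_eq_norm_sq, nsmul_eq_mul]
    push_cast
    ring
  have hc : ContDiff ℝ ∞ (fun y : Space d => ϑ (‖y - p‖ ^ 2)) :=
    h.comp ((contDiff_id.sub contDiff_const).norm_sq ℝ)
  rw [laplacian_eq_sum_dd_of_smooth hc]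
  simp only [h2]
  rw [Finset.sum_add_distrib, norm_sq_eq_sum_stdVec (x - p)]
  simp [Finset.mul_sum, Finset.sum_mul]
  ring

end

/-! ### Radial mollifiers and their dependence on the scale. -/

section

variable {d : ℕ}

/-- Profiles of radial mollifiers: smooth, nonnegative and supported in `(-∞, 1]`. -/
structure IsProfile (θ : ℝ → ℝ) : Prop where
  smooth : ContDiff ℝ ∞ θ
  nonneg : ∀ t, 0 ≤ θ t
  eq_zero : ∀ t, 1 ≤ t → θ t = 0

/-- The primitive of a profile that vanishes for `t ≥ 1`. -/
noncomputable def prim (θ : ℝ → ℝ) (t : ℝ) : ℝ := ∫ τ in t..1, θ τ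

/-- The radial kernel of scale `s` with profile `θ`. -/
noncomputable def kern (θ : ℝ → ℝ) (s : ℝ) (x : Space d) : ℝ :=
  (s ^ (d + 1))⁻¹ * θ (‖x‖ ^ 2 / s ^ 2)

/-- The bump whose Laplacian generates the dilations of the radial kernel. -/
noncomputable def tbump (θ : ℝ → ℝ) (p : Space d) (s : ℝ) (y : Space d) : ℝ :=
  s / 2 * prim θ (‖y - p‖ ^ 2 / s ^ 2)

/-- The mass of the radial kernel with profile `θ`. -/
noncomputable def mass (d : ℕ) (θ : ℝ → ℝ) : ℝ := ∫ x : Space d, θ (‖x‖ ^ 2)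

/-- Mollification by the radial kernel. -/
noncomputable def moll {F : Type*} [NormedAddCommGroup F] [NormedSpace ℝ F]
    (θ : ℝ → ℝ) (s : ℝ) (f : Space d → F) : Space d → F :=
  convolution (kern θ s) f (ContinuousLinearMap.lsmul ℝ ℝ) volume

variable {θ : ℝ → ℝ}

lemma hasDerivAt_prim (hθ : IsProfile θ) (t : ℝ) : HasDerivAt (prim θ) (-θ t) t :=
  intervalIntegral.integral_hasDerivAt_left (hθ.smooth.continuous.intervalIntegrable _ _)
    hθ.smooth.continuous.aestronglyMeasurable.stronglyMeasurableAtFilter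
    hθ.smooth.continuous.continuousAt

lemma deriv_prim (hθ : IsProfile θ) : deriv (prim θ) = fun t => -θ t :=
  funext fun t => (hasDerivAt_prim hθ t).deriv

lemma contDiff_prim (hθ : IsProfile θ) : ContDiff ℝ ∞ (prim θ) := by
  rw [contDiff_infty_iff_deriv]
  exact ⟨fun t => (hasDerivAt_prim hθ t).differentiableAt, deriv_prim hθ ▸ hθ.smooth.neg⟩

lemma prim_eq_zero (hθ : IsProfile θ) {t : ℝ} (ht : 1 ≤ t) : prim θ t = 0 := by
  rw [prim, intervalIntegral.integral_symm, intervalIntegral.integral_zero_ae, neg_zero]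
  refine Eventually.of_forall fun τ hτ => hθ.eq_zero τ ?_
  rw [uIoc_of_le ht] at hτ
  exact hτ.1.le

lemma prim_nonneg (hθ : IsProfile θ) (t : ℝ) : 0 ≤ prim θ t := by
  rcases le_total 1 t with h | h
  · exact (prim_eq_zero hθ h).ge
  · exact intervalIntegral.integral_nonneg h fun τ _ => hθ.nonneg τ

lemma contDiff_kern (hθ : IsProfile θ) (s : ℝ) : ContDiff ℝ ∞ (kern (d := d) θ s) :=
  contDiff_const.mul (hθ.smooth.comp ((contDiff_id.norm_sq ℝ).div_const _))

lemma kern_nonneg (hθ : IsProfile θ) {s : ℝ} (hs : 0 ≤ s) (x : Space d) : 0 ≤ kern θ s x :=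
  mul_nonneg (by positivity) (hθ.nonneg _)

lemma one_le_sq_div_sq {a s : ℝ} (hs : 0 < s) (h : s ≤ a) : 1 ≤ a ^ 2 / s ^ 2 := by
  rw [one_le_div (by positivity)]
  gcongr

lemma kern_eq_zero (hθ : IsProfile θ) {s : ℝ} (hs : 0 < s) {x : Space d} (hx : s ≤ ‖x‖) :
    kern θ s x = 0 := by
  rw [kern, hθ.eq_zero _ (one_le_sq_div_sq hs hx), mul_zero]

lemma support_kern_subset (hθ : IsProfile θ) {s : ℝ} (hs : 0 < s) :
    Function.support (kern (d := d) θ s) ⊆ Metric.ball 0 s := by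
  intro x hx
  rw [mem_ball_zero_iff]
  by_contra! h
  exact hx (kern_eq_zero hθ hs h)

lemma hasCompactSupport_kern (hθ : IsProfile θ) {s : ℝ} (hs : 0 < s) :
    HasCompactSupport (kern (d := d) θ s) :=
  HasCompactSupport.of_support_subset_isCompact (isCompact_closedBall 0 s)
    ((support_kern_subset hθ hs).trans Metric.ball_subset_closedBall)

lemma continuous_kern (hθ : IsProfile θ) (s : ℝ) : Continuous (kern (d := d) θ s) :=
  (contDiff_kern hθ s).continuous

lemma integral_kern {s : ℝ} (hs : 0 < s) : ∫ x, kern (d := d) θ s x = mass d θ := by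
  have h := Measure.integral_comp_inv_smul_of_nonneg (volume : Measure (Space d))
    (fun x : Space d => θ (‖x‖ ^ 2)) hs.le
  rw [finrank_euclideanSpace, Fintype.card_fin] at h
  have h2 (x : Space d) : kern θ s x = (s ^ (d + 1))⁻¹ * θ (‖s⁻¹ • x‖ ^ 2) := by
    rw [kern, norm_smul, norm_inv, Real.norm_of_nonneg hs.le, mul_pow, inv_pow, div_eq_inv_mul]
  simp_rw [h2]
  rw [integral_const_mul, h, smul_eq_mul, mass, inv_mul_cancel_left₀ (by positivity)]

lemma integrable_kern (hθ : IsProfile θ) {s : ℝ} (hs : 0 < s) :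
    Integrable (kern (d := d) θ s) :=
  (continuous_kern hθ s).integrable_of_hasCompactSupport (hasCompactSupport_kern hθ hs)

lemma contDiff_tbump (hθ : IsProfile θ) (p : Space d) (s : ℝ) : ContDiff ℝ ∞ (tbump θ p s) :=
  contDiff_const.mul ((contDiff_prim hθ).comp
    (((contDiff_id.sub contDiff_const).norm_sq ℝ).div_const _))

lemma tbump_nonneg (hθ : IsProfile θ) (p : Space d) {s : ℝ} (hs : 0 < s) (y : Space d) :
    0 ≤ tbump θ p s y := mul_nonneg (by positivity) (prim_nonneg hθ _)

lemma tbump_eq_zero (hθ : IsProfile θ) {p : Space d} {s : ℝ} (hs : 0 < s) {y : Space d}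
    (hy : y ∉ Metric.ball p s) : tbump θ p s y = 0 := by
  rw [Metric.mem_ball, not_lt, dist_eq_norm] at hy
  rw [tbump, prim_eq_zero hθ (one_le_sq_div_sq hs hy), mul_zero]

lemma tsupport_tbump_subset (hθ : IsProfile θ) (p : Space d) {s : ℝ} (hs : 0 < s) :
    tsupport (tbump θ p s) ⊆ Metric.closedBall p s :=
  closure_minimal (fun _ hy => Metric.ball_subset_closedBall
    (by_contra fun h => hy (tbump_eq_zero hθ hs h))) Metric.isClosed_closedBall

lemma hasCompactSupport_tbump (hθ : IsProfile θ) (p : Space d) {s : ℝ} (hs : 0 < s) :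
    HasCompactSupport (tbump θ p s) :=
  HasCompactSupport.of_support_subset_isCompact (isCompact_closedBall p s)
    (subset_closure.trans (tsupport_tbump_subset hθ p hs))

/-- The factor `s / 2` in `tbump` and the profile `prim θ`, whose derivative is `-θ`, are chosen so
that this expression is exactly `s ^ (d + 1)` times the scale derivative of the kernel. -/
lemma laplacian_tbump (hθ : IsProfile θ) (p : Space d) (s : ℝ) (y : Space d) :
    Δ (tbump θ p s) y = -(2 * ‖y - p‖ ^ 2 / s ^ 3 * deriv θ (‖y - p‖ ^ 2 / s ^ 2))
      - (d + 1) / s * θ (‖y - p‖ ^ 2 / s ^ 2) := by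
  -- For `s = 0` both sides vanish, because division by zero is zero.
  rcases eq_or_ne s 0 with rfl | hs
  · have : tbump θ p 0 = fun _ => (0 : ℝ) := by ext; simp [tbump]
    rw [this]
    simp
  have h1 : ∀ q : ℝ, HasDerivAt (fun q : ℝ => s / 2 * prim θ (q / s ^ 2))
      (-(1 / (2 * s)) * θ (q / s ^ 2)) q := by
    intro q
    have := ((hasDerivAt_prim hθ (q / s ^ 2)).comp q
      ((hasDerivAt_id q).div_const (s ^ 2))).const_mul (s / 2)
    refine this.congr_deriv ?_
    field_simp
  have h1' : deriv (fun q : ℝ => s / 2 * prim θ (q / s ^ 2)) =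
      fun q => -(1 / (2 * s)) * θ (q / s ^ 2) := funext fun q => (h1 q).deriv
  have h2 : ∀ q : ℝ, HasDerivAt (fun q : ℝ => -(1 / (2 * s)) * θ (q / s ^ 2))
      (-(1 / (2 * s ^ 3)) * deriv θ (q / s ^ 2)) q := by
    intro q
    have := (((hθ.smooth.differentiable (by simp) (q / s ^ 2)).hasDerivAt).comp q
      ((hasDerivAt_id q).div_const (s ^ 2))).const_mul (-(1 / (2 * s)))
    refine this.congr_deriv ?_
    field_simp
  have hsm : ContDiff ℝ ∞ (fun q : ℝ => s / 2 * prim θ (q / s ^ 2)) :=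
    contDiff_const.mul ((contDiff_prim hθ).comp (contDiff_id.div_const _))
  have := laplacian_radial hsm p y
  rw [h1', (h2 _).deriv] at this
  change Δ (fun y => (fun q : ℝ => s / 2 * prim θ (q / s ^ 2)) (‖y - p‖ ^ 2)) y = _
  rw [this]
  field_simp
  ring

/-! ### Elementary properties of mollification. -/

section moll

variable {F : Type*} [NormedAddCommGroup F] [NormedSpace ℝ F] {f g : Space d → F}

lemma moll_apply (θ : ℝ → ℝ) (s : ℝ) (f : Space d → F) (x : Space d) :
    moll θ s f x = ∫ y, kern θ s (x - y) • f y := convolution_lsmul_swap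

lemma kern_sub_eq_zero (hθ : IsProfile θ) {s : ℝ} (hs : 0 < s) {x y : Space d}
    (h : y ∉ Metric.ball x s) : kern θ s (x - y) = 0 := by
  refine kern_eq_zero hθ hs ?_
  rw [Metric.mem_ball, not_lt, dist_comm, dist_eq_norm] at h
  exact h

lemma integrable_kern_smul (hθ : IsProfile θ) {s : ℝ} (hs : 0 < s)
    (hf : LocallyIntegrable f) (x : Space d) : Integrable fun y => kern θ s (x - y) • f y :=
  ((hasCompactSupport_kern hθ hs).convolutionExists_left
    (ContinuousLinearMap.lsmul ℝ ℝ) (continuous_kern hθ s) hf x).integrable_swap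

lemma moll_congr_ae (hθ : IsProfile θ) {s : ℝ} (hs : 0 < s) {x : Space d}
    (h : ∀ᵐ y, y ∈ Metric.ball x s → f y = g y) : moll θ s f x = moll θ s g x := by
  rw [moll_apply, moll_apply]
  refine integral_congr_ae ?_
  filter_upwards [h] with y hy
  by_cases hb : y ∈ Metric.ball x s
  · simp only [hy hb]
  · simp [kern_sub_eq_zero hθ hs hb]

lemma moll_mono_ae (hθ : IsProfile θ) {s : ℝ} (hs : 0 < s) {x : Space d} {f g : Space d → ℝ}
    (hf : LocallyIntegrable f) (hg : LocallyIntegrable g)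
    (h : ∀ᵐ y, y ∈ Metric.ball x s → f y ≤ g y) : moll θ s f x ≤ moll θ s g x := by
  rw [moll_apply, moll_apply]
  refine integral_mono_ae (integrable_kern_smul hθ hs hf x) (integrable_kern_smul hθ hs hg x) ?_
  filter_upwards [h] with y hy
  by_cases hb : y ∈ Metric.ball x s
  · exact mul_le_mul_of_nonneg_left (hy hb) (kern_nonneg hθ hs.le _)
  · simp [kern_sub_eq_zero hθ hs hb]

lemma contDiff_moll (hθ : IsProfile θ) {s : ℝ} (hs : 0 < s) (hf : LocallyIntegrable f) :
    ContDiff ℝ ∞ (moll θ s f) :=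
  (hasCompactSupport_kern hθ hs).contDiff_convolution_left _ (contDiff_kern hθ s) hf

lemma integral_kern_sub {s : ℝ} (hs : 0 < s) (x : Space d) :
    ∫ y, kern θ s (x - y) = mass d θ := by
  rw [integral_sub_left_eq_self (fun y => kern θ s y), integral_kern hs]

lemma integrable_kern_sub (hθ : IsProfile θ) {s : ℝ} (hs : 0 < s) (x : Space d) :
    Integrable fun y => kern θ s (x - y) := by
  simpa using integrable_kern_smul (F := ℝ) hθ hs (locallyIntegrable_const (1 : ℝ)) x

lemma moll_const [CompleteSpace F] {s : ℝ} (hs : 0 < s) (c : F) (x : Space d) :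
    moll θ s (fun _ => c) x = mass d θ • c := by
  rw [moll_apply, integral_smul_const, integral_kern_sub hs]

lemma moll_sub (hθ : IsProfile θ) {s : ℝ} (hs : 0 < s) (hf : LocallyIntegrable f)
    (hg : LocallyIntegrable g) (x : Space d) :
    moll θ s (fun y => f y - g y) x = moll θ s f x - moll θ s g x := by
  simp_rw [moll_apply, smul_sub]
  exact integral_sub (integrable_kern_smul hθ hs hf x) (integrable_kern_smul hθ hs hg x)

lemma moll_neg (θ : ℝ → ℝ) (s : ℝ) (f : Space d → F) (x : Space d) :
    moll θ s (fun y => -f y) x = -moll θ s f x := by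
  simp_rw [moll_apply, smul_neg, integral_neg]

/-- With `z = 0` this is the sup bound for mollifications; with `z = f x` it gives convergence at
points of continuity. -/
lemma norm_moll_sub_le [CompleteSpace F] (hθ : IsProfile θ) {s : ℝ} (hs : 0 < s)
    (hf : LocallyIntegrable f) {x : Space d} {z : F} {C : ℝ}
    (h : ∀ᵐ y, y ∈ Metric.ball x s → ‖f y - z‖ ≤ C) :
    ‖moll θ s f x - mass d θ • z‖ ≤ mass d θ * C := by
  rw [← moll_const hs z x, ← moll_sub hθ hs hf (locallyIntegrable_const z), moll_apply,
    ← integral_kern_sub hs x, ← integral_mul_const]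
  refine norm_integral_le_of_norm_le ((integrable_kern_sub hθ hs x).mul_const C) ?_
  filter_upwards [h] with y hy
  by_cases hb : y ∈ Metric.ball x s
  · rw [norm_smul, Real.norm_of_nonneg (kern_nonneg hθ hs.le _)]
    exact mul_le_mul_of_nonneg_left (hy hb) (kern_nonneg hθ hs.le _)
  · simp [kern_sub_eq_zero hθ hs hb]

lemma mass_nonneg (hθ : IsProfile θ) : 0 ≤ mass d θ := integral_nonneg fun _ => hθ.nonneg _

lemma tendsto_moll_of_continuousAt [CompleteSpace F] (hθ : IsProfile θ)
    (hf : LocallyIntegrable f) {x : Space d} (hx : ContinuousAt f x) :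
    Tendsto (fun s => moll θ s f x) (𝓝[>] 0) (𝓝 (mass d θ • f x)) := by
  rw [Metric.tendsto_nhds]
  intro ε hε
  have hm := mass_nonneg (d := d) hθ
  obtain ⟨δ, hδ, h⟩ := Metric.continuousAt_iff.1 hx (ε / (mass d θ + 1)) (by positivity)
  filter_upwards [Ioo_mem_nhdsGT hδ] with s hs
  rw [dist_eq_norm]
  refine (norm_moll_sub_le hθ hs.1 hf (C := ε / (mass d θ + 1))
    (Eventually.of_forall fun y hy => ?_)).trans_lt ?_
  · rw [← dist_eq_norm]
    exact (h (lt_trans hy hs.2)).le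
  · rw [mul_div_assoc', div_lt_iff₀ (by positivity)]
    nlinarith

end moll

/-- This plays the role of the heat equation for the family of kernels: the scale derivative is the
Laplacian of a nonnegative, compactly supported bump. Any bound on the pairing of `f` with
Laplacians of such bumps therefore controls how the averages of `f` vary with the scale. -/
lemma hasDerivAt_kern (hθ : IsProfile θ) {s : ℝ} (hs : 0 < s) (p y : Space d) :
    HasDerivAt (fun s => kern θ s (p - y)) ((s ^ (d + 1))⁻¹ * Δ (tbump θ p s) y) s := by
  rw [laplacian_tbump hθ]
  simp only [kern]
  rw [norm_sub_rev p y]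
  have h1 : HasDerivAt (fun s : ℝ => (s ^ (d + 1))⁻¹)
      (-(((d + 1 : ℕ) : ℝ) * s ^ d) / (s ^ (d + 1)) ^ 2) s := by
    simpa using (hasDerivAt_pow (d + 1) s).fun_inv (pow_ne_zero _ hs.ne')
  have h2 : HasDerivAt (fun s : ℝ => ‖y - p‖ ^ 2 / s ^ 2) (-(2 * ‖y - p‖ ^ 2 / s ^ 3)) s := by
    have := ((hasDerivAt_pow 2 s).fun_inv (pow_ne_zero _ hs.ne')).const_mul (‖y - p‖ ^ 2)
    simp only [← div_eq_mul_inv] at this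
    refine this.congr_deriv ?_
    field_simp
    push_cast
    ring
  have h3 := h1.mul (((hθ.smooth.differentiable (by simp) _).hasDerivAt).comp s h2)
  refine h3.congr_deriv ?_
  simp only [Function.comp]
  field_simp
  push_cast
  ring

/-- The derivative of a mollification with respect to the scale. -/
lemma hasDerivAt_moll (hθ : IsProfile θ) {f : Space d → ℝ} (hf : LocallyIntegrable f)
    (p : Space d) {s : ℝ} (hs : 0 < s) :
    HasDerivAt (fun s => moll θ s f p) ((s ^ (d + 1))⁻¹ * ∫ y, f y * Δ (tbump θ p s) y) s := by
  -- For scales in `[s / 2, 2 * s]` all kernel derivatives live in one closed ball and are jointly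
  -- continuous, so compactness supplies the dominating constant.
  have hcont : ContinuousOn (fun z : ℝ × Space d =>
      (z.1 ^ (d + 1))⁻¹ * Δ (tbump θ p z.1) z.2) (Icc (s / 2) (2 * s) ×ˢ Metric.closedBall p (2 * s)) := by
    simp_rw [laplacian_tbump hθ]
    have hz : ∀ z ∈ Icc (s / 2) (2 * s) ×ˢ Metric.closedBall p (2 * s), z.1 ≠ 0 := by
      rintro z ⟨hz, -⟩
      have := hz.1
      positivity [show 0 < z.1 by linarith]
    have hd : Continuous (deriv θ) := hθ.smooth.continuous_deriv (by simp)
    have hq : ContinuousOn (fun z : ℝ × Space d => ‖z.2 - p‖ ^ 2 / z.1 ^ 2)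
        (Icc (s / 2) (2 * s) ×ˢ Metric.closedBall p (2 * s)) :=
      ContinuousOn.div (by fun_prop) (by fun_prop) fun z h => pow_ne_zero _ (hz z h)
    refine ContinuousOn.mul (ContinuousOn.inv₀ (by fun_prop) fun z h => pow_ne_zero _ (hz z h)) ?_
    refine ContinuousOn.sub (ContinuousOn.neg (ContinuousOn.mul ?_ (hd.comp_continuousOn hq)))
      (ContinuousOn.mul ?_ (hθ.smooth.continuous.comp_continuousOn hq))
    · exact ContinuousOn.div (by fun_prop) (by fun_prop) fun z h => pow_ne_zero _ (hz z h)
    · exact ContinuousOn.div (by fun_prop) (by fun_prop) hz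
  obtain ⟨C, hC⟩ := (isCompact_Icc.prod (isCompact_closedBall p (2 * s))).exists_bound_of_continuousOn
    hcont
  have hmeas : AEStronglyMeasurable f volume := hf.aestronglyMeasurable
  have key := hasDerivAt_integral_of_dominated_loc_of_deriv_le (μ := volume)
    (F := fun s y => kern θ s (p - y) • f y)
    (F' := fun s y => (s ^ (d + 1))⁻¹ * Δ (tbump θ p s) y * f y) (x₀ := s)
    (s := Icc (s / 2) (2 * s))
    (bound := (Metric.closedBall p (2 * s)).indicator fun y => C * ‖f y‖)
    (Icc_mem_nhds (by linarith) (by linarith))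
    (by
      filter_upwards [lt_mem_nhds hs] with t ht
      exact (integrable_kern_smul hθ ht hf p).aestronglyMeasurable)
    (integrable_kern_smul hθ hs hf p)
    (((continuous_const.mul (contDiff_laplacian (contDiff_tbump hθ p s)).continuous)
      |>.aestronglyMeasurable).mul hmeas)
    (by
      refine Eventually.of_forall fun y t ht => ?_
      have ht0 : 0 < t := by linarith [ht.1]
      by_cases hy : y ∈ Metric.closedBall p (2 * s)
      · rw [indicator_of_mem hy, norm_mul]
        exact mul_le_mul_of_nonneg_right (hC (t, y) ⟨ht, hy⟩) (norm_nonneg _)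
      · rw [indicator_of_notMem hy, laplacian_eq_zero_of_notMem_tsupport]
        · simp
        · intro h
          exact hy (Metric.closedBall_subset_closedBall ht.2 (tsupport_tbump_subset hθ p ht0 h)))
    (by
      rw [integrable_indicator_iff Metric.isClosed_closedBall.measurableSet]
      exact ((hf.integrableOn_isCompact (isCompact_closedBall p (2 * s))).norm).const_mul C)
    (by
      refine Eventually.of_forall fun y t ht => ?_
      exact (hasDerivAt_kern hθ (by linarith [ht.1]) p y).mul_const (f y))
  have h2 := key.2
  simp_rw [← moll_apply] at h2
  refine h2.congr_deriv ?_
  rw [← integral_const_mul]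
  refine integral_congr_ae (Eventually.of_forall fun y => ?_)
  simp only
  ring

/-! ### Distributional subharmonicity and monotone averages. -/

/-- Subharmonicity in the sense of distributions. -/
def DistSub (f : Space d → ℝ) (G : Set (Space d)) : Prop :=
  ∀ φ : Space d → ℝ, ContDiff ℝ ∞ φ → HasCompactSupport φ → tsupport φ ⊆ G → (∀ x, 0 ≤ φ x) →
    0 ≤ ∫ x, f x * Δ φ x

lemma DistSub.mono {f : Space d → ℝ} {G G' : Set (Space d)} (h : DistSub f G) (hG : G' ⊆ G) :
    DistSub f G' := fun φ h1 h2 h3 h4 => h φ h1 h2 (h3.trans hG) h4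

/-- The scale derivative is the pairing of `f` with the Laplacian of `tbump`, an admissible
nonnegative test function. -/
lemma DistSub.monotoneOn_moll (hθ : IsProfile θ) {f : Space d → ℝ} (hf : LocallyIntegrable f)
    {G : Set (Space d)} (h : DistSub f G) {p : Space d} {r : ℝ}
    (hr : Metric.closedBall p r ⊆ G) : MonotoneOn (fun s => moll θ s f p) (Ioc 0 r) := by
  refine monotoneOn_of_deriv_nonneg (convex_Ioc 0 r)
    (fun s hs => (hasDerivAt_moll hθ hf p hs.1).continuousAt.continuousWithinAt)
    (fun s hs => ?_) fun s hs => ?_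
  · rw [interior_Ioc] at hs
    exact (hasDerivAt_moll hθ hf p hs.1).differentiableAt.differentiableWithinAt
  · rw [interior_Ioc] at hs
    have := hs.1
    rw [(hasDerivAt_moll hθ hf p hs.1).deriv]
    refine mul_nonneg (by positivity) (h _ (contDiff_tbump hθ p s)
      (hasCompactSupport_tbump hθ p hs.1) ((tsupport_tbump_subset hθ p hs.1).trans
        ((Metric.closedBall_subset_closedBall hs.2.le).trans hr)) (tbump_nonneg hθ p hs.1))

/-- By monotonicity the average at scale `r` dominates the limit at scale zero, which is `mass d θ *
f p` by continuity. -/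
lemma DistSub.le_moll (hθ : IsProfile θ) {f : Space d → ℝ} (hf : LocallyIntegrable f)
    {G : Set (Space d)} (h : DistSub f G) {p : Space d} {r : ℝ} (hr0 : 0 < r)
    (hr : Metric.closedBall p r ⊆ G) (hc : ContinuousAt f p) :
    mass d θ * f p ≤ moll θ r f p := by
  refine le_of_tendsto (tendsto_moll_of_continuousAt hθ hf hc) ?_
  filter_upwards [Ioc_mem_nhdsGT hr0] with s hs
  exact h.monotoneOn_moll hθ hf hr hs ⟨hr0, le_rfl⟩ hs.2

end

section

variable {d : ℕ} {θ : ℝ → ℝ}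

/-! ### Existence of profiles -/

/-- The steepness `k` stays free: `k = 1` gives a profile to normalize, and `k → ∞` approximates the
indicator of the unit ball. -/
lemma isProfile_smoothTransition {k : ℝ} (hk : 0 ≤ k) :
    IsProfile fun t => Real.smoothTransition (k * (1 - t)) where
  smooth := Real.smoothTransition.contDiff.comp (contDiff_const.mul (contDiff_const.sub contDiff_id))
  nonneg _ := Real.smoothTransition.nonneg _
  eq_zero t ht := Real.smoothTransition.zero_of_nonpos
    (mul_nonpos_of_nonneg_of_nonpos hk (by linarith))

lemma continuous_profile_norm (hθ : IsProfile θ) :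
    Continuous fun x : Space d => θ (‖x‖ ^ 2) :=
  hθ.smooth.continuous.comp (by fun_prop)

lemma hasCompactSupport_profile_norm (hθ : IsProfile θ) :
    HasCompactSupport fun x : Space d => θ (‖x‖ ^ 2) := by
  refine HasCompactSupport.of_support_subset_isCompact (isCompact_closedBall 0 1) fun x hx => ?_
  rw [mem_closedBall_zero_iff]
  by_contra! h
  exact hx (hθ.eq_zero _ (by nlinarith))

lemma mass_pos (hθ : IsProfile θ) (h0 : 0 < θ 0) : 0 < mass d θ := by
  refine (continuous_profile_norm hθ).integral_pos_of_hasCompactSupport_nonneg_nonzero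
    (hasCompactSupport_profile_norm hθ) (fun x => hθ.nonneg _) (x := 0) ?_
  simpa using h0.ne'

lemma exists_normalized_profile (d : ℕ) : ∃ θ : ℝ → ℝ, IsProfile θ ∧ mass d θ = 1 := by
  have h := isProfile_smoothTransition zero_le_one
  have hp := mass_pos (d := d) h (by simp)
  refine ⟨fun t => (mass d fun t => Real.smoothTransition (1 * (1 - t)))⁻¹ *
    Real.smoothTransition (1 * (1 - t)), ⟨contDiff_const.mul h.smooth,
      fun t => mul_nonneg (by positivity) (h.nonneg t), fun t ht => ?_⟩, ?_⟩
  · rw [h.eq_zero t ht, mul_zero]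
  · rw [mass, integral_const_mul]
    exact inv_mul_cancel₀ hp.ne'

lemma exists_profile_bound (hθ : IsProfile θ) : ∃ C, 0 ≤ C ∧ ∀ t, 0 ≤ t → θ t ≤ C := by
  obtain ⟨C, hC⟩ := (isCompact_Icc (a := (0 : ℝ)) (b := 1)).exists_bound_of_continuousOn
    hθ.smooth.continuous.continuousOn
  refine ⟨max C 0, le_max_right _ _, fun t ht => ?_⟩
  rcases le_total t 1 with h | h
  · exact (le_abs_self _).trans ((hC t ⟨ht, h⟩).trans (le_max_left _ _))
  · rw [hθ.eq_zero t h]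
    exact le_max_right _ _

lemma exists_kern_lipschitz (d : ℕ) (hθ : IsProfile θ) : ∃ L, 0 ≤ L ∧ ∀ s, 0 < s → ∀ x y : Space d,
    |kern θ s x - kern θ s y| ≤ (s ^ (d + 1))⁻¹ * (L * (‖x - y‖ / s)) := by
  have hc : ContDiff ℝ 1 fun x : Space d => θ (‖x‖ ^ 2) :=
    (hθ.smooth.comp (contDiff_id.norm_sq ℝ)).of_le (by simp)
  obtain ⟨L, hL⟩ := hc.lipschitzWith_of_hasCompactSupport (𝕂 := ℝ)
    (hasCompactSupport_profile_norm hθ) (by norm_num)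
  refine ⟨L, L.2, fun s hs x y => ?_⟩
  have h2 (x : Space d) : kern θ s x = (s ^ (d + 1))⁻¹ * θ (‖s⁻¹ • x‖ ^ 2) := by
    rw [kern, norm_smul, norm_inv, Real.norm_of_nonneg hs.le, mul_pow, inv_pow, div_eq_inv_mul]
  rw [h2, h2, ← mul_sub, abs_mul, abs_of_nonneg (by positivity : 0 ≤ (s ^ (d + 1))⁻¹)]
  refine mul_le_mul_of_nonneg_left ?_ (by positivity)
  have := hL.dist_le_mul (s⁻¹ • x) (s⁻¹ • y)
  rw [dist_eq_norm, dist_eq_norm, ← smul_sub, norm_smul (s⁻¹) (x - y), norm_inv,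
    Real.norm_of_nonneg hs.le] at this
  rwa [div_eq_inv_mul]

/-! ### Convergence of mollifications -/

lemma volume_real_closedBall (p : Space d) {r : ℝ} (hr : 0 ≤ r) :
    volume.real (Metric.closedBall p r) =
      r ^ (d + 1) * volume.real (Metric.ball (0 : Space d) 1) := by
  have := Measure.addHaar_real_closedBall (volume : Measure (Space d)) p hr
  rwa [finrank_euclideanSpace, Fintype.card_fin] at this

lemma volume_real_unitBall_pos : 0 < volume.real (Metric.ball (0 : Space d) 1) :=
  ENNReal.toReal_pos (Metric.measure_ball_pos _ _ one_pos).ne' measure_ball_lt_top.ne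

section conv

variable {F : Type*} [NormedAddCommGroup F] [NormedSpace ℝ F] {f : Space d → F}

/-- Convergence holds at every Lebesgue point, since the kernel is at most a constant over the
volume of the ball in which it is supported. -/
lemma ae_tendsto_moll [CompleteSpace F] (hθ : IsProfile θ) (hm : mass d θ = 1) (hf : LocallyIntegrable f) :
    ∀ᵐ x, Tendsto (fun s => moll θ s f x) (𝓝[>] 0) (𝓝 (f x)) := by
  obtain ⟨C, hC0, hC⟩ := exists_profile_bound hθ
  filter_upwards [(Besicovitch.vitaliFamily volume).ae_tendsto_average_norm_sub hf] with x hx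
  simp_rw [moll_apply]
  have h := hx.comp (Besicovitch.tendsto_filterAt volume x)
  refine tendsto_integral_smul_of_tendsto_average_norm_sub
    (C * volume.real (Metric.ball (0 : Space d) 1)) h ?_ ?_ ?_ ?_
  · exact Eventually.of_forall fun s => hf.integrableOn_isCompact (isCompact_closedBall _ _)
  · refine tendsto_const_nhds.congr' ?_
    filter_upwards [self_mem_nhdsWithin] with s hs
    rw [integral_kern_sub hs, hm]
  · filter_upwards [self_mem_nhdsWithin] with s hs y hy
    refine Metric.ball_subset_closedBall ?_
    by_contra hb
    exact hy (kern_sub_eq_zero hθ hs hb)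
  · filter_upwards [self_mem_nhdsWithin] with s hs y
    have hs' : (0 : ℝ) < s := hs
    have hv := volume_real_unitBall_pos (d := d)
    rw [volume_real_closedBall x hs'.le, abs_of_nonneg (kern_nonneg hθ hs'.le _), kern,
      mul_div_mul_right _ _ hv.ne', inv_mul_eq_div]
    exact div_le_div_of_nonneg_right (hC _ (by positivity)) (by positivity)

/-- Jensen's inequality for the probability density `kern`, obtained from the nonnegativity of the
variance of `‖f‖`. -/
lemma norm_moll_sq_le (hθ : IsProfile θ) (hm : mass d θ = 1) {s : ℝ} (hs : 0 < s)
    (hf : LocallyIntegrable f) (hf2 : LocallyIntegrable fun x => ‖f x‖ ^ 2) (x : Space d) :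
    ‖moll θ s f x‖ ^ 2 ≤ moll θ s (fun y => ‖f y‖ ^ 2) x := by
  set a : ℝ := ∫ y, kern θ s (x - y) * ‖f y‖ with ha
  have hn : LocallyIntegrable fun y => ‖f y‖ := fun x => (hf x).norm
  have i1 : Integrable fun y => kern θ s (x - y) * ‖f y‖ := integrable_kern_smul hθ hs hn x
  have i2 : Integrable fun y => kern θ s (x - y) * ‖f y‖ ^ 2 := integrable_kern_smul hθ hs hf2 x
  have i0 := integrable_kern_sub hθ hs x
  have h1 : ‖moll θ s f x‖ ≤ a := by
    rw [moll_apply]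
    refine (norm_integral_le_integral_norm _).trans (le_of_eq ?_)
    refine integral_congr_ae (Eventually.of_forall fun y => ?_)
    simp only [norm_smul, Real.norm_of_nonneg (kern_nonneg hθ hs.le _)]
  have h2 : 0 ≤ ∫ y, kern θ s (x - y) * (‖f y‖ - a) ^ 2 :=
    integral_nonneg fun y => mul_nonneg (kern_nonneg hθ hs.le _) (sq_nonneg _)
  have h3 : ∫ y, kern θ s (x - y) * (‖f y‖ - a) ^ 2 =
      (∫ y, kern θ s (x - y) * ‖f y‖ ^ 2) - a ^ 2 := by
    have : ∀ y, kern θ s (x - y) * (‖f y‖ - a) ^ 2 = kern θ s (x - y) * ‖f y‖ ^ 2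
        - (2 * a * (kern θ s (x - y) * ‖f y‖) - a ^ 2 * kern θ s (x - y)) := fun y => by ring
    simp_rw [this]
    have i3 : Integrable fun y => 2 * a * (kern θ s (x - y) * ‖f y‖) - a ^ 2 * kern θ s (x - y) :=
      (i1.const_mul _).sub (i0.const_mul _)
    rw [integral_sub i2 i3, integral_sub (i1.const_mul _) (i0.const_mul _), integral_const_mul, integral_const_mul,
      integral_kern_sub hs, hm, ← ha]
    ring
  rw [moll_apply θ s (fun y => ‖f y‖ ^ 2)]
  change _ ≤ ∫ y, kern θ s (x - y) * ‖f y‖ ^ 2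
  nlinarith [norm_nonneg (moll θ s f x)]

/-- Integrate the pointwise Jensen inequality; convolution with a kernel of mass one preserves the
integral. -/
lemma integral_norm_moll_sq_le (hθ : IsProfile θ) (hm : mass d θ = 1) {s : ℝ} (hs : 0 < s)
    (hf : MemLp f 2) :
    Integrable (fun x => ‖moll θ s f x‖ ^ 2) ∧
    ∫ x, ‖moll θ s f x‖ ^ 2 ≤ ∫ x, ‖f x‖ ^ 2 := by
  have hl : LocallyIntegrable f := hf.locallyIntegrable (by norm_num)
  have hi : Integrable fun x => ‖f x‖ ^ 2 := hf.integrable_norm_pow (by norm_num)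
  have hc : Integrable (moll θ s fun x => ‖f x‖ ^ 2) :=
    (integrable_kern hθ hs).integrable_convolution _ hi
  have hle := fun x => norm_moll_sq_le hθ hm hs hl hi.locallyIntegrable x
  have hI : Integrable (fun x => ‖moll θ s f x‖ ^ 2) := by
    refine hc.mono' ?_ (Eventually.of_forall fun x => ?_)
    · exact ((contDiff_moll hθ hs hl).continuous.norm.pow 2).aestronglyMeasurable
    · rw [Real.norm_of_nonneg (by positivity)]
      exact hle x
  refine ⟨hI, (integral_mono hI hc hle).trans (le_of_eq ?_)⟩
  rw [moll, integral_convolution _ (integrable_kern hθ hs) hi, integral_kern hs, hm]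
  simp

lemma norm_add_three_sq_le {F : Type*} [NormedAddCommGroup F] (a b c : F) :
    ‖a + b + c‖ ^ 2 ≤ 3 * (‖a‖ ^ 2 + ‖b‖ ^ 2 + ‖c‖ ^ 2) := by
  have := norm_add₃_le (a := a) (b := b) (c := c)
  nlinarith [sq_nonneg (‖a‖ - ‖b‖), sq_nonneg (‖a‖ - ‖c‖), sq_nonneg (‖b‖ - ‖c‖),
    norm_nonneg (a + b + c), norm_nonneg a, norm_nonneg b, norm_nonneg c]

lemma moll_eq_zero [CompleteSpace F] (hθ : IsProfile θ) {s : ℝ} (hs : 0 < s) {x : Space d}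
    (h : ∀ y ∈ Metric.ball x s, f y = 0) : moll θ s f x = 0 := by
  rw [moll_congr_ae (g := fun _ => 0) hθ hs (Eventually.of_forall fun y => h y), moll_const hs,
    smul_zero]

lemma tendsto_integral_norm_moll_sub_sq_of_continuous [CompleteSpace F] (hθ : IsProfile θ) (hm : mass d θ = 1)
    (hf : Continuous f) (hc : HasCompactSupport f) :
    Tendsto (fun s => ∫ x, ‖moll θ s f x - f x‖ ^ 2) (𝓝[>] 0) (𝓝 0) := by
  obtain ⟨M, hM⟩ := hf.bounded_above_of_compact_support hc
  have hl : LocallyIntegrable f := hf.locallyIntegrable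
  have hK : IsCompact (Metric.cthickening 1 (tsupport f)) := IsCompact.cthickening hc
  rw [show 𝓝 (0 : ℝ) = 𝓝 (∫ _ : Space d, (0 : ℝ)) by simp]
  refine tendsto_integral_filter_of_dominated_convergence
    ((Metric.cthickening 1 (tsupport f)).indicator fun _ => (2 * M) ^ 2) ?_ ?_ ?_ ?_
  · filter_upwards [self_mem_nhdsWithin] with s hs
    exact (((contDiff_moll hθ hs hl).continuous.sub hf).norm.pow 2).aestronglyMeasurable
  · filter_upwards [Ioo_mem_nhdsGT one_pos] with s hs
    refine Eventually.of_forall fun x => ?_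
    by_cases hx : x ∈ Metric.cthickening 1 (tsupport f)
    · rw [indicator_of_mem hx, Real.norm_of_nonneg (by positivity)]
      have h1 : ‖moll θ s f x‖ ≤ M := by
        have := norm_moll_sub_le hθ hs.1 hl (x := x) (z := 0) (C := M)
          (Eventually.of_forall fun y _ => by simpa using hM y)
        simpa [hm] using this
      have h2 := norm_sub_le (moll θ s f x) (f x)
      have h3 := hM x
      gcongr
      linarith
    · have hz : ∀ y ∈ Metric.ball x s, f y = 0 := by
        intro y hy
        by_contra hne
        refine hx (Metric.mem_cthickening_of_dist_le x y 1 _ (subset_tsupport f hne) ?_)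
        rw [dist_comm]
        exact (lt_trans hy hs.2).le
      rw [indicator_of_notMem hx, moll_eq_zero hθ hs.1 hz, hz x (Metric.mem_ball_self hs.1)]
      simp
  · rw [integrable_indicator_iff hK.measurableSet]
    exact integrableOn_const hK.measure_lt_top.ne
  · refine Eventually.of_forall fun x => ?_
    have := tendsto_moll_of_continuousAt hθ hl hf.continuousAt (x := x)
    rw [hm, one_smul] at this
    have := ((this.sub_const (f x)).norm).pow 2
    simpa using this

/-- Mollifications converge in `L²`. -/
lemma tendsto_integral_norm_moll_sub_sq [CompleteSpace F] (hθ : IsProfile θ) (hm : mass d θ = 1)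
    (hf : MemLp f 2) :
    Tendsto (fun s => ∫ x, ‖moll θ s f x - f x‖ ^ 2) (𝓝[>] 0) (𝓝 0) := by
  rw [Metric.tendsto_nhds]
  intro ε hε
  -- Three errors of at most `ε / 12`, multiplied by the factor 3 of `norm_add_three_sq_le`, add up
  -- to less than `ε`.
  obtain ⟨g, hgc, hfg, hg, hgL⟩ := MemLp.exists_hasCompactSupport_integral_rpow_sub_le
    (p := 2) (by norm_num) (f := f) (by simpa using hf) (show 0 < ε / 12 by positivity)
  have hgL' : MemLp g 2 := by simpa using hgL
  have hfg' : ∫ x, ‖f x - g x‖ ^ 2 ≤ ε / 12 := by simpa using hfg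
  have hl : LocallyIntegrable f := hf.locallyIntegrable (by norm_num)
  have hlg : LocallyIntegrable g := hg.locallyIntegrable
  have hfgL : MemLp (fun x => f x - g x) 2 := hf.sub hgL'
  have h := (Metric.tendsto_nhds.1
    (tendsto_integral_norm_moll_sub_sq_of_continuous hθ hm hg hgc)) (ε / 12) (by positivity)
  filter_upwards [h, self_mem_nhdsWithin] with s hs1 hs
  have hs' : (0 : ℝ) < s := hs
  rw [Real.dist_eq, sub_zero, abs_of_nonneg (integral_nonneg fun _ => by positivity)] at hs1 ⊢
  obtain ⟨iA, hA⟩ := integral_norm_moll_sq_le hθ hm hs' hfgL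
  have iC : Integrable fun x => ‖f x - g x‖ ^ 2 := hfgL.integrable_norm_pow (by norm_num)
  have hgm : MemLp (fun x => moll θ s g x - g x) 2 := by
    refine MemLp.sub ?_ hgL'
    exact (contDiff_moll hθ hs' hlg).continuous.memLp_of_hasCompactSupport
      (HasCompactSupport.convolution _ (hasCompactSupport_kern hθ hs') hgc)
  have iB : Integrable fun x => ‖moll θ s g x - g x‖ ^ 2 :=
    hgm.integrable_norm_pow (by norm_num)
  have hle : ∀ x, ‖moll θ s f x - f x‖ ^ 2 ≤ 3 * (‖moll θ s (fun x => f x - g x) x‖ ^ 2 +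
      ‖moll θ s g x - g x‖ ^ 2 + ‖f x - g x‖ ^ 2) := by
    intro x
    have := norm_add_three_sq_le (moll θ s (fun x => f x - g x) x) (moll θ s g x - g x)
      (-(f x - g x))
    rw [norm_neg, moll_sub hθ hs' hl hlg] at this
    rw [moll_sub hθ hs' hl hlg]
    convert this using 3
    abel
  have hfin : ∫ x, ‖moll θ s f x - f x‖ ^ 2 ≤ ∫ x, 3 * (‖moll θ s (fun x => f x - g x) x‖ ^ 2 +
      ‖moll θ s g x - g x‖ ^ 2 + ‖f x - g x‖ ^ 2) :=
    integral_mono_of_nonneg (Eventually.of_forall fun _ => by positivity)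
      (((iA.add iB).add iC).const_mul (3 : ℝ)) (Eventually.of_forall hle)
  have iAB : Integrable fun x => ‖moll θ s (fun x => f x - g x) x‖ ^ 2 +
      ‖moll θ s g x - g x‖ ^ 2 := iA.add iB
  rw [integral_const_mul, integral_add iAB iC, integral_add iA iB] at hfin
  linarith

end conv

/-! ### Derivatives of mollifications -/

lemma fderiv_kern_sub (hθ : IsProfile θ) (s : ℝ) (x y e : Space d) :
    fderiv ℝ (fun y => kern θ s (x - y)) y e = -fderiv ℝ (kern θ s) (x - y) e := by
  have h := ((contDiff_kern (d := d) hθ s).differentiable (by simp) (x - y)).hasFDerivAt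
  have h2 := h.comp y ((hasFDerivAt_id y).const_sub x)
  rw [show (fun y => kern θ s (x - y)) = kern θ s ∘ fun y => x - y from rfl]
  erw [h2.fderiv]
  simp

lemma dd_kern_sub (hθ : IsProfile θ) (s : ℝ) (x y e : Space d) :
    dd (fun y => kern θ s (x - y)) e y = dd (kern θ s) e (x - y) := by
  unfold dd
  simp_rw [fderiv_kern_sub hθ]
  have hd := contDiff_fderiv_apply (contDiff_kern (d := d) hθ s) e
  have h := (hd.differentiable (by simp) (x - y)).hasFDerivAt
  have h2 := (h.comp y ((hasFDerivAt_id y).const_sub x)).neg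
  have h3 : (fun y => -fderiv ℝ (kern θ s) (x - y) e) =
    -((fun z => fderiv ℝ (kern θ s) z e) ∘ fun y => x - y) := rfl
  rw [h3]
  erw [h2.fderiv]
  simp

lemma fderiv_convolution_apply {k f : Space d → ℝ} (hk : ContDiff ℝ ∞ k) (hc : HasCompactSupport k)
    (hf : LocallyIntegrable f) (x e : Space d) :
    fderiv ℝ (convolution k f (ContinuousLinearMap.lsmul ℝ ℝ) volume) x e =
      ∫ y, fderiv ℝ k (x - y) e * f y := by
  rw [(hc.hasFDerivAt_convolution_left (ContinuousLinearMap.lsmul ℝ ℝ)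
    (hk.of_le (by simp)) hf x).fderiv, convolution_eq_swap, ContinuousLinearMap.integral_apply]
  · simp
  · exact ((hc.fderiv ℝ).convolutionExists_left _ (hk.continuous_fderiv (by simp)) hf
      x).integrable_swap

lemma fderiv_moll_apply (hθ : IsProfile θ) {f : Space d → ℝ} (hf : LocallyIntegrable f) {s : ℝ}
    (hs : 0 < s) (x e : Space d) :
    fderiv ℝ (moll θ s f) x e = ∫ y, fderiv ℝ (kern θ s) (x - y) e * f y :=
  fderiv_convolution_apply (contDiff_kern hθ s) (hasCompactSupport_kern hθ hs) hf x e

lemma contDiff_kern_sub (hθ : IsProfile θ) (s : ℝ) (x : Space d) :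
    ContDiff ℝ ∞ fun y => kern θ s (x - y) :=
  (contDiff_kern hθ s).comp (contDiff_const.sub contDiff_id)

lemma tsupport_kern_sub_subset (hθ : IsProfile θ) {s : ℝ} (hs : 0 < s) (x : Space d) :
    tsupport (fun y => kern θ s (x - y)) ⊆ Metric.closedBall x s :=
  closure_minimal (fun _ hy => Metric.ball_subset_closedBall
    (by_contra fun h => hy (kern_sub_eq_zero hθ hs h))) Metric.isClosed_closedBall

lemma hasCompactSupport_kern_sub (hθ : IsProfile θ) {s : ℝ} (hs : 0 < s) (x : Space d) :
    HasCompactSupport fun y => kern θ s (x - y) :=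
  HasCompactSupport.of_support_subset_isCompact (isCompact_closedBall x s)
    (subset_closure.trans (tsupport_kern_sub_subset hθ hs x))

/-- Both derivatives fall on the kernel; the two signs from differentiating in `y` instead of `x`
cancel. The Laplacian becomes a pairing with a test function, the form in which `DistSub` applies.
-/
lemma laplacian_moll (hθ : IsProfile θ) {f : Space d → ℝ} (hf : LocallyIntegrable f) {s : ℝ}
    (hs : 0 < s) (x : Space d) :
    Δ (moll θ s f) x = ∫ y, f y * (Δ fun y : Space d => kern θ s (x - y)) y := by
  rw [laplacian_eq_sum_dd_of_smooth (contDiff_moll hθ hs hf), laplacian_eq_sum_dd_of_smooth (contDiff_kern_sub hθ s x)]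
  simp_rw [Finset.mul_sum]
  have hk := contDiff_kern (d := d) hθ s
  have hc := hasCompactSupport_kern (d := d) hθ hs
  rw [integral_finsetSum]
  · refine Finset.sum_congr rfl fun i _ => ?_
    have h1 : (fun y => fderiv ℝ (moll θ s f) y (stdVec i)) =
        convolution (fun z => fderiv ℝ (kern θ s) z (stdVec i)) f
          (ContinuousLinearMap.lsmul ℝ ℝ) volume := by
      ext y
      rw [fderiv_moll_apply hθ hf hs, convolution_lsmul_swap]
      rfl
    rw [dd, h1, fderiv_convolution_apply (contDiff_fderiv_apply hk _)
      (hasCompactSupport_fderiv_apply hc _) hf]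
    refine integral_congr_ae (Eventually.of_forall fun y => ?_)
    simp only [dd_kern_sub hθ]
    rw [mul_comm]
    rfl
  · intro i _
    have hd := contDiff_dd (contDiff_kern_sub (d := d) hθ s x) (stdVec i)
    have := hf.integrable_smul_right_of_hasCompactSupport hd.continuous
      (hasCompactSupport_dd (hasCompactSupport_kern_sub hθ hs x) _)
    simpa using this

lemma DistSub.laplacian_moll_nonneg (hθ : IsProfile θ) {f : Space d → ℝ} (hf : LocallyIntegrable f)
    {G : Set (Space d)} (h : DistSub f G) {s : ℝ} (hs : 0 < s) {x : Space d}
    (hx : Metric.closedBall x s ⊆ G) : 0 ≤ Δ (moll θ s f) x := by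
  rw [laplacian_moll hθ hf hs]
  exact h _ (contDiff_kern_sub hθ s x) (hasCompactSupport_kern_sub hθ hs x)
    ((tsupport_kern_sub_subset hθ hs x).trans hx) fun y => kern_nonneg hθ hs.le _

/-- The gradient of a mollification is the mollification of the weak gradient. -/
lemma gradient_moll (hθ : IsProfile θ) {Ω : Set (Space d)} (hΩ : MeasurableSet Ω)
    {u : Space d → ℝ} {g : Space d → Space d} (hg : IsWeakGradient Ω u g) {u₀ : Space d → ℝ}
    (hu₀ : LocallyIntegrable u₀) (hu : ∀ x ∈ Ω, u₀ x = u x)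
    (hgl : LocallyIntegrable (Ω.indicator g)) {s : ℝ} (hs : 0 < s) {x : Space d}
    (hx : Metric.closedBall x s ⊆ Ω) : ∇ (moll θ s u₀) x = moll θ s (Ω.indicator g) x := by
  refine ext_inner_stdVec fun e => ?_
  rw [inner_gradient_left, fderiv_moll_apply hθ hu₀ hs, moll_apply]
  have hI := integrable_kern_smul hθ hs hgl x
  rw [real_inner_comm, ← integral_inner hI]
  have h := hg.2.2 _ (contDiff_kern_sub hθ s x) (hasCompactSupport_kern_sub hθ hs x)
    ((tsupport_kern_sub_subset hθ hs x).trans hx) e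
  simp_rw [fderiv_kern_sub hθ, mul_neg, integral_neg] at h
  have h' := neg_injective h
  rw [← integral_indicator hΩ, ← integral_indicator hΩ] at h'
  calc _ = ∫ y, Ω.indicator (fun y => u y * fderiv ℝ (kern θ s) (x - y) e) y := by
        refine integral_congr_ae (Eventually.of_forall fun y => ?_)
        by_cases hy : y ∈ Ω
        · simp only [indicator_of_mem hy, hu y hy, mul_comm]
        · simp only [indicator_of_notMem hy]
          have : y ∉ tsupport fun y => kern θ s (x - y) :=
            fun h => hy (hx (tsupport_kern_sub_subset hθ hs x h))
          have h0 : fderiv ℝ (fun y => kern θ s (x - y)) y e = 0 := by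
            by_contra hne
            exact this (tsupport_partial_subset e (subset_tsupport _ hne))
          rw [fderiv_kern_sub hθ, neg_eq_zero] at h0
          rw [h0, zero_mul]
    _ = _ := h'
    _ = _ := by
        refine integral_congr_ae (Eventually.of_forall fun y => ?_)
        by_cases hy : y ∈ Ω
        · simp only [indicator_of_mem hy, inner_smul_right, real_inner_comm]
        · simp [indicator_of_notMem hy]

end

section

variable {d : ℕ}

/-! ### A smooth convex approximation of the positive part -/

/-- A smooth convex approximation of the positive part at scale `δ`. -/
noncomputable def ramp (δ s : ℝ) : ℝ := δ * ∫ τ in 0..s / δ, Real.smoothTransition τ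

lemma hasDerivAt_ramp {δ : ℝ} (hδ : 0 < δ) (s : ℝ) :
    HasDerivAt (ramp δ) (Real.smoothTransition (s / δ)) s := by
  have hc : Continuous Real.smoothTransition := Real.smoothTransition.continuous
  have h : HasDerivAt (fun t => ∫ τ in 0..t, Real.smoothTransition τ)
      (Real.smoothTransition (s / δ)) (s / δ) :=
    intervalIntegral.integral_hasDerivAt_right (hc.intervalIntegrable _ _)
      hc.aestronglyMeasurable.stronglyMeasurableAtFilter hc.continuousAt
  have := (h.comp s ((hasDerivAt_id s).div_const δ)).const_mul δ
  refine this.congr_deriv ?_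
  field_simp

lemma deriv_ramp {δ : ℝ} (hδ : 0 < δ) :
    deriv (ramp δ) = fun s => Real.smoothTransition (s / δ) :=
  funext fun s => (hasDerivAt_ramp hδ s).deriv

lemma contDiff_deriv_ramp {δ : ℝ} (hδ : 0 < δ) : ContDiff ℝ ∞ (deriv (ramp δ)) := by
  rw [deriv_ramp hδ]
  exact Real.smoothTransition.contDiff.comp (contDiff_id.div_const _)

lemma contDiff_ramp {δ : ℝ} (hδ : 0 < δ) : ContDiff ℝ ∞ (ramp δ) :=
  contDiff_infty_iff_deriv.2
    ⟨fun s => (hasDerivAt_ramp hδ s).differentiableAt, contDiff_deriv_ramp hδ⟩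

lemma ramp_eq_zero {δ s : ℝ} (hδ : 0 < δ) (hs : s ≤ 0) : ramp δ s = 0 := by
  have h0 : s / δ ≤ 0 := div_nonpos_of_nonpos_of_nonneg hs hδ.le
  rw [ramp, intervalIntegral.integral_zero_ae, mul_zero]
  refine Eventually.of_forall fun τ hτ => Real.smoothTransition.zero_of_nonpos ?_
  rw [uIoc_of_ge h0] at hτ
  exact hτ.2

lemma ramp_nonneg {δ : ℝ} (hδ : 0 < δ) (s : ℝ) : 0 ≤ ramp δ s := by
  rcases le_total s 0 with hs | hs
  · exact (ramp_eq_zero hδ hs).ge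
  · exact mul_nonneg hδ.le (intervalIntegral.integral_nonneg (by positivity)
      fun τ _ => Real.smoothTransition.nonneg τ)

lemma ramp_le {δ s : ℝ} (hδ : 0 < δ) (hs : 0 ≤ s) : ramp δ s ≤ s := by
  have hc : Continuous Real.smoothTransition := Real.smoothTransition.continuous
  have h := intervalIntegral.integral_mono_on (μ := volume) (a := 0) (b := s / δ) (by positivity)
    (hc.intervalIntegrable _ _) (intervalIntegrable_const (c := (1 : ℝ)))
    fun τ _ => Real.smoothTransition.le_one τ
  rw [intervalIntegral.integral_const, smul_eq_mul, mul_one, sub_zero, le_div_iff₀ hδ] at h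
  rw [ramp]
  linarith

lemma sub_le_ramp {δ : ℝ} (hδ : 0 < δ) (s : ℝ) : s - δ ≤ ramp δ s := by
  rcases le_total s δ with hs | hs
  · linarith [ramp_nonneg hδ s]
  have hc : Continuous Real.smoothTransition := Real.smoothTransition.continuous
  have h1 : 1 ≤ s / δ := by rwa [one_le_div hδ]
  have ha := intervalIntegral.integral_nonneg (μ := volume) (a := 0) (b := 1) zero_le_one
    fun τ _ => Real.smoothTransition.nonneg τ
  have hb : ∫ τ in (1 : ℝ)..s / δ, Real.smoothTransition τ = ∫ τ in (1 : ℝ)..s / δ, (1 : ℝ) := by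
    refine intervalIntegral.integral_congr fun τ hτ => ?_
    rw [uIcc_of_le h1] at hτ
    exact Real.smoothTransition.one_of_one_le hτ.1
  rw [ramp, ← intervalIntegral.integral_add_adjacent_intervals (hc.intervalIntegrable 0 1)
    (hc.intervalIntegrable 1 (s / δ)), hb, intervalIntegral.integral_const, smul_eq_mul, mul_one]
  have : δ * (s / δ) = s := by field_simp
  nlinarith

lemma abs_ramp_sub_le {δ s : ℝ} (hδ : 0 < δ) : |ramp δ s - max s 0| ≤ δ := by
  rw [abs_le]
  rcases le_total s 0 with hs | hs
  · rw [ramp_eq_zero hδ hs, max_eq_right hs]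
    constructor <;> linarith
  · rw [max_eq_left hs]
    constructor <;> linarith [ramp_le hδ hs, sub_le_ramp hδ s]

lemma deriv_deriv_ramp_nonneg {δ : ℝ} (hδ : 0 < δ) (s : ℝ) : 0 ≤ deriv (deriv (ramp δ)) s := by
  refine Monotone.deriv_nonneg ?_
  rw [deriv_ramp hδ]
  exact fun a b hab => Real.smoothTransition.monotone (div_le_div_of_nonneg_right hab hδ.le)

/-! ### The Laplacian of a composition -/

lemma dd_comp {F : ℝ → ℝ} {f : Space d → ℝ} {x : Space d} (hF : ContDiff ℝ 2 F)
    (hf : ContDiffAt ℝ 2 f x) (e : Space d) :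
    dd (fun y => F (f y)) e x =
      deriv (deriv F) (f x) * (fderiv ℝ f x e) ^ 2 + deriv F (f x) * dd f e x := by
  have hF1 : Differentiable ℝ F := hF.differentiable (by norm_num)
  have hF2 : Differentiable ℝ (deriv F) := by
    have : ContDiff ℝ (1 + 1) F := by norm_num; exact hF
    exact (contDiff_succ_iff_deriv.1 this).2.2.differentiable (by norm_num)
  have hev : ∀ᶠ y in 𝓝 x, DifferentiableAt ℝ f y := by
    filter_upwards [hf.eventually (by simp)] with y hy using hy.differentiableAt (by norm_num)
  have h1 : (fun y => fderiv ℝ (fun y => F (f y)) y e) =ᶠ[𝓝 x]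
      fun y => deriv F (f y) * fderiv ℝ f y e := by
    filter_upwards [hev] with y hy
    rw [fderiv_fun_comp y (hF1 _) hy]
    simp [mul_comm]
  have hd : DifferentiableAt ℝ (fun y => fderiv ℝ f y e) x :=
    ((hf.fderiv_right (m := 1) (by norm_num)).differentiableAt (by norm_num)).clm_apply
      (differentiableAt_const e)
  rw [dd, h1.fderiv_eq, fderiv_fun_mul (c := fun y => deriv F (f y))
    ((hF2 _).comp x hev.self_of_nhds) hd]
  have h2 : fderiv ℝ (fun y => deriv F (f y)) x e = deriv (deriv F) (f x) * fderiv ℝ f x e := by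
    rw [fderiv_fun_comp x (hF2 _) hev.self_of_nhds]
    simp [mul_comm]
  simp only [add_apply, smul_apply, smul_eq_mul]
  rw [h2, dd]
  ring

/-- This is $\Delta F(f)=F''(f)|\nabla f|^2+F'(f)\Delta f$ with both coefficients nonnegative. -/
lemma laplacian_comp_nonneg {F : ℝ → ℝ} {f : Space d → ℝ} {x : Space d} (hF : ContDiff ℝ 2 F)
    (hf : ContDiffAt ℝ 2 f x) (h1 : 0 ≤ deriv F (f x)) (h2 : 0 ≤ deriv (deriv F) (f x))
    (hΔ : 0 ≤ Δ f x) : 0 ≤ Δ (fun y => F (f y)) x := by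
  rw [laplacian_eq_sum_dd (f := fun y => F (f y)) (hF.contDiffAt.comp x hf)]
  simp_rw [dd_comp hF hf]
  rw [Finset.sum_add_distrib, ← Finset.mul_sum, ← Finset.mul_sum, ← laplacian_eq_sum_dd hf]
  have := Finset.sum_nonneg fun i (_ : i ∈ Finset.univ) => sq_nonneg (fderiv ℝ f x (stdVec i))
  positivity

/-- A function that is subharmonic where it lies strictly between its minimum `-1` and `1` is
subharmonic in the sense of distributions where it is less than `1`. -/
lemma distSub_of_laplacian_nonneg {O : Set (Space d)} (hO : IsOpen O) {f : Space d → ℝ}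
    (hf : ContinuousOn f O) (hge : ∀ x ∈ O, -1 ≤ f x)
    (hC2 : ContDiffOn ℝ 2 f {x | x ∈ O ∧ |f x| < 1})
    (hΔ : ∀ x, x ∈ O → |f x| < 1 → 0 ≤ Δ f x) : DistSub f {x | x ∈ O ∧ f x < 1} := by
  intro φ hφ hc hs hφ0
  have hU : IsOpen {x | x ∈ O ∧ f x < 1} := hf.isOpen_inter_preimage hO isOpen_Iio
  have hA : IsOpen {x | x ∈ O ∧ |f x| < 1} := hf.abs.isOpen_inter_preimage hO isOpen_Iio
  have hΔc := (contDiff_laplacian hφ).continuous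
  have hΔs := hasCompactSupport_laplacian hc
  have hlow : ∀ δ > 0, -(2 * δ * ∫ x, |Δ φ x|) ≤ ∫ x, f x * Δ φ x := by
    intro δ hδ
    -- `F` is smooth, convex and nondecreasing, equals -1 below `-1 + δ`, and differs from the
    -- identity by at most `2 * δ` above -1. Thus `F ∘ f` is constant near the contact set `f = -1`,
    -- where `f` itself need not be smooth.
    set F : ℝ → ℝ := fun s => ramp δ (s + 1 - δ) - 1 with hFdef
    have hF : ContDiff ℝ ∞ F :=
      ((contDiff_ramp hδ).comp ((contDiff_id.add contDiff_const).sub contDiff_const)).sub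
        contDiff_const
    have hF2 : ContDiff ℝ 2 F := hF.of_le (by norm_cast)
    have hF' : deriv F = fun s => deriv (ramp δ) (s + 1 - δ) := by
      ext s
      have := ((hasDerivAt_ramp hδ (s + 1 - δ)).comp s
        (((hasDerivAt_id s).add_const 1).sub_const δ)).sub_const 1
      rw [show deriv F s = _ from this.deriv, deriv_ramp hδ, mul_one]
    have hF'' : ∀ s, deriv (deriv F) s = deriv (deriv (ramp δ)) (s + 1 - δ) := by
      intro s
      rw [hF']
      simpa only [add_sub_assoc] using deriv_comp_add_const (deriv (ramp δ)) (1 - δ) s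
    have hloc : ∀ x, x ∈ O → f x < 1 → ¬|f x| < 1 → (fun y => F (f y)) =ᶠ[𝓝 x] fun _ => -1 := by
      intro x hx h1 h2
      have hfx : f x = -1 := by
        refine le_antisymm ?_ (hge x hx)
        by_contra! h
        exact h2 (abs_lt.2 ⟨h, h1⟩)
      filter_upwards [(hf.continuousAt (hO.mem_nhds hx)).eventually_lt_const
        (show f x < -1 + δ by linarith)] with y hy
      simp only [hFdef]
      rw [ramp_eq_zero hδ (by linarith)]
      norm_num
    have hcd : ContDiffOn ℝ 2 (fun y => F (f y)) {x | x ∈ O ∧ f x < 1} := by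
      rintro x ⟨hx, h1⟩
      by_cases h2 : |f x| < 1
      · exact (hF2.contDiffAt.comp x (hC2.contDiffAt (hA.mem_nhds ⟨hx, h2⟩))).contDiffWithinAt
      · exact (contDiffAt_const.congr_of_eventuallyEq (hloc x hx h1 h2)).contDiffWithinAt
    have hpos : ∀ x, x ∈ O → f x < 1 → 0 ≤ Δ (fun y => F (f y)) x := by
      intro x hx h1
      by_cases h2 : |f x| < 1
      · refine laplacian_comp_nonneg hF2 (hC2.contDiffAt (hA.mem_nhds ⟨hx, h2⟩)) ?_ ?_ (hΔ x hx h2)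
        · rw [hF', deriv_ramp hδ]
          exact Real.smoothTransition.nonneg _
        · rw [hF'']
          exact deriv_deriv_ramp_nonneg hδ _
      · rw [(InnerProductSpace.laplacian_congr_nhds (hloc x hx h1 h2)).self_of_nhds]
        simp
    -- `F ∘ f` is now `C²` on all of `{f < 1}`, so Green's identity applies across the contact set.
    have hint := integral_mul_laplacian hU hcd hφ hc hs
    have h0 : 0 ≤ ∫ x, F (f x) * Δ φ x := by
      rw [hint]
      refine integral_nonneg fun x => ?_
      by_cases hx : x ∈ tsupport φ
      · exact mul_nonneg (hpos x (hs hx).1 (hs hx).2) (hφ0 x)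
      · simp [image_eq_zero_of_notMem_tsupport hx]
    have hΔsub := (tsupport_laplacian_subset φ).trans hs
    have i1 : Integrable fun x => F (f x) * Δ φ x :=
      integrable_mul_of_continuousOn hcd.continuousOn hΔc hΔs hΔsub
    have i2 : Integrable fun x => f x * Δ φ x :=
      integrable_mul_of_continuousOn (hf.mono fun x hx => hx.1) hΔc hΔs hΔsub
    have i3 : Integrable fun x => 2 * δ * |Δ φ x| :=
      ((hΔc.integrable_of_hasCompactSupport hΔs).abs).const_mul _
    have hle : ∫ x, (F (f x) * Δ φ x - f x * Δ φ x) ≤ ∫ x, 2 * δ * |Δ φ x| := by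
      refine integral_mono (i1.sub i2) i3 fun x => ?_
      by_cases hx : x ∈ tsupport φ
      · simp only
        rw [← sub_mul]
        refine (le_abs_self _).trans ?_
        rw [abs_mul]
        refine mul_le_mul_of_nonneg_right ?_ (abs_nonneg _)
        have hge' := hge x (hs hx).1
        have := abs_le.1 (abs_ramp_sub_le hδ (s := f x + 1 - δ))
        rw [abs_le]
        simp only [hFdef]
        rcases le_total (f x + 1 - δ) 0 with h | h
        · rw [max_eq_right h] at this
          constructor <;> linarith [this.1, this.2]
        · rw [max_eq_left h] at this
          constructor <;> linarith [this.1, this.2]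
      · simp [laplacian_eq_zero_of_notMem_tsupport hx]
    rw [integral_sub i1 i2, integral_const_mul] at hle
    linarith
  have hlim : Tendsto (fun δ : ℝ => -(2 * δ * ∫ x, |Δ φ x|)) (𝓝[>] 0) (𝓝 0) := by
    have : Continuous fun δ : ℝ => -(2 * δ * ∫ x, |Δ φ x|) := by fun_prop
    simpa using (this.tendsto 0).mono_left nhdsWithin_le_nhds
  refine le_of_tendsto hlim ?_
  filter_upwards [self_mem_nhdsWithin] with δ hδ using hlow δ hδ

end

section

variable {d : ℕ} {Ω : Set (Space d)}

/-! ### Weak gradients -/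

/-- `u` and its weak gradient `g` are square integrable in `Ω`. -/
structure HasL2Gradient (Ω : Set (Space d)) (u : Space d → ℝ) (g : Space d → Space d) : Prop where
  memLp : MemLp u 2 (volume.restrict Ω)
  memLp_grad : MemLp g 2 (volume.restrict Ω)
  weak : IsWeakGradient Ω u g

lemma MemH1.exists_hasL2Gradient {u : Space d → ℝ} (h : MemH1 Ω u) :
    ∃ g, HasL2Gradient Ω u g := by
  obtain ⟨h1, g, h2, h3⟩ := h
  exact ⟨g, h1, h2, h3⟩

lemma HasL2Gradient.memH1 {u : Space d → ℝ} {g : Space d → Space d} (h : HasL2Gradient Ω u g) :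
    MemH1 Ω u := ⟨h.memLp, g, h.memLp_grad, h.weak⟩

lemma setIntegral_eq_of_tsupport {F : Type*} [NormedAddCommGroup F] [NormedSpace ℝ F]
    {φ : Space d → ℝ} (hs : tsupport φ ⊆ Ω) {f : Space d → F} (hf : ∀ x, φ x = 0 → f x = 0) :
    ∫ x in Ω, f x = ∫ x, f x :=
  setIntegral_eq_integral_of_forall_compl_eq_zero fun x hx =>
    hf x (image_eq_zero_of_notMem_tsupport fun h => hx (hs h))

lemma integrableOn_smul_test {F : Type*} [NormedAddCommGroup F] [NormedSpace ℝ F]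
    {φ : Space d → ℝ} {g : Space d → F} (hg : LocallyIntegrableOn g Ω) (hφ : Continuous φ)
    (hc : HasCompactSupport φ) (hs : tsupport φ ⊆ Ω) :
    IntegrableOn (fun x => φ x • g x) Ω := by
  have h1 : IntegrableOn g (tsupport φ) := hg.integrableOn_compact_subset hs hc
  have h2 : IntegrableOn (fun x => φ x • g x) (tsupport φ) :=
    h1.continuousOn_smul hφ.continuousOn hc
  refine Integrable.integrableOn ?_
  rw [← integrableOn_iff_integrable_of_support_subset (s := tsupport φ)]
  · exact h2
  · intro x hx
    exact subset_tsupport _ fun h => hx (by simp [h])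

lemma integrableOn_mul_inner_test {φ : Space d → ℝ} {g : Space d → Space d}
    (hg : LocallyIntegrableOn g Ω) (hφ : ContDiff ℝ ∞ φ) (hc : HasCompactSupport φ)
    (hs : tsupport φ ⊆ Ω) (e : Space d) :
    IntegrableOn (fun x => φ x * inner ℝ (g x) e) Ω := by
  have := (integrableOn_smul_test hg hφ.continuous hc hs).const_inner (𝕜 := ℝ) e
  simp_rw [inner_smul_right, fun x => real_inner_comm (g x) e] at this
  exact this

/-- The fundamental lemma of the calculus of variations, applied to `g - g'`. -/
lemma IsWeakGradient.ae_eq (hΩ : IsOpen Ω) {u : Space d → ℝ} {g g' : Space d → Space d}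
    (h : IsWeakGradient Ω u g) (h' : IsWeakGradient Ω u g') :
    g =ᵐ[volume.restrict Ω] g' := by
  have hl : LocallyIntegrableOn (fun x => g x - g' x) Ω := h.2.1.sub h'.2.1
  have := hΩ.ae_eq_zero_of_integral_contDiff_smul_eq_zero hl fun φ hφ hc hs => by
    have hi := integrableOn_smul_test hl hφ.continuous hc hs
    rw [← setIntegral_eq_of_tsupport hs (by intro x hx; simp [hx])]
    refine ext_inner_left ℝ fun e => ?_
    rw [inner_zero_right, ← integral_inner hi]
    have h1 := h.2.2 φ hφ hc hs e
    rw [h'.2.2 φ hφ hc hs e] at h1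
    have i1 : IntegrableOn (fun x => φ x * inner ℝ (g x) e) Ω :=
      integrableOn_mul_inner_test h.2.1 hφ hc hs e
    have i2 : IntegrableOn (fun x => φ x * inner ℝ (g' x) e) Ω :=
      integrableOn_mul_inner_test h'.2.1 hφ hc hs e
    have h3 : ∀ x, inner ℝ e (φ x • (g x - g' x)) =
        φ x * inner ℝ (g x) e - φ x * inner ℝ (g' x) e := fun x => by
      rw [inner_smul_right, inner_sub_right, real_inner_comm, real_inner_comm (g' x), mul_sub]
    simp_rw [h3]
    rw [integral_sub i1 i2]
    linarith
  rw [Filter.EventuallyEq, ae_restrict_iff' hΩ.measurableSet]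
  filter_upwards [this] with x hx hxΩ using sub_eq_zero.1 (hx hxΩ)

lemma IsWeakGradient.weakGradient_ae_eq (hΩ : IsOpen Ω) {u : Space d → ℝ} {g : Space d → Space d}
    (h : IsWeakGradient Ω u g) : weakGradient Ω u =ᵐ[volume.restrict Ω] g := by
  have hex : ∃ g, IsWeakGradient Ω u g := ⟨g, h⟩
  rw [weakGradient, dif_pos hex]
  exact hex.choose_spec.ae_eq hΩ h

/-- The gradient in `energy` is an arbitrary choice; uniqueness almost everywhere lets any explicit
weak gradient replace it. -/
lemma IsWeakGradient.energy_eq (hΩ : IsOpen Ω) {u : Space d → ℝ} {g : Space d → Space d}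
    (h : IsWeakGradient Ω u g) :
    energy Ω u = ∫ x in Ω, (‖g x‖ ^ 2 + (Ioo (-1 : ℝ) 1).indicator 1 (u x)) := by
  refine integral_congr_ae ?_
  filter_upwards [h.weakGradient_ae_eq hΩ] with x hx
  rw [hx]

lemma IsWeakGradient.neg {u : Space d → ℝ} {g : Space d → Space d} (h : IsWeakGradient Ω u g) :
    IsWeakGradient Ω (fun x => -u x) (fun x => -g x) := by
  refine ⟨h.1.neg, h.2.1.neg, fun φ hφ hc hs e => ?_⟩
  simp only [neg_mul, inner_neg_left, mul_neg, integral_neg]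
  rw [h.2.2 φ hφ hc hs e]

lemma HasL2Gradient.neg {u : Space d → ℝ} {g : Space d → Space d} (h : HasL2Gradient Ω u g) :
    HasL2Gradient Ω (fun x => -u x) (fun x => -g x) :=
  ⟨h.memLp.neg, h.memLp_grad.neg, h.weak.neg⟩

lemma integrableOn_mul_fderiv_test {φ u : Space d → ℝ} (hu : LocallyIntegrableOn u Ω)
    (hφ : ContDiff ℝ ∞ φ) (hc : HasCompactSupport φ) (hs : tsupport φ ⊆ Ω) (e : Space d) :
    IntegrableOn (fun x => u x * fderiv ℝ φ x e) Ω := by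
  have := integrableOn_smul_test hu (contDiff_fderiv_apply hφ e).continuous
    (hasCompactSupport_fderiv_apply hc e) ((tsupport_partial_subset e).trans hs)
  simpa [mul_comm] using this

lemma HasL2Gradient.add {u v : Space d → ℝ} {g k : Space d → Space d}
    (hu : HasL2Gradient Ω u g) (hv : HasL2Gradient Ω v k) :
    HasL2Gradient Ω (fun x => u x + v x) (fun x => g x + k x) := by
  refine ⟨hu.memLp.add hv.memLp, hu.memLp_grad.add hv.memLp_grad, hu.weak.1.add hv.weak.1,
    hu.weak.2.1.add hv.weak.2.1, fun φ hφ hc hs e => ?_⟩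
  simp_rw [add_mul, inner_add_left, mul_add]
  rw [integral_add (integrableOn_mul_fderiv_test hu.weak.1 hφ hc hs e)
      (integrableOn_mul_fderiv_test hv.weak.1 hφ hc hs e),
    integral_add (integrableOn_mul_inner_test hu.weak.2.1 hφ hc hs e)
      (integrableOn_mul_inner_test hv.weak.2.1 hφ hc hs e),
    hu.weak.2.2 φ hφ hc hs e, hv.weak.2.2 φ hφ hc hs e]
  ring

lemma HasL2Gradient.sub {u v : Space d → ℝ} {g k : Space d → Space d}
    (hu : HasL2Gradient Ω u g) (hv : HasL2Gradient Ω v k) :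
    HasL2Gradient Ω (fun x => u x - v x) (fun x => g x - k x) := by
  simpa only [sub_eq_add_neg] using hu.add hv.neg

/-- A smooth compactly supported function has its gradient as weak gradient. -/
lemma hasL2Gradient_of_contDiff {f : Space d → ℝ} (hf : ContDiff ℝ ∞ f)
    (hfc : HasCompactSupport f) : HasL2Gradient Ω f (∇ f) := by
  have h1 : MemLp f 2 := hf.continuous.memLp_of_hasCompactSupport hfc
  have h2 : MemLp (∇ f) 2 := (continuous_gradient hf).memLp_of_hasCompactSupport
    (hasCompactSupport_gradient hfc)
  refine ⟨h1.mono_measure Measure.restrict_le_self, h2.mono_measure Measure.restrict_le_self,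
    hf.continuous.locallyIntegrable.locallyIntegrableOn _,
    (continuous_gradient hf).locallyIntegrable.locallyIntegrableOn _, fun φ hφ hc hs e => ?_⟩
  rw [setIntegral_eq_of_tsupport ((tsupport_partial_subset e).trans hs)
    (by intro x hx; simp [hx]), setIntegral_eq_of_tsupport hs (by intro x hx; simp [hx]),
    integral_mul_fderiv_test isOpen_univ (hf.of_le (by simp)).contDiffOn hφ hc (subset_univ _)]
  simp_rw [inner_gradient_left, mul_comm]

/-- The product rule for a test function and a weakly differentiable function. -/
lemma HasL2Gradient.mul_test {u η : Space d → ℝ} {g : Space d → Space d}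
    (hu : HasL2Gradient Ω u g) (hη : ContDiff ℝ ∞ η) (hηc : HasCompactSupport η) :
    HasL2Gradient Ω (fun x => η x * u x) (fun x => η x • g x + u x • ∇ η x) := by
  have hηb : MemLp η ⊤ (volume.restrict Ω) :=
    (hη.continuous.memLp_top_of_hasCompactSupport hηc volume).mono_measure
      Measure.restrict_le_self
  have hηb' : MemLp (∇ η) ⊤ (volume.restrict Ω) :=
    ((continuous_gradient hη).memLp_top_of_hasCompactSupport (hasCompactSupport_gradient hηc)
      volume).mono_measure Measure.restrict_le_self
  have m1 : MemLp (fun x => η x * u x) 2 (volume.restrict Ω) := hu.memLp.mul hηb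
  have m2 : MemLp (fun x => η x • g x) 2 (volume.restrict Ω) := hu.memLp_grad.smul hηb
  have m3 : MemLp (fun x => u x • ∇ η x) 2 (volume.restrict Ω) := hηb'.smul hu.memLp
  refine ⟨m1, m2.add m3,
    locallyIntegrableOn_of_locallyIntegrable_restrict (m1.locallyIntegrable (by norm_num)),
    locallyIntegrableOn_of_locallyIntegrable_restrict
      ((m2.add m3).locallyIntegrable (by norm_num)), fun φ hφ hc hs e => ?_⟩
  have hηφ : ContDiff ℝ ∞ fun x => η x * φ x := hη.mul hφ
  have hcηφ : HasCompactSupport fun x => η x * φ x := hc.mul_left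
  have hsηφ : tsupport (fun x => η x * φ x) ⊆ Ω := (tsupport_mul_subset_right).trans hs
  have h := hu.weak.2.2 _ hηφ hcηφ hsηφ e
  have hprod : ∀ x, u x * fderiv ℝ (fun x => η x * φ x) x e =
      η x * u x * fderiv ℝ φ x e + u x * φ x * inner ℝ (∇ η x) e := by
    intro x
    rw [fderiv_fun_mul (hη.differentiable (by simp) x) (hφ.differentiable (by simp) x),
      inner_gradient_left]
    simp only [add_apply, smul_apply, smul_eq_mul]
    ring
  simp_rw [hprod] at h
  have i1 : IntegrableOn (fun x => η x * u x * fderiv ℝ φ x e) Ω :=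
    integrableOn_mul_fderiv_test
      (locallyIntegrableOn_of_locallyIntegrable_restrict (m1.locallyIntegrable (by norm_num)))
      hφ hc hs e
  have i2 : IntegrableOn (fun x => φ x * inner ℝ (η x • g x) e) Ω :=
    integrableOn_mul_inner_test
      (locallyIntegrableOn_of_locallyIntegrable_restrict (m2.locallyIntegrable (by norm_num)))
      hφ hc hs e
  have i3 : IntegrableOn (fun x => φ x * inner ℝ (u x • ∇ η x) e) Ω :=
    integrableOn_mul_inner_test
      (locallyIntegrableOn_of_locallyIntegrable_restrict (m3.locallyIntegrable (by norm_num)))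
      hφ hc hs e
  simp_rw [inner_smul_left, RCLike.conj_to_real] at i2 i3
  have i3' : IntegrableOn (fun x => u x * φ x * inner ℝ (∇ η x) e) Ω := by
    refine i3.congr (Eventually.of_forall fun x => ?_)
    simp only
    ring
  rw [integral_add i1 i3'] at h
  simp_rw [inner_add_left, inner_smul_left, RCLike.conj_to_real, mul_add]
  rw [integral_add i2 i3]
  have e1 : ∫ x in Ω, η x * φ x * inner ℝ (g x) e = ∫ x in Ω, φ x * (η x * inner ℝ (g x) e) := by
    congr 1; ext x; ring
  have e2 : ∫ x in Ω, u x * φ x * inner ℝ (∇ η x) e =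
      ∫ x in Ω, φ x * (u x * inner ℝ (∇ η x) e) := by
    congr 1; ext x; ring
  rw [e1, e2] at h
  linarith

/-! ### The positive part of a smooth function -/

/-- The gradient of the positive part of a smooth function. -/
noncomputable def posGrad (z : Space d → ℝ) : Space d → Space d :=
  {x | 0 < z x}.indicator (∇ z)

lemma tendsto_ramp (s : ℝ) : Tendsto (fun δ => ramp δ s) (𝓝[>] 0) (𝓝 (max s 0)) := by
  rw [tendsto_iff_norm_sub_tendsto_zero]
  refine squeeze_zero' (Eventually.of_forall fun _ => norm_nonneg _) ?_
    (tendsto_nhdsWithin_of_tendsto_nhds (tendsto_id (x := 𝓝 (0 : ℝ))))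
  filter_upwards [self_mem_nhdsWithin] with δ hδ using abs_ramp_sub_le hδ

lemma tendsto_deriv_ramp (s : ℝ) :
    Tendsto (fun δ => deriv (ramp δ) s) (𝓝[>] 0) (𝓝 ((Ioi (0 : ℝ)).indicator 1 s)) := by
  by_cases hs : 0 < s
  · rw [indicator_of_mem (show s ∈ Ioi 0 from hs)]
    refine tendsto_const_nhds.congr' ?_
    filter_upwards [Ioo_mem_nhdsGT hs] with δ hδ
    rw [deriv_ramp hδ.1]
    exact (Real.smoothTransition.one_of_one_le (by rw [one_le_div hδ.1]; exact hδ.2.le)).symm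
  · rw [indicator_of_notMem (show s ∉ Ioi 0 from hs)]
    refine tendsto_const_nhds.congr' ?_
    filter_upwards [self_mem_nhdsWithin] with δ hδ
    rw [deriv_ramp hδ]
    exact (Real.smoothTransition.zero_of_nonpos
      (div_nonpos_of_nonpos_of_nonneg (not_lt.1 hs) (le_of_lt hδ))).symm

lemma abs_deriv_ramp_le {δ : ℝ} (hδ : 0 < δ) (s : ℝ) : |deriv (ramp δ) s| ≤ 1 := by
  rw [deriv_ramp hδ, abs_of_nonneg (Real.smoothTransition.nonneg _)]
  exact Real.smoothTransition.le_one _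

variable {z : Space d → ℝ} {K : Set (Space d)}

lemma contDiff_ramp_comp (hz : ContDiff ℝ ∞ z) {δ : ℝ} (hδ : 0 < δ) :
    ContDiff ℝ ∞ fun x => ramp δ (z x) := (contDiff_ramp hδ).comp hz

lemma hasCompactSupport_ramp_comp (hK : IsCompact K) (hzK : ∀ x, x ∉ K → z x ≤ 0)
    {δ : ℝ} (hδ : 0 < δ) : HasCompactSupport fun x => ramp δ (z x) :=
  HasCompactSupport.of_support_subset_isCompact hK fun x hx =>
    by_contra fun h => hx (ramp_eq_zero hδ (hzK x h))

lemma gradient_ramp_comp (hz : ContDiff ℝ ∞ z) {δ : ℝ} (hδ : 0 < δ) (x : Space d) :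
    ∇ (fun x => ramp δ (z x)) x = deriv (ramp δ) (z x) • ∇ z x :=
  gradient_fun_comp (hz.differentiable (by simp) x)
    ((contDiff_ramp hδ).differentiable (by simp) _)

lemma tendsto_gradient_ramp_comp (hz : ContDiff ℝ ∞ z) (x : Space d) :
    Tendsto (fun δ => ∇ (fun x => ramp δ (z x)) x) (𝓝[>] 0) (𝓝 (posGrad z x)) := by
  have h := (tendsto_deriv_ramp (z x)).smul_const (∇ z x)
  have h2 : (Ioi (0 : ℝ)).indicator (1 : ℝ → ℝ) (z x) • ∇ z x = posGrad z x := by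
    by_cases hx : 0 < z x
    · simp [posGrad, hx]
    · simp [posGrad, hx]
  rw [h2] at h
  refine h.congr' ?_
  filter_upwards [self_mem_nhdsWithin] with δ hδ
  rw [gradient_ramp_comp hz hδ]

lemma norm_gradient_ramp_comp_le (hz : ContDiff ℝ ∞ z) (hzK : ∀ x, x ∉ K → z x ≤ 0)
    {δ : ℝ} (hδ : 0 < δ) (x : Space d) :
    ‖∇ (fun x => ramp δ (z x)) x‖ ≤ K.indicator (fun x => ‖∇ z x‖) x := by
  rw [gradient_ramp_comp hz hδ, norm_smul, Real.norm_eq_abs]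
  by_cases hx : x ∈ K
  · rw [indicator_of_mem hx]
    exact mul_le_of_le_one_left (norm_nonneg _) (abs_deriv_ramp_le hδ _)
  · rw [indicator_of_notMem hx, deriv_ramp hδ]
    simp only
    rw [Real.smoothTransition.zero_of_nonpos
      (div_nonpos_of_nonpos_of_nonneg (hzK x hx) hδ.le)]
    simp

lemma norm_posGrad_le (hzK : ∀ x, x ∉ K → z x ≤ 0) (x : Space d) :
    ‖posGrad z x‖ ≤ K.indicator (fun x => ‖∇ z x‖) x := by
  by_cases hx : x ∈ K
  · rw [indicator_of_mem hx]
    exact norm_indicator_le_norm_self _ _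
  · rw [indicator_of_notMem hx, posGrad, indicator_of_notMem, norm_zero]
    simpa using hzK x hx

lemma measurableSet_pos (hz : Continuous z) : MeasurableSet {x | 0 < z x} :=
  (isOpen_lt continuous_const hz).measurableSet

lemma aestronglyMeasurable_posGrad (hz : ContDiff ℝ ∞ z) : AEStronglyMeasurable (posGrad z) :=
  (continuous_gradient hz).aestronglyMeasurable.indicator (measurableSet_pos hz.continuous)

/-- The weak gradient of the positive part of a smooth function. -/
lemma hasL2Gradient_posPart (hz : ContDiff ℝ ∞ z) (hK : IsCompact K)
    (hzK : ∀ x, x ∉ K → z x ≤ 0) :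
    HasL2Gradient Ω (fun x => max (z x) 0) (posGrad z) := by
  have hcont : Continuous fun x => max (z x) 0 := hz.continuous.max continuous_const
  have hsupp : HasCompactSupport fun x => max (z x) 0 :=
    HasCompactSupport.of_support_subset_isCompact hK fun x hx =>
      by_contra fun h => hx (max_eq_right (hzK x h))
  have m1 : MemLp (fun x => max (z x) 0) 2 := hcont.memLp_of_hasCompactSupport hsupp
  obtain ⟨C, hC⟩ := hK.exists_bound_of_continuousOn (continuous_gradient hz).continuousOn
  have m0 : MemLp (K.indicator fun _ => (C : ℝ)) 2 :=
    memLp_indicator_const 2 hK.measurableSet C (Or.inr hK.measure_lt_top.ne)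
  have hbd : ∀ x, K.indicator (fun x => ‖∇ z x‖) x ≤ K.indicator (fun _ => C) x := fun x => by
    by_cases hx : x ∈ K
    · simpa [hx] using hC x hx
    · simp [hx]
  have m2 : MemLp (posGrad z) 2 := by
    refine m0.mono' (aestronglyMeasurable_posGrad hz) (Eventually.of_forall fun x => ?_)
    exact (norm_posGrad_le hzK x).trans (hbd x)
  refine ⟨m1.mono_measure Measure.restrict_le_self, m2.mono_measure Measure.restrict_le_self,
    hcont.locallyIntegrable.locallyIntegrableOn _,
    (m2.locallyIntegrable (by norm_num)).locallyIntegrableOn _, fun φ hφ hc hs e => ?_⟩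
  have hφ1 := contDiff_fderiv_apply hφ e
  obtain ⟨A, hA⟩ := hφ1.continuous.bounded_above_of_compact_support
    (hasCompactSupport_fderiv_apply hc e)
  obtain ⟨B, hB⟩ := hφ.continuous.bounded_above_of_compact_support hc
  -- The defining identity holds for the smooth functions `ramp δ ∘ z`; both sides pass to the limit
  -- by dominated convergence. The gradients converge at every point, also on `{z = 0}`, because
  -- `deriv (ramp δ)` vanishes at 0.
  have t1 : Tendsto (fun δ => ∫ x in Ω, ramp δ (z x) * fderiv ℝ φ x e) (𝓝[>] 0)
      (𝓝 (∫ x in Ω, max (z x) 0 * fderiv ℝ φ x e)) := by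
    refine tendsto_integral_filter_of_dominated_convergence
      (fun x => max (z x) 0 * A) ?_ ?_ ?_ ?_
    · filter_upwards [self_mem_nhdsWithin] with δ hδ
      exact ((contDiff_ramp_comp hz hδ).continuous.mul hφ1.continuous).aestronglyMeasurable
    · filter_upwards [self_mem_nhdsWithin] with δ hδ
      refine Eventually.of_forall fun x => ?_
      rw [norm_mul, Real.norm_of_nonneg (ramp_nonneg hδ _)]
      refine mul_le_mul ?_ (hA x) (norm_nonneg _) (le_max_right _ _)
      rcases le_total (z x) 0 with h | h
      · rw [ramp_eq_zero hδ h]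
        exact le_max_right _ _
      · exact (ramp_le hδ h).trans (le_max_left _ _)
    · exact ((hcont.integrable_of_hasCompactSupport hsupp).mul_const A).integrableOn
    · exact Eventually.of_forall fun x => (tendsto_ramp (z x)).mul_const _
  have t2 : Tendsto (fun δ => ∫ x in Ω, φ x * inner ℝ (∇ (fun x => ramp δ (z x)) x) e) (𝓝[>] 0)
      (𝓝 (∫ x in Ω, φ x * inner ℝ (posGrad z x) e)) := by
    refine tendsto_integral_filter_of_dominated_convergence
      (fun x => B * (K.indicator (fun _ => C) x * ‖e‖)) ?_ ?_ ?_ ?_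
    · filter_upwards [self_mem_nhdsWithin] with δ hδ
      exact (hφ.continuous.mul ((continuous_gradient (contDiff_ramp_comp hz hδ)).inner
        continuous_const)).aestronglyMeasurable
    · filter_upwards [self_mem_nhdsWithin] with δ hδ
      refine Eventually.of_forall fun x => ?_
      rw [norm_mul]
      have hB0 : 0 ≤ B := (norm_nonneg _).trans (hB x)
      refine mul_le_mul (hB x) ((norm_inner_le_norm _ _).trans ?_) (norm_nonneg _) hB0
      exact mul_le_mul_of_nonneg_right ((norm_gradient_ramp_comp_le hz hzK hδ x).trans (hbd x))
        (norm_nonneg _)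
    · refine (Integrable.const_mul (Integrable.mul_const ?_ _) _).integrableOn
      rw [integrable_indicator_iff hK.measurableSet]
      exact integrableOn_const hK.measure_lt_top.ne
    · exact Eventually.of_forall fun x =>
        ((tendsto_gradient_ramp_comp hz x).inner tendsto_const_nhds).const_mul _
  refine tendsto_nhds_unique t1 (t2.neg.congr' ?_)
  filter_upwards [self_mem_nhdsWithin] with δ hδ
  exact ((hasL2Gradient_of_contDiff (Ω := Ω) (contDiff_ramp_comp hz hδ)
    (hasCompactSupport_ramp_comp hK hzK hδ)).weak.2.2 φ hφ hc hs e).symm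

/-- A smooth function that is superharmonic on `K` has nonnegative Dirichlet pairing with
positive parts supported in `K`. -/
lemma integral_inner_posGrad_nonneg {b : Space d → ℝ} (hb : ContDiff ℝ ∞ b)
    (hz : ContDiff ℝ ∞ z) (hK : IsCompact K) (hzK : ∀ x, x ∉ K → z x ≤ 0)
    (hbK : ∀ x ∈ K, Δ b x ≤ 0) : 0 ≤ ∫ x, inner ℝ (∇ b x) (posGrad z x) := by
  have t : Tendsto (fun δ => ∫ x, inner ℝ (∇ b x) (∇ (fun x => ramp δ (z x)) x)) (𝓝[>] 0)
      (𝓝 (∫ x, inner ℝ (∇ b x) (posGrad z x))) := by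
    refine tendsto_integral_filter_of_dominated_convergence
      (K.indicator fun x => ‖∇ b x‖ * ‖∇ z x‖) ?_ ?_ ?_ ?_
    · filter_upwards [self_mem_nhdsWithin] with δ hδ
      exact ((continuous_gradient hb).inner
        (continuous_gradient (contDiff_ramp_comp hz hδ))).aestronglyMeasurable
    · filter_upwards [self_mem_nhdsWithin] with δ hδ
      refine Eventually.of_forall fun x => (norm_inner_le_norm _ _).trans ?_
      have := norm_gradient_ramp_comp_le hz hzK hδ x
      by_cases hx : x ∈ K
      · rw [indicator_of_mem hx] at this ⊢
        exact mul_le_mul_of_nonneg_left this (norm_nonneg _)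
      · rw [indicator_of_notMem hx] at this ⊢
        rw [le_antisymm this (norm_nonneg _), mul_zero]
    · rw [integrable_indicator_iff hK.measurableSet]
      exact ((continuous_gradient hb).norm.mul
        (continuous_gradient hz).norm).continuousOn.integrableOn_compact hK
    · exact Eventually.of_forall fun x =>
        tendsto_const_nhds.inner (tendsto_gradient_ramp_comp hz x)
  -- For each `δ` the pairing equals $-\int\Delta b\cdot$`ramp δ z`, where `ramp δ z` is nonnegative
  -- and vanishes off `K`.
  refine ge_of_tendsto t ?_
  filter_upwards [self_mem_nhdsWithin] with δ hδ
  rw [integral_inner_gradient hb (contDiff_ramp_comp hz hδ) (hasCompactSupport_ramp_comp hK hzK hδ),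
    ← integral_neg]
  refine integral_nonneg fun x => ?_
  by_cases hx : x ∈ K
  · have h1 := mul_nonneg (neg_nonneg.2 (hbK x hx)) (ramp_nonneg hδ (z x))
    change 0 ≤ -(Δ b x * ramp δ (z x))
    linarith
  · simp [ramp_eq_zero hδ (hzK x hx)]

end

section

variable {d : ℕ} {Ω G : Set (Space d)} {V W u : Space d → ℝ}

/-! ### The obstacle problem -/

/-- The characteristic function of `(-1, 1)`. -/
noncomputable abbrev chi (t : ℝ) : ℝ := (Ioo (-1 : ℝ) 1).indicator 1 t

lemma chi_nonneg (t : ℝ) : 0 ≤ chi t := indicator_nonneg (fun _ _ => zero_le_one) t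

lemma chi_le_one (t : ℝ) : chi t ≤ 1 := indicator_le_self' (fun _ _ => zero_le_one) t

lemma chi_neg (t : ℝ) : chi (-t) = chi t := by
  have : -t ∈ Ioo (-1 : ℝ) 1 ↔ t ∈ Ioo (-1 : ℝ) 1 := by
    constructor <;> rintro ⟨h1, h2⟩ <;> constructor <;> linarith
  by_cases h : t ∈ Ioo (-1 : ℝ) 1
  · rw [chi, chi, indicator_of_mem h, indicator_of_mem (this.2 h)]
    rfl
  · rw [chi, chi, indicator_of_notMem h, indicator_of_notMem (mt this.1 h)]

/-- A minimizer of the energy between two obstacles, the lower of which is subharmonic and the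
upper superharmonic in an open set `G`. -/
structure IsObstacleMinimizer (Ω G : Set (Space d)) (V W u : Space d → ℝ) : Prop where
  isOpen : IsOpen Ω
  volume_ne_top : volume Ω ≠ ⊤
  isOpen_sub : IsOpen G
  subset : G ⊆ Ω
  continuous_lower : Continuous V
  continuous_upper : Continuous W
  abs_lower_le : ∀ x, |V x| ≤ 1
  abs_upper_le : ∀ x, |W x| ≤ 1
  lower_le_upper : ∀ x, V x ≤ W x
  distSub_lower : DistSub V G
  distSub_neg_upper : DistSub (fun x => -W x) G
  minimizer : IsConstrainedMinimizer V W Ω u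

lemma mem_admissible_neg {v : Space d → ℝ} (h : v ∈ admissible V W Ω) :
    (fun x => -v x) ∈ admissible (fun x => -W x) (fun x => -V x) Ω := by
  obtain ⟨h1, h2⟩ := h
  obtain ⟨g, hg⟩ := h1.exists_hasL2Gradient
  refine ⟨hg.neg.memH1, ?_⟩
  filter_upwards [h2] with x hx
  exact ⟨neg_le_neg hx.2, neg_le_neg hx.1⟩

lemma energy_neg (hΩ : IsOpen Ω) {v : Space d → ℝ} (h : MemH1 Ω v) :
    energy Ω (fun x => -v x) = energy Ω v := by
  obtain ⟨g, hg⟩ := h.exists_hasL2Gradient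
  rw [hg.weak.energy_eq hΩ, hg.neg.weak.energy_eq hΩ]
  simp_rw [norm_neg]
  refine integral_congr_ae (Eventually.of_forall fun x => ?_)
  simp only
  rw [← chi, ← chi, chi_neg]

namespace IsObstacleMinimizer

/-- The penalty is even and the hypotheses on the two obstacles are mirror images. Every one-sided
estimate for `u` therefore also holds for `-u`. -/
lemma neg (P : IsObstacleMinimizer Ω G V W u) :
    IsObstacleMinimizer Ω G (fun x => -W x) (fun x => -V x) (fun x => -u x) where
  isOpen := P.isOpen
  volume_ne_top := P.volume_ne_top
  isOpen_sub := P.isOpen_sub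
  subset := P.subset
  continuous_lower := P.continuous_upper.neg
  continuous_upper := P.continuous_lower.neg
  abs_lower_le x := by rw [abs_neg]; exact P.abs_upper_le x
  abs_upper_le x := by rw [abs_neg]; exact P.abs_lower_le x
  lower_le_upper x := neg_le_neg (P.lower_le_upper x)
  distSub_lower := P.distSub_neg_upper
  distSub_neg_upper := by simpa using P.distSub_lower
  minimizer := by
    refine ⟨mem_admissible_neg P.minimizer.1, fun v hv => ?_⟩
    have hv' := mem_admissible_neg hv
    simp only [neg_neg] at hv'
    have := P.minimizer.2 _ hv'
    rwa [energy_neg P.isOpen hv.1, ← energy_neg P.isOpen P.minimizer.1.1] at this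

end IsObstacleMinimizer

/-- The extension of `u` by `W` outside `Ω`. -/
noncomputable def extend (Ω : Set (Space d)) (u W : Space d → ℝ) (x : Space d) : ℝ :=
  Ω.indicator u x + Ωᶜ.indicator W x

lemma extend_of_mem {x : Space d} (h : x ∈ Ω) : extend Ω u W x = u x := by
  simp [extend, h]

lemma extend_of_notMem {x : Space d} (h : x ∉ Ω) : extend Ω u W x = W x := by
  simp [extend, h]

namespace IsObstacleMinimizer

/-- Extending by `W` keeps the function between the obstacles on the whole space, so its
mollifications compare with those of `V` and `W` without reference to the boundary of `Ω`. -/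
lemma ae_le (P : IsObstacleMinimizer Ω G V W u) :
    ∀ᵐ x, V x ≤ extend Ω u W x ∧ extend Ω u W x ≤ W x := by
  have h := P.minimizer.1.2
  rw [ae_restrict_iff' P.isOpen.measurableSet] at h
  filter_upwards [h] with x hx
  by_cases hΩ : x ∈ Ω
  · rw [extend_of_mem hΩ]
    exact hx hΩ
  · rw [extend_of_notMem hΩ]
    exact ⟨P.lower_le_upper x, le_rfl⟩

lemma ae_abs_le (P : IsObstacleMinimizer Ω G V W u) : ∀ᵐ x, |extend Ω u W x| ≤ 1 := by
  filter_upwards [P.ae_le] with x hx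
  exact abs_le.2 ⟨(abs_le.1 (P.abs_lower_le x)).1.trans hx.1,
    hx.2.trans (abs_le.1 (P.abs_upper_le x)).2⟩

lemma aestronglyMeasurable_extend (P : IsObstacleMinimizer Ω G V W u) :
    AEStronglyMeasurable (extend Ω u W) := by
  refine AEStronglyMeasurable.add ?_ ?_
  · exact (aestronglyMeasurable_indicator_iff P.isOpen.measurableSet).2 P.minimizer.1.1.1.1
  · exact P.continuous_upper.aestronglyMeasurable.indicator P.isOpen.measurableSet.compl

lemma locallyIntegrable_extend (P : IsObstacleMinimizer Ω G V W u) :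
    LocallyIntegrable (extend Ω u W) :=
  (locallyIntegrable_const (1 : ℝ)).mono P.aestronglyMeasurable_extend (by
    filter_upwards [P.ae_abs_le] with x hx
    simpa using hx)

end IsObstacleMinimizer

lemma integral_inner_weakGradient {g : Space d → Space d} (hg : IsWeakGradient Ω u g)
    {φ : Space d → ℝ} (hφ : ContDiff ℝ ∞ φ) (hc : HasCompactSupport φ) (hs : tsupport φ ⊆ Ω) :
    ∫ x in Ω, inner ℝ (g x) (∇ φ x) = -∫ x in Ω, u x * Δ φ x := by
  rw [laplacian_eq_sum_dd_of_smooth hφ]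
  simp_rw [fun x => inner_eq_sum_stdVec (g x) (∇ φ x), inner_gradient_left, Finset.mul_sum]
  have h1 (i : Fin (d + 1)) := contDiff_fderiv_apply hφ (stdVec i)
  have h2 (i : Fin (d + 1)) := hasCompactSupport_fderiv_apply hc (stdVec i)
  have h3 (i : Fin (d + 1)) := (tsupport_partial_subset (φ := φ) (stdVec i)).trans hs
  rw [integral_finsetSum, integral_finsetSum, ← Finset.sum_neg_distrib]
  · refine Finset.sum_congr rfl fun i _ => ?_
    have := hg.2.2 _ (h1 i) (h2 i) (h3 i) (stdVec i)
    unfold dd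
    rw [this, neg_neg]
    simp_rw [mul_comm]
  · intro i _
    exact integrableOn_mul_fderiv_test hg.1 (h1 i) (h2 i) (h3 i) _
  · intro i _
    have := integrableOn_mul_inner_test hg.2.1 (h1 i) (h2 i) (h3 i) (stdVec i)
    simp_rw [mul_comm (fderiv ℝ φ _ _)] at this
    exact this

/-! ### The variational inequality -/

/-- A nonnegative variation together with a cutoff function equal to one on its support. -/
structure IsVariation (G : Set (Space d)) (φ η : Space d → ℝ) : Prop where
  smooth : ContDiff ℝ ∞ φ
  nonneg : ∀ x, 0 ≤ φ x
  cut_smooth : ContDiff ℝ ∞ η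
  cut_compact : HasCompactSupport η
  cut_tsupport : tsupport η ⊆ G
  cut_nonneg : ∀ x, 0 ≤ η x
  cut_le_one : ∀ x, η x ≤ 1
  cut_eq_one : ∀ x, φ x ≠ 0 → η x = 1

namespace IsVariation

variable {φ η : Space d → ℝ}

lemma tsupport_subset (h : IsVariation G φ η) : tsupport φ ⊆ tsupport η :=
  closure_mono fun x hx => by
    rw [Function.mem_support, h.cut_eq_one x hx]
    exact one_ne_zero

lemma eq_zero (h : IsVariation G φ η) {x : Space d} (hx : x ∉ tsupport η) : φ x = 0 :=
  image_eq_zero_of_notMem_tsupport fun h' => hx (h.tsupport_subset h')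

lemma hasCompactSupport (h : IsVariation G φ η) : HasCompactSupport φ :=
  h.cut_compact.mono' (subset_closure.trans h.tsupport_subset)

/-- At such a point the cutoff attains its maximum value 1. Hence `η` need not equal 1 on a
neighbourhood of the closed support of `φ`. -/
lemma gradient_cut (h : IsVariation G φ η) {x : Space d} (hx : φ x ≠ 0) : ∇ η x = 0 := by
  have hmax : IsLocalMax η x := Eventually.of_forall fun y => by
    rw [h.cut_eq_one x hx]
    exact h.cut_le_one y
  simp [gradient, hmax.fderiv_eq_zero]

end IsVariation

/-! ### The mollified, shifted and truncated competitor. -/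

section competitor

variable {φ η : Space d → ℝ} {θ : ℝ → ℝ}

/-- The excess of the shifted mollification over the mollified upper obstacle. -/
noncomputable def excess (θ : ℝ → ℝ) (Ω : Set (Space d)) (u W φ : Space d → ℝ) (s : ℝ)
    (x : Space d) : ℝ :=
  φ x - (moll θ s W x - moll θ s (extend Ω u W) x)

/-- The competitor: inside the cutoff, the mollification of `u` is shifted by `φ` and truncated by
the mollified upper obstacle. -/
noncomputable def competitor (θ : ℝ → ℝ) (Ω : Set (Space d)) (u W φ η : Space d → ℝ) (s : ℝ)
    (x : Space d) : ℝ :=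
  u x - η x * u x + (η x * moll θ s (extend Ω u W) x + φ x) - max (excess θ Ω u W φ s x) 0

/-- The gradient of the competitor before truncation. -/
noncomputable def shiftGrad (θ : ℝ → ℝ) (Ω : Set (Space d)) (u W φ η : Space d → ℝ)
    (g : Space d → Space d) (s : ℝ) (x : Space d) : Space d :=
  g x - (η x • g x + u x • ∇ η x) + ∇ (fun x => η x * moll θ s (extend Ω u W) x + φ x) x

variable (P : IsObstacleMinimizer Ω G V W u) (hv : IsVariation G φ η) (hθ : IsProfile θ)
  (hm : mass d θ = 1) {s : ℝ} (hs : 0 < s)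

include P hθ hs

lemma contDiff_moll_extend : ContDiff ℝ ∞ (moll θ s (extend Ω u W)) :=
  contDiff_moll hθ hs P.locallyIntegrable_extend

lemma contDiff_moll_upper : ContDiff ℝ ∞ (moll θ s W) :=
  contDiff_moll hθ hs P.continuous_upper.locallyIntegrable

lemma moll_extend_le_moll_upper (x : Space d) : moll θ s (extend Ω u W) x ≤ moll θ s W x := by
  refine moll_mono_ae hθ hs P.locallyIntegrable_extend P.continuous_upper.locallyIntegrable ?_
  filter_upwards [P.ae_le] with y hy _ using hy.2

lemma excess_le (x : Space d) : excess θ Ω u W φ s x ≤ φ x := by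
  have := moll_extend_le_moll_upper P hθ hs x
  rw [excess]
  linarith

include hm in
-- The chain is $V\le V_s\le u_s$: subharmonicity of `V` in the ball, then monotonicity of
-- mollification. Superharmonicity of `W` gives $W_s\le W$ in the same way in `moll_upper_le`.
lemma lower_le_moll_extend {x : Space d} (hx : Metric.closedBall x s ⊆ G) :
    V x ≤ moll θ s (extend Ω u W) x := by
  have h1 := P.distSub_lower.le_moll hθ P.continuous_lower.locallyIntegrable hs hx
    P.continuous_lower.continuousAt
  rw [hm, one_mul] at h1
  refine h1.trans (moll_mono_ae hθ hs P.continuous_lower.locallyIntegrable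
    P.locallyIntegrable_extend ?_)
  filter_upwards [P.ae_le] with y hy _ using hy.1

include hm in
lemma moll_upper_le {x : Space d} (hx : Metric.closedBall x s ⊆ G) : moll θ s W x ≤ W x := by
  have h1 := P.distSub_neg_upper.le_moll hθ
    (f := fun x => -W x) P.continuous_upper.neg.locallyIntegrable hs hx
    P.continuous_upper.neg.continuousAt
  rw [hm, one_mul, moll_neg] at h1
  linarith

lemma excess_nonpos {x : Space d} (hx : φ x = 0) : excess θ Ω u W φ s x ≤ 0 :=
  hx ▸ excess_le P hθ hs x

include hv

lemma contDiff_excess : ContDiff ℝ ∞ (excess θ Ω u W φ s) :=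
  hv.smooth.sub ((contDiff_moll_upper P hθ hs).sub (contDiff_moll_extend P hθ hs))

lemma excess_nonpos_off (x : Space d) (hx : x ∉ tsupport η) : excess θ Ω u W φ s x ≤ 0 :=
  excess_nonpos P hθ hs (hv.eq_zero hx)

lemma hasL2Gradient_competitor {g : Space d → Space d} (hg : HasL2Gradient Ω u g) :
    HasL2Gradient Ω (competitor θ Ω u W φ η s)
      (fun x => shiftGrad θ Ω u W φ η g s x - posGrad (excess θ Ω u W φ s) x) := by
  have hC : ContDiff ℝ ∞ fun x => η x * moll θ s (extend Ω u W) x + φ x :=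
    (hv.cut_smooth.mul (contDiff_moll_extend P hθ hs)).add hv.smooth
  have hCc : HasCompactSupport fun x => η x * moll θ s (extend Ω u W) x + φ x :=
    HasCompactSupport.add hv.cut_compact.mul_right hv.hasCompactSupport
  exact ((hg.sub (hg.mul_test hv.cut_smooth hv.cut_compact)).add
    (hasL2Gradient_of_contDiff hC hCc)).sub
    (hasL2Gradient_posPart (contDiff_excess P hv hθ hs) hv.cut_compact
      (excess_nonpos_off P hv hθ hs))

include hm in
-- Where $\varphi=0$ the competitor is a convex combination of $u$ and $u_s$; where $\varphi\ne0$ it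
-- is $\min(u_s+\varphi,W_s)$. Both lie between the obstacles because $V\le u_s\le W_s\le W$ on the
-- support of the cutoff.
lemma competitor_mem_admissible (hball : ∀ x ∈ tsupport η, Metric.closedBall x s ⊆ G) :
    competitor θ Ω u W φ η s ∈ admissible V W Ω := by
  obtain ⟨g, hg⟩ := P.minimizer.1.1.exists_hasL2Gradient
  refine ⟨(hasL2Gradient_competitor P hv hθ hs hg).memH1, ?_⟩
  filter_upwards [P.minimizer.1.2] with x hx
  have hUW := moll_extend_le_moll_upper P hθ hs x
  by_cases hφ : φ x = 0
  · have h1 := excess_nonpos P hθ hs hφ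
    rw [competitor, max_eq_right h1, hφ]
    have h2 := hv.cut_nonneg x
    have h3 := hv.cut_le_one x
    by_cases hη : η x = 0
    · rw [hη]
      constructor <;> linarith [hx.1, hx.2]
    · have hb := hball x (subset_tsupport _ hη)
      have h4 := lower_le_moll_extend P hθ hm hs hb
      have h5 := moll_upper_le P hθ hm hs hb
      constructor
      · nlinarith [hx.1, hx.2]
      · nlinarith [hx.1, hx.2]
  · have hη := hv.cut_eq_one x hφ
    have hb := hball x (subset_tsupport _ (by rw [Function.mem_support, hη]; exact one_ne_zero))
    have h4 := lower_le_moll_extend P hθ hm hs hb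
    have h5 := moll_upper_le P hθ hm hs hb
    have h6 := hv.nonneg x
    rw [competitor, hη]
    rcases le_total (excess θ Ω u W φ s x) 0 with h | h
    · rw [max_eq_right h]
      rw [excess] at h
      constructor <;> linarith
    · rw [max_eq_left h, excess]
      constructor <;> linarith

lemma competitor_eq_off {x : Space d} (hx : x ∉ tsupport η) :
    competitor θ Ω u W φ η s x = u x := by
  rw [competitor, max_eq_right (excess_nonpos_off P hv hθ hs x hx), hv.eq_zero hx,
    image_eq_zero_of_notMem_tsupport hx]
  ring

/-- This isolates the limit gradient `g + ∇ φ` from an error caused only by mollification. -/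
lemma shiftGrad_eq (g : Space d → Space d) (x : Space d) :
    shiftGrad θ Ω u W φ η g s x = (g x + ∇ φ x) +
      (η x • (∇ (moll θ s (extend Ω u W)) x - g x)
        + (moll θ s (extend Ω u W) x - u x) • ∇ η x) := by
  have h1 : DifferentiableAt ℝ η x := hv.cut_smooth.differentiable (by simp) x
  have h2 : DifferentiableAt ℝ (moll θ s (extend Ω u W)) x :=
    (contDiff_moll_extend P hθ hs).differentiable (by simp) x
  have h3 : DifferentiableAt ℝ φ x := hv.smooth.differentiable (by simp) x
  rw [shiftGrad, gradient_fun_add (f := fun x => η x * moll θ s (extend Ω u W) x) (h1.mul h2) h3,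
    gradient_fun_mul h1 h2]
  module

/-- Let $z$ be the excess. On $\{z>0\}$ the gradient before truncation is $\nabla W_s+\nabla z$ and
after truncation $\nabla W_s$; expanding the square and dropping $-|\nabla z|^2$ gives the bound.
Elsewhere the truncation does nothing. -/
lemma norm_sub_posGrad_sq (g : Space d → Space d) (x : Space d) :
    ‖shiftGrad θ Ω u W φ η g s x - posGrad (excess θ Ω u W φ s) x‖ ^ 2 ≤
      ‖shiftGrad θ Ω u W φ η g s x‖ ^ 2
        - 2 * inner ℝ (∇ (moll θ s W) x) (posGrad (excess θ Ω u W φ s) x) := by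
  by_cases hz : 0 < excess θ Ω u W φ s x
  · have hφ : φ x ≠ 0 := (hz.trans_le (excess_le P hθ hs x)).ne'
    have hp : posGrad (excess θ Ω u W φ s) x = ∇ (excess θ Ω u W φ s) x :=
      indicator_of_mem (s := {x | 0 < excess θ Ω u W φ s x}) hz _
    have h2 : DifferentiableAt ℝ (moll θ s (extend Ω u W)) x :=
      (contDiff_moll_extend P hθ hs).differentiable (by simp) x
    have h4 : DifferentiableAt ℝ (moll θ s W) x :=
      (contDiff_moll_upper P hθ hs).differentiable (by simp) x
    have h3 : DifferentiableAt ℝ φ x := hv.smooth.differentiable (by simp) x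
    have hE : ∇ (excess θ Ω u W φ s) x = ∇ φ x
        - (∇ (moll θ s W) x - ∇ (moll θ s (extend Ω u W)) x) := by
      rw [← gradient_fun_sub h4 h2, ← gradient_fun_sub h3 (h4.fun_sub h2)]
      rfl
    have hH : shiftGrad θ Ω u W φ η g s x = ∇ (moll θ s W) x + ∇ (excess θ Ω u W φ s) x := by
      rw [shiftGrad_eq P hv hθ hs, hv.gradient_cut hφ, hv.cut_eq_one x hφ, hE]
      module
    rw [hp, hH, add_sub_cancel_right, norm_add_sq_real]
    nlinarith [sq_nonneg ‖∇ (excess θ Ω u W φ s) x‖]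
  · have hp : posGrad (excess θ Ω u W φ s) x = 0 :=
      indicator_of_notMem (s := {x | 0 < excess θ Ω u W φ s x}) hz _
    simp [hp]

end competitor

end

/-! ### Energy comparison and removal of the mollification. -/

section

variable {d : ℕ} {Ω G : Set (Space d)} {V W u φ η : Space d → ℝ} {θ : ℝ → ℝ}

/-- The part of the cutoff region on which the penalty of `u` may increase. -/
noncomputable def slack (Ω : Set (Space d)) (u η : Space d → ℝ) : ℝ :=
  ∫ x in Ω, (tsupport η).indicator (fun x => 1 - chi (u x)) x

/-- Changing `u` inside `K` can raise the penalty only where it was zero. This sharp form makes the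
cost vanish when $|u|<1$ on `K`, which is what yields harmonicity. -/
lemma chi_le_of_off {K : Set (Space d)} {v : Space d → ℝ} (h : ∀ x, x ∉ K → v x = u x)
    (x : Space d) : chi (v x) ≤ chi (u x) + K.indicator (fun x => 1 - chi (u x)) x := by
  by_cases hx : x ∈ K
  · rw [indicator_of_mem hx]
    linarith [chi_le_one (v x)]
  · rw [indicator_of_notMem hx, h x hx, add_zero]

lemma aestronglyMeasurable_chi {μ : Measure (Space d)} {v : Space d → ℝ}
    (hv : AEStronglyMeasurable v μ) : AEStronglyMeasurable (fun x => chi (v x)) μ :=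
  ((measurable_one.indicator measurableSet_Ioo).comp_aemeasurable
    hv.aemeasurable).aestronglyMeasurable

lemma integrableOn_chi (hΩ : volume Ω ≠ ⊤) {v : Space d → ℝ}
    (hv : AEStronglyMeasurable v (volume.restrict Ω)) :
    IntegrableOn (fun x => chi (v x)) Ω := by
  refine (integrableOn_const (C := (1 : ℝ)) hΩ).mono' (aestronglyMeasurable_chi hv)
    (Eventually.of_forall fun x => ?_)
  rw [Real.norm_of_nonneg (chi_nonneg _)]
  exact chi_le_one _

lemma integrable_inner_posGrad {b z : Space d → ℝ} {K : Set (Space d)} (hb : ContDiff ℝ ∞ b)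
    (hz : ContDiff ℝ ∞ z) (hK : IsCompact K) (hzK : ∀ x, x ∉ K → z x ≤ 0) :
    Integrable fun x => inner ℝ (∇ b x) (posGrad z x) := by
  have hi : Integrable (K.indicator fun x => ‖∇ b x‖ * ‖∇ z x‖) := by
    rw [integrable_indicator_iff hK.measurableSet]
    exact ((continuous_gradient hb).norm.mul
      (continuous_gradient hz).norm).continuousOn.integrableOn_compact hK
  refine hi.mono' ((continuous_gradient hb).aestronglyMeasurable.inner
    (aestronglyMeasurable_posGrad hz)) (Eventually.of_forall fun x =>
      (norm_inner_le_norm _ _).trans ?_)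
  have := norm_posGrad_le hzK x
  by_cases hx : x ∈ K
  · rw [indicator_of_mem hx] at this ⊢
    exact mul_le_mul_of_nonneg_left this (norm_nonneg _)
  · rw [indicator_of_notMem hx] at this ⊢
    rw [le_antisymm this (norm_nonneg _), mul_zero]

/-- Minimality against the competitor. The cross term from truncation has a favourable sign because
the mollified upper obstacle is superharmonic on the support of the cutoff, so the truncation
disappears from the estimate. -/
lemma integral_norm_sq_le_shiftGrad (P : IsObstacleMinimizer Ω G V W u) (hv : IsVariation G φ η)
    (hθ : IsProfile θ) (hm : mass d θ = 1) {s : ℝ} (hs : 0 < s) {g : Space d → Space d}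
    (hg : HasL2Gradient Ω u g) (hball : ∀ x ∈ tsupport η, Metric.closedBall x s ⊆ G) :
    MemLp (shiftGrad θ Ω u W φ η g s) 2 (volume.restrict Ω) ∧
    ∫ x in Ω, ‖g x‖ ^ 2 ≤ (∫ x in Ω, ‖shiftGrad θ Ω u W φ η g s x‖ ^ 2) + slack Ω u η := by
  set z := excess θ Ω u W φ s with hzdef
  have hz : ContDiff ℝ ∞ z := contDiff_excess P hv hθ hs
  have hzK : ∀ x, x ∉ tsupport η → z x ≤ 0 := excess_nonpos_off P hv hθ hs
  have hW := contDiff_moll_upper P hθ hs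
  have hcomp := hasL2Gradient_competitor P hv hθ hs hg
  have hpos := hasL2Gradient_posPart (Ω := Ω) hz hv.cut_compact hzK
  have hH : MemLp (shiftGrad θ Ω u W φ η g s) 2 (volume.restrict Ω) := by
    have := hcomp.memLp_grad.add hpos.memLp_grad
    refine this.ae_eq (Eventually.of_forall fun x => ?_)
    simp [hzdef]
  refine ⟨hH, ?_⟩
  have hmin := P.minimizer.2 _ (competitor_mem_admissible P hv hθ hm hs hball)
  rw [hg.weak.energy_eq P.isOpen, hcomp.weak.energy_eq P.isOpen] at hmin
  have i1 : IntegrableOn (fun x => ‖g x‖ ^ 2) Ω := hg.memLp_grad.integrable_norm_pow (by norm_num)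
  have i2 : IntegrableOn (fun x => chi (u x)) Ω := integrableOn_chi P.volume_ne_top hg.memLp.1
  have i3 : IntegrableOn (fun x => ‖shiftGrad θ Ω u W φ η g s x‖ ^ 2) Ω :=
    hH.integrable_norm_pow (by norm_num)
  have i4 : Integrable fun x => inner ℝ (∇ (moll θ s W) x) (posGrad z x) :=
    integrable_inner_posGrad hW hz hv.cut_compact hzK
  have i5 : IntegrableOn (fun x => (tsupport η).indicator (fun x => 1 - chi (u x)) x) Ω :=
    Integrable.indicator ((integrableOn_const (C := (1 : ℝ)) P.volume_ne_top).sub i2)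
      (isClosed_tsupport η).measurableSet
  have hnn : 0 ≤ ∫ x in Ω, inner ℝ (∇ (moll θ s W) x) (posGrad z x) := by
    rw [setIntegral_eq_of_tsupport (hv.cut_tsupport.trans P.subset)]
    · refine integral_inner_posGrad_nonneg hW hz hv.cut_compact hzK fun x hx => ?_
      have h1 := P.distSub_neg_upper.laplacian_moll_nonneg hθ
        (f := fun x => -W x) P.continuous_upper.neg.locallyIntegrable hs (hball x hx)
      have h2 : moll θ s (fun x => -W x) = -moll θ s W := funext fun x => moll_neg θ s W x
      rw [h2, InnerProductSpace.laplacian_neg] at h1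
      simpa using h1
    · intro x hx
      have hφ : φ x = 0 := by
        by_contra h
        exact one_ne_zero ((hv.cut_eq_one x h).symm.trans hx)
      have : posGrad z x = 0 := indicator_of_notMem (s := {x | 0 < z x})
        (not_lt.2 (excess_nonpos P hθ hs hφ)) _
      rw [this, inner_zero_right]
  have hle : ∫ x in Ω, (‖shiftGrad θ Ω u W φ η g s x - posGrad z x‖ ^ 2
      + chi (competitor θ Ω u W φ η s x)) ≤ ∫ x in Ω, ((‖shiftGrad θ Ω u W φ η g s x‖ ^ 2
        - 2 * inner ℝ (∇ (moll θ s W) x) (posGrad z x)) + (chi (u x)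
          + (tsupport η).indicator (fun x => 1 - chi (u x)) x)) := by
    refine integral_mono_of_nonneg (Eventually.of_forall fun x => ?_)
      ((i3.sub (i4.integrableOn.const_mul 2)).add (i2.add i5)) (Eventually.of_forall fun x => ?_)
    · exact add_nonneg (sq_nonneg _) (chi_nonneg _)
    · exact add_le_add (norm_sub_posGrad_sq P hv hθ hs g x)
        (chi_le_of_off (fun x hx => competitor_eq_off P hv hθ hs hx) x)
  have e1 : ∫ x in Ω, ((‖shiftGrad θ Ω u W φ η g s x‖ ^ 2
        - 2 * inner ℝ (∇ (moll θ s W) x) (posGrad z x)) + (chi (u x)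
          + (tsupport η).indicator (fun x => 1 - chi (u x)) x)) =
      ((∫ x in Ω, ‖shiftGrad θ Ω u W φ η g s x‖ ^ 2)
        - 2 * ∫ x in Ω, inner ℝ (∇ (moll θ s W) x) (posGrad z x))
        + ((∫ x in Ω, chi (u x)) + slack Ω u η) := by
    have i34 : IntegrableOn (fun x => ‖shiftGrad θ Ω u W φ η g s x‖ ^ 2
        - 2 * inner ℝ (∇ (moll θ s W) x) (posGrad z x)) Ω := i3.sub (i4.integrableOn.const_mul 2)
    have i25 : IntegrableOn (fun x => chi (u x)
          + (tsupport η).indicator (fun x => 1 - chi (u x)) x) Ω := i2.add i5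
    rw [integral_add i34 i25, integral_add i2 i5, integral_sub i3 (i4.integrableOn.const_mul 2),
      integral_const_mul]
    rfl
  have e2 : ∫ x in Ω, (‖g x‖ ^ 2 + chi (u x)) =
      (∫ x in Ω, ‖g x‖ ^ 2) + ∫ x in Ω, chi (u x) := integral_add i1 i2
  have h3 := (e2.symm.le.trans hmin).trans (hle.trans e1.le)
  linarith

/-- The error made by mollifying `u` inside the cutoff. -/
noncomputable def mollError (θ : ℝ → ℝ) (Ω : Set (Space d)) (u W η : Space d → ℝ)
    (g : Space d → Space d) (s : ℝ) (x : Space d) : Space d :=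
  η x • (∇ (moll θ s (extend Ω u W)) x - g x)
    + (moll θ s (extend Ω u W) x - u x) • ∇ η x

lemma norm_add_sq_le_of_pos {F : Type*} [NormedAddCommGroup F] (a b : F) {t : ℝ} (ht : 0 < t) :
    ‖a + b‖ ^ 2 ≤ (1 + t) * ‖a‖ ^ 2 + (1 + t⁻¹) * ‖b‖ ^ 2 := by
  have h1 := norm_add_le a b
  have h2 : 2 * ‖a‖ * ‖b‖ ≤ t * ‖a‖ ^ 2 + t⁻¹ * ‖b‖ ^ 2 := by
    have h3 : 0 ≤ t⁻¹ * (t * ‖a‖ - ‖b‖) ^ 2 := by positivity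
    have h4 : t⁻¹ * (t * ‖a‖ - ‖b‖) ^ 2 = t * ‖a‖ ^ 2 - 2 * ‖a‖ * ‖b‖ + t⁻¹ * ‖b‖ ^ 2 := by
      field_simp
      ring
    linarith
  nlinarith [norm_nonneg (a + b), norm_nonneg a, norm_nonneg b]

/-- On the support of `η` the gradient of the mollification is the mollification of the weak
gradient, which converges in $L^2$. The zeroth-order term converges almost everywhere and its square
is bounded by 4. -/
lemma tendsto_integral_mollError (P : IsObstacleMinimizer Ω G V W u) (hv : IsVariation G φ η)
    (hθ : IsProfile θ) (hm : mass d θ = 1) {g : Space d → Space d}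
    (hg : HasL2Gradient Ω u g) {δ : ℝ} (hδ : 0 < δ)
    (hball : ∀ x ∈ tsupport η, Metric.closedBall x δ ⊆ G) :
    Tendsto (fun s => ∫ x in Ω, ‖mollError θ Ω u W η g s x‖ ^ 2) (𝓝[>] 0) (𝓝 0) := by
  have hΩm := P.isOpen.measurableSet
  have hgi : MemLp (Ω.indicator g) 2 := (memLp_indicator_iff_restrict hΩm).2 hg.memLp_grad
  have hgl : LocallyIntegrable (Ω.indicator g) := hgi.locallyIntegrable (by norm_num)
  obtain ⟨M, hM⟩ := (continuous_gradient hv.cut_smooth).bounded_above_of_compact_support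
    (hasCompactSupport_gradient hv.cut_compact)
  have hM0 : 0 ≤ M := (norm_nonneg _).trans (hM 0)
  have t1 := tendsto_integral_norm_moll_sub_sq hθ hm hgi
  have hKm := (isClosed_tsupport η).measurableSet
  have hbd : ∀ s, 0 < s → ∀ x, |moll θ s (extend Ω u W) x| ≤ 1 := fun s hs x => by
    have := norm_moll_sub_le hθ hs P.locallyIntegrable_extend (x := x) (z := 0) (C := 1) (by
      filter_upwards [P.ae_abs_le] with y hy _ using by simpa using hy)
    simpa [hm] using this
  have i0 : ∀ s, 0 < s → Integrable ((tsupport η).indicator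
      fun x => (moll θ s (extend Ω u W) x - extend Ω u W x) ^ 2) := by
    intro s hs
    rw [integrable_indicator_iff hKm]
    refine (integrableOn_const (C := (4 : ℝ)) hv.cut_compact.measure_lt_top.ne).mono' ?_ ?_
    · exact (((contDiff_moll_extend P hθ hs).continuous.aestronglyMeasurable.sub
        P.aestronglyMeasurable_extend).pow 2).restrict
    · refine ae_restrict_of_ae ?_
      filter_upwards [P.ae_abs_le] with x hx
      rw [Real.norm_of_nonneg (sq_nonneg _)]
      have h1 := abs_le.1 hx
      have h2 := abs_le.1 (hbd s hs x)
      nlinarith [h1.1, h1.2, h2.1, h2.2]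
  have t2 : Tendsto (fun s => ∫ x, (tsupport η).indicator
      (fun x => (moll θ s (extend Ω u W) x - extend Ω u W x) ^ 2) x) (𝓝[>] 0) (𝓝 0) := by
    rw [show 𝓝 (0 : ℝ) = 𝓝 (∫ _ : Space d, (0 : ℝ)) by simp]
    refine tendsto_integral_filter_of_dominated_convergence
      ((tsupport η).indicator fun _ => 4) ?_ ?_ ?_ ?_
    · filter_upwards [self_mem_nhdsWithin] with s hs using (i0 s hs).aestronglyMeasurable
    · filter_upwards [self_mem_nhdsWithin] with s hs
      filter_upwards [P.ae_abs_le] with x hx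
      by_cases hxK : x ∈ tsupport η
      · rw [indicator_of_mem hxK, indicator_of_mem hxK, Real.norm_of_nonneg (sq_nonneg _)]
        have h1 := abs_le.1 hx
        have h2 := abs_le.1 (hbd s hs x)
        nlinarith [h1.1, h1.2, h2.1, h2.2]
      · rw [indicator_of_notMem hxK, indicator_of_notMem hxK, norm_zero]
    · rw [integrable_indicator_iff hKm]
      exact integrableOn_const hv.cut_compact.measure_lt_top.ne
    · filter_upwards [ae_tendsto_moll hθ hm P.locallyIntegrable_extend] with x hx
      by_cases hxK : x ∈ tsupport η
      · simp only [indicator_of_mem hxK]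
        simpa using (hx.sub_const (extend Ω u W x)).pow 2
      · simp only [indicator_of_notMem hxK]
        exact tendsto_const_nhds
  have t3 : Tendsto (fun s => 2 * (∫ x, ‖moll θ s (Ω.indicator g) x - Ω.indicator g x‖ ^ 2)
      + 2 * M ^ 2 * ∫ x, (tsupport η).indicator
      (fun x => (moll θ s (extend Ω u W) x - extend Ω u W x) ^ 2) x) (𝓝[>] 0) (𝓝 0) := by
    simpa using (t1.const_mul 2).add (t2.const_mul (2 * M ^ 2))
  refine squeeze_zero' (Eventually.of_forall fun _ => integral_nonneg fun _ => sq_nonneg _) ?_ t3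
  filter_upwards [Ioo_mem_nhdsGT hδ] with s hs
  have iA : Integrable fun x => ‖moll θ s (Ω.indicator g) x - Ω.indicator g x‖ ^ 2 := by
    have h1 := integral_norm_moll_sq_le hθ hm hs.1 hgi
    have h2 : MemLp (moll θ s (Ω.indicator g)) 2 := by
      rw [memLp_two_iff_integrable_sq_norm (contDiff_moll hθ hs.1
        hgl).continuous.aestronglyMeasurable]
      exact h1.1
    exact (h2.sub hgi).integrable_norm_pow (by norm_num)
  rw [← integral_const_mul, ← integral_const_mul, ← integral_add (iA.const_mul 2)
    ((i0 s hs.1).const_mul _), ← integral_indicator hΩm]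
  refine integral_mono_of_nonneg (Eventually.of_forall fun x =>
    indicator_nonneg (fun _ _ => sq_nonneg _) x) ((iA.const_mul 2).add ((i0 s hs.1).const_mul _))
    (Eventually.of_forall fun x => ?_)
  by_cases hx : x ∈ Ω
  · simp only [indicator_of_mem hx]
    by_cases hxK : x ∈ tsupport η
    · rw [indicator_of_mem hxK, mollError, gradient_moll hθ hΩm hg.weak P.locallyIntegrable_extend
        (fun x hx => extend_of_mem hx) hgl hs.1 (((Metric.closedBall_subset_closedBall
          hs.2.le).trans (hball x hxK)).trans P.subset), extend_of_mem hx]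
      refine (norm_add_sq_le_of_pos _ _ one_pos).trans ?_
      rw [norm_smul, norm_smul, mul_pow, mul_pow, Real.norm_eq_abs, Real.norm_eq_abs, sq_abs,
        sq_abs, inv_one]
      have h1 : η x ^ 2 ≤ 1 := by
        have := hv.cut_nonneg x
        have := hv.cut_le_one x
        nlinarith
      have h2 : ‖∇ η x‖ ^ 2 ≤ M ^ 2 := by
        have := hM x
        gcongr
      have h3 := mul_le_mul_of_nonneg_right h1 (sq_nonneg ‖moll θ s (Ω.indicator g) x - g x‖)
      have h4 := mul_le_mul_of_nonneg_left h2 (sq_nonneg (moll θ s (extend Ω u W) x - u x))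
      linarith
    · have h1 : η x = 0 := image_eq_zero_of_notMem_tsupport hxK
      have h2 : ∇ η x = 0 :=
        image_eq_zero_of_notMem_tsupport fun h => hxK (tsupport_gradient_subset η h)
      rw [mollError, h1, h2, indicator_of_notMem hxK]
      simp only [zero_smul, smul_zero, add_zero, norm_zero, ne_eq, OfNat.ofNat_ne_zero,
        not_false_eq_true, zero_pow]
      positivity
  · simp only [indicator_of_notMem hx]
    have : 0 ≤ (tsupport η).indicator
      (fun x => (moll θ s (extend Ω u W) x - extend Ω u W x) ^ 2) x :=
      indicator_nonneg (fun _ _ => sq_nonneg _) x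
    positivity

/-- The variational inequality satisfied by a minimizer. -/
theorem IsObstacleMinimizer.two_mul_integral_le (P : IsObstacleMinimizer Ω G V W u)
    (hv : IsVariation G φ η) :
    2 * ∫ x in Ω, u x * Δ φ x ≤ (∫ x, ‖∇ φ x‖ ^ 2) + slack Ω u η := by
  obtain ⟨g, hg⟩ := P.minimizer.1.1.exists_hasL2Gradient
  obtain ⟨θ, hθ, hm⟩ := exists_normalized_profile d
  obtain ⟨δ, hδ, hδG⟩ :=
    IsCompact.exists_cthickening_subset_open hv.cut_compact P.isOpen_sub hv.cut_tsupport
  have hball : ∀ x ∈ tsupport η, Metric.closedBall x δ ⊆ G := fun x hx =>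
    (Metric.closedBall_subset_cthickening hx δ).trans hδG
  have hφΩ : tsupport φ ⊆ Ω := hv.tsupport_subset.trans (hv.cut_tsupport.trans P.subset)
  have hφL : MemLp (∇ φ) 2 (volume.restrict Ω) :=
    (hasL2Gradient_of_contDiff hv.smooth hv.hasCompactSupport).memLp_grad
  have hAL : MemLp (fun x => g x + ∇ φ x) 2 (volume.restrict Ω) := hg.memLp_grad.add hφL
  have iA : IntegrableOn (fun x => ‖g x + ∇ φ x‖ ^ 2) Ω := hAL.integrable_norm_pow (by norm_num)
  -- Young's inequality with parameter `t` separates `g + ∇ φ` from the mollification error. The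
  -- scale tends to zero with `t` fixed, and `t` tends to zero afterwards.
  have key1 : ∀ t : ℝ, 0 < t → ∫ x in Ω, ‖g x‖ ^ 2 ≤
      (1 + t) * (∫ x in Ω, ‖g x + ∇ φ x‖ ^ 2) + slack Ω u η := by
    intro t ht
    have tE := tendsto_integral_mollError P hv hθ hm hg hδ hball
    have tR := ((tE.const_mul (1 + t⁻¹)).const_add
      ((1 + t) * ∫ x in Ω, ‖g x + ∇ φ x‖ ^ 2)).add_const (slack Ω u η)
    rw [mul_zero, add_zero] at tR
    refine ge_of_tendsto tR ?_
    filter_upwards [Ioo_mem_nhdsGT hδ] with s hs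
    obtain ⟨hH, hle⟩ := integral_norm_sq_le_shiftGrad P hv hθ hm hs.1 hg fun x hx =>
      (Metric.closedBall_subset_closedBall hs.2.le).trans (hball x hx)
    refine hle.trans (add_le_add_left ?_ _)
    have hEL : MemLp (mollError θ Ω u W η g s) 2 (volume.restrict Ω) := by
      refine (hH.sub hAL).ae_eq (Eventually.of_forall fun x => ?_)
      simp only [Pi.sub_apply]
      rw [shiftGrad_eq P hv hθ hs.1, mollError]
      abel
    have iE : IntegrableOn (fun x => ‖mollError θ Ω u W η g s x‖ ^ 2) Ω :=
      hEL.integrable_norm_pow (by norm_num)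
    rw [← integral_const_mul, ← integral_const_mul,
      ← integral_add (iA.const_mul _) (iE.const_mul _)]
    refine integral_mono (hH.integrable_norm_pow (by norm_num))
      ((iA.const_mul _).add (iE.const_mul _)) fun x => ?_
    simp only
    rw [shiftGrad_eq P hv hθ hs.1]
    exact norm_add_sq_le_of_pos _ _ ht
  have key2 : ∫ x in Ω, ‖g x‖ ^ 2 ≤ (∫ x in Ω, ‖g x + ∇ φ x‖ ^ 2) + slack Ω u η := by
    have hlim : Tendsto (fun t : ℝ => (1 + t) * (∫ x in Ω, ‖g x + ∇ φ x‖ ^ 2) + slack Ω u η)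
        (𝓝[>] 0) (𝓝 ((∫ x in Ω, ‖g x + ∇ φ x‖ ^ 2) + slack Ω u η)) := by
      have : Continuous fun t : ℝ =>
        (1 + t) * (∫ x in Ω, ‖g x + ∇ φ x‖ ^ 2) + slack Ω u η := by fun_prop
      simpa using (this.tendsto 0).mono_left nhdsWithin_le_nhds
    refine ge_of_tendsto hlim ?_
    filter_upwards [self_mem_nhdsWithin] with t ht using key1 t ht
  have i1 : IntegrableOn (fun x => ‖g x‖ ^ 2) Ω := hg.memLp_grad.integrable_norm_pow (by norm_num)
  have i2 : IntegrableOn (fun x => ‖∇ φ x‖ ^ 2) Ω := hφL.integrable_norm_pow (by norm_num)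
  have i3 : IntegrableOn (fun x => inner ℝ (g x) (∇ φ x)) Ω := by
    have i4 : IntegrableOn (fun x => ‖g x + ∇ φ x‖ ^ 2 - ‖g x‖ ^ 2 - ‖∇ φ x‖ ^ 2) Ω :=
      (iA.sub i1).sub i2
    refine (i4.div_const 2).congr (Eventually.of_forall fun x => ?_)
    simp only [norm_add_sq_real]
    ring
  have e1 : ∫ x in Ω, ‖g x + ∇ φ x‖ ^ 2 = (∫ x in Ω, ‖g x‖ ^ 2)
      + 2 * (∫ x in Ω, inner ℝ (g x) (∇ φ x)) + ∫ x in Ω, ‖∇ φ x‖ ^ 2 := by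
    simp_rw [norm_add_sq_real]
    have i5 : IntegrableOn (fun x => ‖g x‖ ^ 2 + 2 * inner ℝ (g x) (∇ φ x)) Ω :=
      i1.add (i3.const_mul 2)
    rw [integral_add i5 i2, integral_add i1 (i3.const_mul 2), integral_const_mul]
  have e2 : ∫ x in Ω, ‖∇ φ x‖ ^ 2 = ∫ x, ‖∇ φ x‖ ^ 2 :=
    setIntegral_eq_integral_of_forall_compl_eq_zero fun x hx => by
      have : ∇ φ x = 0 := image_eq_zero_of_notMem_tsupport fun h =>
        hx (hφΩ (tsupport_gradient_subset φ h))
      simp [this]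
  -- Expanding the square cancels `‖g‖ ^ 2`, and the cross term becomes $-2\int u\,\Delta\varphi$.
  rw [e1, e2, integral_inner_weakGradient hg.weak hv.smooth hv.hasCompactSupport hφΩ] at key2
  linarith

end

section

variable {d : ℕ} {Ω G : Set (Space d)} {V W u φ η : Space d → ℝ} {θ : ℝ → ℝ}

/-! ### Consequences of the variational inequality -/

lemma setIntegral_mul_laplacian_eq (hΩ : IsOpen Ω) (hφ : tsupport φ ⊆ Ω) :
    ∫ x in Ω, u x * Δ φ x = ∫ x, extend Ω u W x * Δ φ x := by
  rw [← setIntegral_eq_of_tsupport (Ω := Ω) ((tsupport_laplacian_subset φ).trans hφ)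
    (by intro x hx; simp [hx])]
  exact setIntegral_congr_fun hΩ.measurableSet fun x hx => by simp only [extend_of_mem hx]

lemma slack_le (hη : HasCompactSupport η) : slack Ω u η ≤ volume.real (tsupport η) := by
  have hK := (isClosed_tsupport η).measurableSet
  have hi : Integrable ((tsupport η).indicator fun _ => (1 : ℝ)) := by
    rw [integrable_indicator_iff hK]
    exact integrableOn_const hη.measure_lt_top.ne
  have h1 : slack Ω u η ≤ ∫ x in Ω, (tsupport η).indicator (fun _ => (1 : ℝ)) x := by
    refine integral_mono_of_nonneg (Eventually.of_forall fun x => ?_) hi.integrableOn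
      (Eventually.of_forall fun x => ?_)
    · exact indicator_nonneg (fun x _ => by linarith [chi_le_one (u x)]) x
    · exact indicator_le_indicator (by linarith [chi_nonneg (u x)])
  refine h1.trans ((setIntegral_le_integral hi
    (Eventually.of_forall fun x => indicator_nonneg (fun _ _ => zero_le_one) x)).trans ?_)
  rw [integral_indicator hK, setIntegral_const, smul_eq_mul, mul_one]

/-- The gradient is $-\theta(|y-p|^2/s^2)\,(y-p)/s$, so its size is bounded independently of the
scale. -/
lemma norm_gradient_tbump_le (hθ : IsProfile θ) {C : ℝ} (hC0 : 0 ≤ C)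
    (hC : ∀ t, 0 ≤ t → θ t ≤ C) (p : Space d) {s : ℝ} (hs : 0 < s) (y : Space d) :
    ‖∇ (tbump θ p s) y‖ ≤ (Metric.closedBall p s).indicator (fun _ => C) y := by
  by_cases hy : y ∈ Metric.closedBall p s
  · rw [indicator_of_mem hy]
    have h1 : DifferentiableAt ℝ (fun y : Space d => ‖y - p‖ ^ 2) y :=
      ((contDiff_id.sub contDiff_const).norm_sq ℝ (n := 1)).differentiable (by norm_num) y
    have h2 : HasDerivAt (fun q : ℝ => s / 2 * prim θ (q / s ^ 2))
        (-(1 / (2 * s)) * θ (‖y - p‖ ^ 2 / s ^ 2)) (‖y - p‖ ^ 2) := by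
      have := ((hasDerivAt_prim hθ (‖y - p‖ ^ 2 / s ^ 2)).comp (‖y - p‖ ^ 2)
        ((hasDerivAt_id (‖y - p‖ ^ 2)).div_const (s ^ 2))).const_mul (s / 2)
      refine this.congr_deriv ?_
      field_simp
    have h3 : ∇ (fun y : Space d => ‖y - p‖ ^ 2) y = (2 : ℝ) • (y - p) := by
      refine ext_inner_stdVec fun e => ?_
      have hq : HasFDerivAt (fun y => ‖y - p‖ ^ 2) (2 • innerSL ℝ (y - p)) y := by
        simpa using ((hasFDerivAt_id y).sub_const p).norm_sq
      rw [inner_gradient_left, hq.fderiv, inner_smul_left]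
      simp [inner_sub_left]
    have h4 := gradient_fun_comp (F := fun q : ℝ => s / 2 * prim θ (q / s ^ 2)) h1
      h2.differentiableAt
    rw [show tbump θ p s = fun y => (fun q : ℝ => s / 2 * prim θ (q / s ^ 2)) (‖y - p‖ ^ 2) from rfl,
      h4, h2.deriv, h3, norm_smul, norm_smul]
    have h5 : ‖y - p‖ ≤ s := by rwa [Metric.mem_closedBall, dist_eq_norm] at hy
    have h6 := hC (‖y - p‖ ^ 2 / s ^ 2) (by positivity)
    have h7 := hθ.nonneg (‖y - p‖ ^ 2 / s ^ 2)
    rw [norm_mul, norm_neg, Real.norm_of_nonneg (by positivity : 0 ≤ 1 / (2 * s)),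
      Real.norm_of_nonneg h7, Real.norm_of_nonneg (by norm_num : (0 : ℝ) ≤ 2)]
    calc 1 / (2 * s) * θ (‖y - p‖ ^ 2 / s ^ 2) * (2 * ‖y - p‖) ≤ 1 / (2 * s) * C * (2 * s) := by
          gcongr
      _ = C := by field_simp
  · rw [indicator_of_notMem hy]
    have : ∇ (tbump θ p s) y = 0 := image_eq_zero_of_notMem_tsupport fun h =>
      hy (tsupport_tbump_subset hθ p hs (tsupport_gradient_subset _ h))
    rw [this, norm_zero]

/-- The constant in the estimate for the dilations of mollifications of minimizers. -/
noncomputable def bumpConst (d : ℕ) (C : ℝ) : ℝ :=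
  (C ^ 2 + 2 ^ (d + 1)) * volume.real (Metric.ball (0 : Space d) 1) / 2

lemma exists_isVariation_tbump (hθ : IsProfile θ) {p : Space d} {s : ℝ} (hs : 0 < s)
    (hp : Metric.closedBall p (2 * s) ⊆ G) :
    ∃ η, IsVariation G (tbump θ p s) η ∧ tsupport η = Metric.closedBall p (2 * s) := by
  -- The outer radius `2 * s` of the cutoff is the source of the doubled balls below and of `2 ^ (d
  -- + 1)` in `bumpConst`.
  let f : ContDiffBump p := ⟨s, 2 * s, hs, by linarith⟩
  refine ⟨f, ⟨contDiff_tbump hθ p s, tbump_nonneg hθ p hs, f.contDiff, f.hasCompactSupport,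
    f.tsupport_eq.subset.trans hp, fun x => f.nonneg, fun x => f.le_one, fun x hx => ?_⟩,
    f.tsupport_eq⟩
  refine f.one_of_mem_closedBall (Metric.ball_subset_closedBall ?_)
  by_contra h
  exact hx (tbump_eq_zero hθ hs h)

namespace IsObstacleMinimizer

/-- In the variational inequality both the Dirichlet integral of the bump and the measure term scale
like `s ^ (d + 1)`, exactly the factor by which the kernel derivative is normalized. -/
lemma integral_tbump_le (P : IsObstacleMinimizer Ω G V W u) (hθ : IsProfile θ) {C : ℝ}
    (hC0 : 0 ≤ C) (hC : ∀ t, 0 ≤ t → θ t ≤ C) {p : Space d} {s : ℝ} (hs : 0 < s)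
    (hp : Metric.closedBall p (2 * s) ⊆ G) :
    ∫ x in Ω, u x * Δ (tbump θ p s) x ≤ bumpConst d C * s ^ (d + 1) := by
  obtain ⟨η, hv, hη⟩ := exists_isVariation_tbump hθ hs hp
  have h1 := P.two_mul_integral_le hv
  have h2 := slack_le (Ω := Ω) (u := u) hv.cut_compact
  rw [hη, volume_real_closedBall p (by positivity)] at h2
  have h3 : ∫ x, ‖∇ (tbump θ p s) x‖ ^ 2 ≤ ∫ x, (Metric.closedBall p s).indicator
      (fun _ => C ^ 2) x := by
    refine integral_mono_of_nonneg (Eventually.of_forall fun _ => sq_nonneg _) ?_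
      (Eventually.of_forall fun x => ?_)
    · rw [integrable_indicator_iff Metric.isClosed_closedBall.measurableSet]
      exact integrableOn_const (isCompact_closedBall p s).measure_lt_top.ne
    · have := norm_gradient_tbump_le hθ hC0 hC p hs x
      by_cases hx : x ∈ Metric.closedBall p s
      · simp only [indicator_of_mem hx] at this ⊢
        gcongr
      · simp only [indicator_of_notMem hx] at this ⊢
        rw [le_antisymm this (norm_nonneg _)]
        norm_num
  rw [integral_indicator Metric.isClosed_closedBall.measurableSet, setIntegral_const, smul_eq_mul,
    volume_real_closedBall p hs.le] at h3
  rw [bumpConst]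
  have h4 : (2 * s) ^ (d + 1) = 2 ^ (d + 1) * s ^ (d + 1) := mul_pow _ _ _
  rw [h4] at h2
  linarith

lemma abs_integral_tbump_le (P : IsObstacleMinimizer Ω G V W u) (hθ : IsProfile θ) {C : ℝ}
    (hC0 : 0 ≤ C) (hC : ∀ t, 0 ≤ t → θ t ≤ C) {p : Space d} {s : ℝ} (hs : 0 < s)
    (hp : Metric.closedBall p (2 * s) ⊆ G) :
    |∫ x in Ω, u x * Δ (tbump θ p s) x| ≤ bumpConst d C * s ^ (d + 1) := by
  have h1 := P.integral_tbump_le hθ hC0 hC hs hp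
  have h2 := P.neg.integral_tbump_le hθ hC0 hC hs hp
  simp_rw [neg_mul, integral_neg] at h2
  exact abs_le.2 ⟨by linarith, h1⟩

/-- Mollifications of a minimizer are Lipschitz in the scale. -/
lemma abs_moll_sub_le (P : IsObstacleMinimizer Ω G V W u) (hθ : IsProfile θ) {C : ℝ}
    (hC0 : 0 ≤ C) (hC : ∀ t, 0 ≤ t → θ t ≤ C) {p : Space d} {r : ℝ}
    (hp : Metric.closedBall p (2 * r) ⊆ G) {s t : ℝ} (hs : s ∈ Ioc 0 r) (ht : t ∈ Ioc 0 r) :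
    |moll θ s (extend Ω u W) p - moll θ t (extend Ω u W) p| ≤ bumpConst d C * |s - t| := by
  refine (convex_Ioc 0 r).norm_image_sub_le_of_norm_hasDerivWithin_le
    (f := fun s => moll θ s (extend Ω u W) p)
    (fun τ hτ => (hasDerivAt_moll hθ P.locallyIntegrable_extend p hτ.1).hasDerivWithinAt)
    (fun τ hτ => ?_) ht hs
  have hτ0 := hτ.1
  have hb : Metric.closedBall p (2 * τ) ⊆ G :=
    (Metric.closedBall_subset_closedBall (by linarith [hτ.2])).trans hp
  have h := P.abs_integral_tbump_le hθ hC0 hC hτ.1 hb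
  rw [setIntegral_mul_laplacian_eq (W := W) P.isOpen ((tsupport_tbump_subset hθ p hτ.1).trans
    ((Metric.closedBall_subset_closedBall (by linarith)).trans (hb.trans P.subset)))] at h
  rw [norm_mul, Real.norm_of_nonneg (by positivity), inv_mul_le_iff₀ (by positivity), mul_comm]
  exact h

end IsObstacleMinimizer

lemma exists_isVariation (hG : IsOpen G) (hφ : ContDiff ℝ ∞ φ) (hc : HasCompactSupport φ)
    (hs : tsupport φ ⊆ G) (h0 : ∀ x, 0 ≤ φ x) : ∃ η, IsVariation G φ η := by
  obtain ⟨K, hK, h1, h2⟩ := exists_compact_between hc hG hs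
  obtain ⟨f, hf1, hf0, hf⟩ := exists_contMDiffMap_one_nhds_of_subset_interior (n := ⊤)
    (modelWithCornersSelf ℝ (Space d)) (isClosed_tsupport φ) h1
  have hsub : tsupport f ⊆ K :=
    closure_minimal (fun x hx => by_contra fun h => hx (hf0 x h)) hK.isClosed
  exact ⟨f, hφ, h0, f.contMDiff.contDiff, hK.of_isClosed_subset (isClosed_tsupport f) hsub,
    hsub.trans h2, fun x => (hf x).1, fun x => (hf x).2,
    fun x hx => hf1.self_of_nhdsSet x (subset_tsupport φ hx)⟩

/-- A minimizer is superharmonic in the sense of distributions where its values lie in `(-1, 1)`. -/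
lemma IsObstacleMinimizer.integral_nonpos (P : IsObstacleMinimizer Ω G V W u)
    {A : Set (Space d)} (hA : IsOpen A) (hAG : A ⊆ G) (hu : ∀ᵐ x, x ∈ A → |u x| < 1)
    (hφ : ContDiff ℝ ∞ φ) (hc : HasCompactSupport φ)
    (hs : tsupport φ ⊆ A) (h0 : ∀ x, 0 ≤ φ x) : ∫ x in Ω, u x * Δ φ x ≤ 0 := by
  obtain ⟨η, hv⟩ := exists_isVariation hA hφ hc hs h0
  have hsl : slack Ω u η = 0 := by
    rw [slack, integral_eq_zero_of_ae]
    refine ae_restrict_of_ae ?_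
    filter_upwards [hu] with x hx
    by_cases hxK : x ∈ tsupport η
    · have h1 : u x ∈ Ioo (-1 : ℝ) 1 := abs_lt.1 (hx (hv.cut_tsupport hxK))
      rw [indicator_of_mem hxK, chi, indicator_of_mem h1]
      simp
    · rw [indicator_of_notMem hxK]
      rfl
  have hΔ : ∀ t : ℝ, Δ (fun x => t * φ x) = fun x => t * Δ φ x := fun t => by
    ext x
    exact InnerProductSpace.laplacian_smul t (hφ.contDiffAt.of_le (by norm_cast))
  have hg : ∀ t : ℝ, ∀ x, ∇ (fun x => t * φ x) x = t • ∇ φ x := fun t x => by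
    refine ext_inner_stdVec fun e => ?_
    rw [inner_gradient_left, inner_smul_left, inner_gradient_left,
      fderiv_const_mul (hφ.differentiable (by simp) x)]
    simp
  -- With no measure term, the left side is linear in `t * φ` and the right side quadratic, so
  -- dividing by `t` leaves a bound that vanishes with `t`.
  have key : ∀ t : ℝ, 0 < t → 2 * ∫ x in Ω, u x * Δ φ x ≤ t * ∫ x, ‖∇ φ x‖ ^ 2 := by
    intro t ht
    have hvt : IsVariation G (fun x => t * φ x) η :=
      ⟨contDiff_const.mul hφ, fun x => mul_nonneg ht.le (h0 x), hv.cut_smooth, hv.cut_compact,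
        hv.cut_tsupport.trans hAG, hv.cut_nonneg, hv.cut_le_one,
        fun x hx => hv.cut_eq_one x (right_ne_zero_of_mul hx)⟩
    have h1 := P.two_mul_integral_le hvt
    rw [hsl, hΔ] at h1
    simp_rw [hg, norm_smul, mul_pow, Real.norm_eq_abs, sq_abs, mul_left_comm (u _) t] at h1
    rw [integral_const_mul, integral_const_mul, add_zero] at h1
    refine le_of_mul_le_mul_left ?_ ht
    linarith
  have hlim : Tendsto (fun t : ℝ => t * ∫ x, ‖∇ φ x‖ ^ 2) (𝓝[>] 0) (𝓝 0) := by
    have : Continuous fun t : ℝ => t * ∫ x, ‖∇ φ x‖ ^ 2 := by fun_prop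
    simpa using (this.tendsto 0).mono_left nhdsWithin_le_nhds
  have := ge_of_tendsto hlim (by filter_upwards [self_mem_nhdsWithin] with t ht using key t ht)
  linarith

end

section

variable {d : ℕ} {Ω G : Set (Space d)} {V W u φ η : Space d → ℝ} {θ : ℝ → ℝ}

/-! ### The continuous representative -/

open Classical in
/-- The precise representative of a minimizer: the limit of mollifications in `G`, and the common
value of the obstacles elsewhere. -/
noncomputable def precise (θ : ℝ → ℝ) (Ω G : Set (Space d)) (V W u : Space d → ℝ) (x : Space d) :
    ℝ :=
  if x ∈ G then limUnder (𝓝[>] (0 : ℝ)) fun s => moll θ s (extend Ω u W) x else V x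

lemma bumpConst_nonneg (d : ℕ) (C : ℝ) : 0 ≤ bumpConst d C := by
  rw [bumpConst]
  positivity

lemma exists_closedBall_subset (hG : IsOpen G) {x : Space d} (hx : x ∈ G) :
    ∃ r, 0 < r ∧ Metric.closedBall x (2 * r) ⊆ G := by
  obtain ⟨ε, hε, h⟩ := Metric.nhds_basis_closedBall.mem_iff.1 (hG.mem_nhds hx)
  exact ⟨ε / 2, by positivity, by rwa [mul_div_cancel₀ _ two_ne_zero]⟩

/-- Mollifications of a bounded function are Lipschitz, with constant inverse to the scale. -/
lemma exists_abs_moll_sub_le (hθ : IsProfile θ) :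
    ∃ L, 0 ≤ L ∧ ∀ f : Space d → ℝ, LocallyIntegrable f → (∀ᵐ x, |f x| ≤ 1) → ∀ s, 0 < s →
      ∀ x y : Space d, ‖x - y‖ ≤ s → |moll θ s f x - moll θ s f y| ≤ L * (‖x - y‖ / s) := by
  obtain ⟨L, hL0, hL⟩ := exists_kern_lipschitz d hθ
  refine ⟨L * (2 ^ (d + 1) * volume.real (Metric.ball (0 : Space d) 1)), by positivity,
    fun f hf hf1 s hs x y hxy => ?_⟩
  have i1 := integrable_kern_smul hθ hs hf x
  have i2 := integrable_kern_smul hθ hs hf y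
  rw [moll_apply, moll_apply, ← integral_sub i1 i2]
  -- Since `‖x - y‖ ≤ s`, this ball contains the supports of both kernels; its volume cancels the
  -- normalization `(s ^ (d + 1))⁻¹`.
  set B := Metric.closedBall x (2 * s) with hB
  have hBm : MeasurableSet B := Metric.isClosed_closedBall.measurableSet
  have hi : Integrable (B.indicator fun _ => (s ^ (d + 1))⁻¹ * (L * (‖x - y‖ / s))) := by
    rw [integrable_indicator_iff hBm]
    exact integrableOn_const (isCompact_closedBall x (2 * s)).measure_lt_top.ne
  have h := norm_integral_le_of_norm_le hi (f := fun z => kern θ s (x - z) • f z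
    - kern θ s (y - z) • f z) (by
      filter_upwards [hf1] with z hz
      rw [← sub_smul, norm_smul]
      by_cases hzB : z ∈ B
      · rw [indicator_of_mem hzB]
        have h1 := hL s hs (x - z) (y - z)
        rw [sub_sub_sub_cancel_right] at h1
        calc _ ≤ |kern θ s (x - z) - kern θ s (y - z)| * 1 :=
              mul_le_mul_of_nonneg_left hz (abs_nonneg _)
          _ ≤ _ := by rwa [mul_one]
      · rw [indicator_of_notMem hzB]
        have h1 : z ∉ Metric.ball x s := fun h => hzB
          (Metric.closedBall_subset_closedBall (by linarith) (Metric.ball_subset_closedBall h))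
        have h2 : z ∉ Metric.ball y s := fun h => hzB (by
          rw [hB, Metric.mem_closedBall]
          have h3 := dist_triangle z y x
          have h4 : dist z y < s := h
          rw [dist_comm y x, dist_eq_norm x y] at h3
          linarith)
        rw [kern_sub_eq_zero hθ hs h1, kern_sub_eq_zero hθ hs h2]
        simp)
  refine h.trans (le_of_eq ?_)
  rw [integral_indicator hBm, setIntegral_const, smul_eq_mul, hB,
    volume_real_closedBall x (by positivity), mul_pow]
  field_simp

namespace IsObstacleMinimizer

/-- The scale estimate makes the mollifications Cauchy at every point of `G`, not merely at almost
every one. -/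
lemma tendsto_precise (P : IsObstacleMinimizer Ω G V W u) (hθ : IsProfile θ) {x : Space d}
    (hx : x ∈ G) :
    Tendsto (fun s => moll θ s (extend Ω u W) x) (𝓝[>] 0) (𝓝 (precise θ Ω G V W u x)) := by
  obtain ⟨C, hC0, hC⟩ := exists_profile_bound hθ
  obtain ⟨r, hr, hrG⟩ := exists_closedBall_subset P.isOpen_sub hx
  rw [precise, if_pos hx]
  refine tendsto_nhds_limUnder (cauchy_map_iff_exists_tendsto.1 ?_)
  rw [Metric.cauchy_iff]
  refine ⟨inferInstance, fun ε hε => ?_⟩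
  have hb := bumpConst_nonneg d C
  have hε' : 0 < min r (ε / (bumpConst d C + 1)) := lt_min hr (by positivity)
  refine ⟨_, image_mem_map (Ioo_mem_nhdsGT hε'), ?_⟩
  rintro _ ⟨s, hs, rfl⟩ _ ⟨t, ht, rfl⟩
  have hs2 := lt_min_iff.1 hs.2
  have ht2 := lt_min_iff.1 ht.2
  rw [Real.dist_eq]
  refine (P.abs_moll_sub_le hθ hC0 hC hrG ⟨hs.1, hs2.1.le⟩ ⟨ht.1, ht2.1.le⟩).trans_lt ?_
  have h1 : |s - t| < ε / (bumpConst d C + 1) := by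
    rw [abs_lt]
    constructor <;> linarith [hs.1, ht.1, hs2.2, ht2.2]
  rw [lt_div_iff₀ (by positivity)] at h1
  nlinarith [abs_nonneg (s - t)]

lemma abs_precise_sub_le (P : IsObstacleMinimizer Ω G V W u) (hθ : IsProfile θ) {C : ℝ}
    (hC0 : 0 ≤ C) (hC : ∀ t, 0 ≤ t → θ t ≤ C) {x : Space d} {s : ℝ} (hs : 0 < s)
    (hx : Metric.closedBall x (2 * s) ⊆ G) :
    |precise θ Ω G V W u x - moll θ s (extend Ω u W) x| ≤ bumpConst d C * s := by
  have hxG : x ∈ G := hx (Metric.mem_closedBall_self (by positivity))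
  have ht := ((P.tendsto_precise hθ hxG).sub_const (moll θ s (extend Ω u W) x)).abs
  refine le_of_tendsto ht ?_
  filter_upwards [Ioc_mem_nhdsGT hs] with t ht
  refine (P.abs_moll_sub_le hθ hC0 hC hx ht ⟨hs, le_rfl⟩).trans ?_
  refine mul_le_mul_of_nonneg_left ?_ (bumpConst_nonneg d C)
  rw [abs_le]
  constructor <;> linarith [ht.1, ht.2]

lemma precise_mem_Icc (P : IsObstacleMinimizer Ω G V W u) (hθ : IsProfile θ) (hm : mass d θ = 1)
    (x : Space d) :
    V x ≤ precise θ Ω G V W u x ∧ precise θ Ω G V W u x ≤ W x := by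
  by_cases hxG : x ∈ G
  · obtain ⟨r, hr, hrG⟩ := exists_closedBall_subset P.isOpen_sub hxG
    have ht := P.tendsto_precise hθ hxG
    have hb : ∀ s ∈ Ioo 0 r, Metric.closedBall x s ⊆ G := fun s hs =>
      (Metric.closedBall_subset_closedBall (by linarith [hs.2])).trans hrG
    constructor
    · refine ge_of_tendsto ht ?_
      filter_upwards [Ioo_mem_nhdsGT hr] with s hs
      exact lower_le_moll_extend P hθ hm hs.1 (hb s hs)
    · refine le_of_tendsto ht ?_
      filter_upwards [Ioo_mem_nhdsGT hr] with s hs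
      exact (moll_extend_le_moll_upper P hθ hs.1 x).trans (moll_upper_le P hθ hm hs.1 (hb s hs))
  · rw [precise, if_neg hxG]
    exact ⟨le_rfl, P.lower_le_upper x⟩

/-- In `G` this is convergence at Lebesgue points; off `G` the coinciding obstacles leave `u` only
one possible value. -/
lemma precise_ae_eq (P : IsObstacleMinimizer Ω G V W u) (hθ : IsProfile θ) (hm : mass d θ = 1)
    (hVW : ∀ x ∈ Ω, x ∉ G → V x = W x) :
    precise θ Ω G V W u =ᵐ[volume.restrict Ω] u := by
  rw [Filter.EventuallyEq, ae_restrict_iff' P.isOpen.measurableSet]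
  filter_upwards [ae_tendsto_moll hθ hm P.locallyIntegrable_extend, P.ae_le] with x hx hle hxΩ
  rw [extend_of_mem hxΩ] at hx hle
  by_cases hxG : x ∈ G
  · exact tendsto_nhds_unique (P.tendsto_precise hθ hxG) hx
  · rw [precise, if_neg hxG]
    exact le_antisymm hle.1 (hle.2.trans (hVW x hxΩ hxG).ge)

lemma abs_precise_le (P : IsObstacleMinimizer Ω G V W u) (hθ : IsProfile θ) (hm : mass d θ = 1)
    (x : Space d) :
    |precise θ Ω G V W u x| ≤ 1 := by
  have h := P.precise_mem_Icc hθ hm x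
  exact abs_le.2 ⟨(abs_le.1 (P.abs_lower_le x)).1.trans h.1,
    h.2.trans (abs_le.1 (P.abs_upper_le x)).2⟩

/-- Interior Hölder continuity of the precise representative. -/
lemma exists_holderOnWith_precise (P : IsObstacleMinimizer Ω G V W u) (hθ : IsProfile θ)
    (hm : mass d θ = 1) {D : Set (Space d)}
    (hD : IsCompact (closure D)) (hDG : closure D ⊆ G) :
    ∃ C : ℝ≥0, HolderOnWith C (1 / 2) (precise θ Ω G V W u) D := by
  obtain ⟨C, hC0, hC⟩ := exists_profile_bound hθ
  obtain ⟨L, hL0, hL⟩ := exists_abs_moll_sub_le (d := d) hθ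
  obtain ⟨δ, hδ, hδG⟩ := hD.exists_cthickening_subset_open P.isOpen_sub hDG
  set b := bumpConst d C with hb
  have hb0 : 0 ≤ b := bumpConst_nonneg d C
  -- `2 * r ≤ δ` keeps the doubled balls inside `G`, and `r ≤ 1` ensures $|x-y|=s^2\le s$, as the
  -- spatial estimate requires.
  set r := min 1 (δ / 2) with hr
  have hr0 : 0 < r := lt_min one_pos (by positivity)
  have hr1 : r ≤ 1 := min_le_left _ _
  have hball : ∀ x ∈ D, Metric.closedBall x (2 * r) ⊆ G := fun x hx =>
    ((Metric.closedBall_subset_closedBall (by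
      have : r ≤ δ / 2 := min_le_right _ _
      linarith)).trans
      (Metric.closedBall_subset_cthickening (subset_closure hx) δ)).trans hδG
  have hK0 : 0 ≤ 2 * b + L + 2 / r := by positivity
  -- `2 * b` pays for replacing the values at `x` and `y` by averages at scale `s`, `L` for moving
  -- the centre of the average, and `2 / r` covers distant points, where the difference is at most
  -- 2.
  refine ⟨⟨2 * b + L + 2 / r, hK0⟩, fun x hx y hy => ?_⟩
  have key : dist (precise θ Ω G V W u x) (precise θ Ω G V W u y) ≤
      (2 * b + L + 2 / r) * Real.sqrt (dist x y) := by
    rcases eq_or_ne x y with rfl | hne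
    · simp
    have hd : 0 < dist x y := dist_pos.2 hne
    set s := Real.sqrt (dist x y) with hs
    have hs0 : 0 < s := Real.sqrt_pos.2 hd
    have hss : s * s = dist x y := Real.mul_self_sqrt hd.le
    rw [Real.dist_eq]
    rcases le_total s r with hsr | hsr
    · have h1 := P.abs_precise_sub_le hθ hC0 hC hs0
        ((Metric.closedBall_subset_closedBall (by linarith)).trans (hball x hx))
      have h2 := P.abs_precise_sub_le hθ hC0 hC hs0
        ((Metric.closedBall_subset_closedBall (by linarith)).trans (hball y hy))
      have hxy : ‖x - y‖ = s * s := by rw [hss, dist_eq_norm]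
      have h3 := hL _ P.locallyIntegrable_extend P.ae_abs_le s hs0 x y (by
        rw [hxy]
        nlinarith)
      rw [hxy, mul_div_cancel_right₀ _ hs0.ne'] at h3
      have h4 : 0 ≤ 2 / r * s := by positivity
      have e : precise θ Ω G V W u x - precise θ Ω G V W u y =
        (precise θ Ω G V W u x - moll θ s (extend Ω u W) x)
        + (moll θ s (extend Ω u W) x - moll θ s (extend Ω u W) y)
        - (precise θ Ω G V W u y - moll θ s (extend Ω u W) y) := by ring
      rw [e]
      have h5 := abs_sub ((precise θ Ω G V W u x - moll θ s (extend Ω u W) x)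
        + (moll θ s (extend Ω u W) x - moll θ s (extend Ω u W) y))
        (precise θ Ω G V W u y - moll θ s (extend Ω u W) y)
      have h6 := abs_add_le (precise θ Ω G V W u x - moll θ s (extend Ω u W) x)
        (moll θ s (extend Ω u W) x - moll θ s (extend Ω u W) y)
      nlinarith
    · have hG : ∀ z ∈ D, |precise θ Ω G V W u z| ≤ 1 := fun z hz =>
        P.abs_precise_le hθ hm z
      have h1 := abs_le.1 (hG x hx)
      have h2 := abs_le.1 (hG y hy)
      have h3 : 2 ≤ 2 / r * s := by
        rw [div_mul_eq_mul_div, le_div_iff₀ hr0]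
        linarith
      have h4 : 0 ≤ (2 * b + L) * s := by positivity
      rw [abs_le]
      constructor <;> nlinarith [h1.1, h1.2, h2.1, h2.2]
  rw [edist_dist, edist_dist, show (((1 / 2 : ℝ≥0)) : ℝ) = 1 / 2 by simp,
    ENNReal.ofReal_rpow_of_nonneg dist_nonneg (by norm_num), ← Real.sqrt_eq_rpow]
  refine (ENNReal.ofReal_le_ofReal key).trans (le_of_eq ?_)
  rw [ENNReal.ofReal_mul hK0]
  congr 1
  exact ENNReal.ofReal_eq_coe_nnreal hK0

/-- Inside `G` this is the Hölder estimate; at other points of `Ω` the function is squeezed between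
continuous obstacles that touch. -/
lemma continuousOn_precise (P : IsObstacleMinimizer Ω G V W u) (hθ : IsProfile θ)
    (hm : mass d θ = 1) (hVW : ∀ x ∈ Ω, x ∉ G → V x = W x) :
    ContinuousOn (precise θ Ω G V W u) Ω := by
  intro x hx
  by_cases hxG : x ∈ G
  · obtain ⟨r, hr, hrG⟩ := exists_closedBall_subset P.isOpen_sub hxG
    have hcl : closure (Metric.closedBall x (2 * r)) = Metric.closedBall x (2 * r) :=
      Metric.isClosed_closedBall.closure_eq
    obtain ⟨C, hC⟩ := P.exists_holderOnWith_precise hθ hm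
      (D := Metric.closedBall x (2 * r)) (by rw [hcl]; exact isCompact_closedBall _ _)
      (by rwa [hcl])
    exact ((hC.continuousOn (by norm_num)).continuousAt
      (Metric.closedBall_mem_nhds x (by positivity))).continuousWithinAt
  · have hW := hVW x hx hxG
    have hp : precise θ Ω G V W u x = V x := by rw [precise, if_neg hxG]
    rw [ContinuousWithinAt, hp]
    refine tendsto_of_tendsto_of_tendsto_of_le_of_le'
      (P.continuous_lower.continuousWithinAt (s := Ω) (x := x)) (h := W) ?_ ?_ ?_
    · rw [hW]
      exact P.continuous_upper.continuousWithinAt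
    · filter_upwards [self_mem_nhdsWithin] with y hy using (P.precise_mem_Icc hθ hm y).1
    · filter_upwards [self_mem_nhdsWithin] with y hy using (P.precise_mem_Icc hθ hm y).2

/-- The precise representative is harmonic where its values lie in `(-1, 1)`. -/
lemma harmonicOnNhd_precise (P : IsObstacleMinimizer Ω G V W u) (hθ : IsProfile θ)
    (hm : mass d θ = 1) (hVW : ∀ x ∈ Ω, x ∉ G → V x = W x)
    (hG1 : ∀ x ∈ Ω, x ∉ G → |V x| = 1) :
    InnerProductSpace.HarmonicOnNhd (precise θ Ω G V W u)
      {x | x ∈ Ω ∧ |precise θ Ω G V W u x| < 1} := by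
  set A := {x | x ∈ Ω ∧ |precise θ Ω G V W u x| < 1} with hAdef
  have hA : IsOpen A :=
    (P.continuousOn_precise hθ hm hVW).abs.isOpen_inter_preimage P.isOpen isOpen_Iio
  have hAG : A ⊆ G := by
    intro x hx
    by_contra h
    have h1 := hx.2
    rw [precise, if_neg h, hG1 x hx.1 h] at h1
    exact lt_irrefl _ h1
  have hae := P.precise_ae_eq hθ hm hVW
  rw [Filter.EventuallyEq, ae_restrict_iff' P.isOpen.measurableSet] at hae
  have hu : ∀ᵐ x, x ∈ A → |u x| < 1 := by
    filter_upwards [hae] with x hx hxA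
    rw [← hx hxA.1]
    exact hxA.2
  have hl := P.locallyIntegrable_extend
  have hln : LocallyIntegrable fun x => -extend Ω u W x := hl.neg
  have hAΩ : A ⊆ Ω := fun x hx => hx.1
  have hsup : DistSub (fun x => -extend Ω u W x) A := by
    intro φ hφ hc hs h0
    have h := P.integral_nonpos hA hAG hu hφ hc hs h0
    rw [setIntegral_mul_laplacian_eq (W := W) P.isOpen (hs.trans hAΩ)] at h
    simp_rw [neg_mul, integral_neg]
    linarith
  have hsub : DistSub (extend Ω u W) A := by
    intro φ hφ hc hs h0
    have h := P.neg.integral_nonpos hA hAG (by simpa using hu) hφ hc hs h0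
    simp_rw [neg_mul, integral_neg] at h
    rw [setIntegral_mul_laplacian_eq (W := W) P.isOpen (hs.trans hAΩ)] at h
    linarith
  -- Monotonicity in the scale for both the function and its negative makes the mollification
  -- constant in the scale, hence equal to its limit.
  have hconst : ∀ x r, 0 < r → Metric.closedBall x r ⊆ A →
      precise θ Ω G V W u x = moll θ r (extend Ω u W) x := by
    intro x r hr hx
    have hxG : x ∈ G := hAG (hx (Metric.mem_closedBall_self hr.le))
    refine tendsto_nhds_unique (P.tendsto_precise hθ hxG) (tendsto_const_nhds.congr' ?_)
    filter_upwards [Ioc_mem_nhdsGT hr] with s hs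
    have h1 := hsub.monotoneOn_moll hθ hl hx hs ⟨hr, le_rfl⟩ hs.2
    have h2 := hsup.monotoneOn_moll hθ hln hx hs ⟨hr, le_rfl⟩ hs.2
    simp only [moll_neg] at h1 h2
    linarith
  intro x hx
  obtain ⟨r, hr, hrA⟩ := exists_closedBall_subset hA hx
  have hb : ∀ y ∈ Metric.ball x r, Metric.closedBall y r ⊆ A := fun y hy =>
    (Metric.closedBall_subset_closedBall' (by
      have : dist y x < r := hy
      linarith)).trans hrA
  -- One scale `r` serves all points near `x`, so locally the function is a single smooth
  -- mollification, whose Laplacian has both signs.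
  have hev : precise θ Ω G V W u =ᶠ[𝓝 x] moll θ r (extend Ω u W) := by
    filter_upwards [Metric.ball_mem_nhds x hr] with y hy using hconst y r hr (hb y hy)
  rw [InnerProductSpace.harmonicAt_congr_nhds hev]
  refine ⟨(contDiff_moll hθ hr hl).contDiffAt.of_le (by norm_cast), ?_⟩
  filter_upwards [Metric.ball_mem_nhds x hr] with y hy
  have h1 := hsub.laplacian_moll_nonneg hθ hl hr (hb y hy)
  have h2 := hsup.laplacian_moll_nonneg hθ hln hr (hb y hy)
  have h3 : moll θ r (fun x => -extend Ω u W x) = -moll θ r (extend Ω u W) :=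
    funext fun x => moll_neg θ r _ x
  rw [h3, InnerProductSpace.laplacian_neg] at h2
  simp only [Pi.neg_apply, Pi.zero_apply] at h2 ⊢
  linarith

end IsObstacleMinimizer

/-! ### Sub-mean value property -/

lemma tendsto_smoothTransition_profile (t : ℝ) :
    Tendsto (fun k : ℕ => Real.smoothTransition (k * (1 - t))) atTop
      (𝓝 ((Iio (1 : ℝ)).indicator 1 t)) := by
  by_cases ht : t < 1
  · rw [indicator_of_mem (show t ∈ Iio 1 from ht)]
    have h1 : Tendsto (fun k : ℕ => (k : ℝ) * (1 - t)) atTop atTop :=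
      tendsto_natCast_atTop_atTop.atTop_mul_const (by linarith)
    refine tendsto_const_nhds.congr' ?_
    filter_upwards [h1.eventually_ge_atTop 1] with k hk
    exact (Real.smoothTransition.one_of_one_le hk).symm
  · rw [indicator_of_notMem (show t ∉ Iio 1 from ht)]
    refine tendsto_const_nhds.congr fun k => ?_
    exact (Real.smoothTransition.zero_of_nonpos
      (mul_nonpos_of_nonneg_of_nonpos (Nat.cast_nonneg k) (by linarith))).symm

/-- The profiles increase in steepness to the indicator of `t < 1`, so smooth radial averages
converge to the integral over the open ball. Thus inequalities for mollifications pass to ball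
averages. -/
lemma tendsto_moll_ball {f : Space d → ℝ} (hf : LocallyIntegrable f) (x : Space d) {r : ℝ}
    (hr : 0 < r) :
    Tendsto (fun k : ℕ => moll (fun t => Real.smoothTransition (k * (1 - t))) r f x) atTop
      (𝓝 ((r ^ (d + 1))⁻¹ * ∫ y in Metric.ball x r, f y)) := by
  simp_rw [moll_apply, kern, smul_eq_mul]
  have hBm : MeasurableSet (Metric.ball x r) := Metric.isOpen_ball.measurableSet
  rw [← integral_const_mul, ← integral_indicator hBm]
  have hbi : IntegrableOn f (Metric.ball x r) :=
    (hf.integrableOn_isCompact (isCompact_closedBall x r)).mono_set Metric.ball_subset_closedBall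
  have hz : ∀ y, y ∉ Metric.ball x r → 1 ≤ ‖x - y‖ ^ 2 / r ^ 2 := fun y hy => by
    rw [Metric.mem_ball, not_lt, dist_comm, dist_eq_norm] at hy
    exact one_le_sq_div_sq hr hy
  refine tendsto_integral_of_dominated_convergence
    ((Metric.ball x r).indicator fun y => (r ^ (d + 1))⁻¹ * ‖f y‖) (fun k => ?_) ?_ (fun k => ?_) ?_
  · refine AEStronglyMeasurable.mul (Continuous.aestronglyMeasurable ?_) hf.aestronglyMeasurable
    exact continuous_const.mul (Real.smoothTransition.continuous.comp (by fun_prop))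
  · rw [integrable_indicator_iff hBm]
    exact hbi.norm.const_mul _
  · refine Eventually.of_forall fun y => ?_
    by_cases hy : y ∈ Metric.ball x r
    · rw [indicator_of_mem hy, norm_mul, norm_mul,
        Real.norm_of_nonneg (by positivity : 0 ≤ (r ^ (d + 1))⁻¹),
        Real.norm_of_nonneg (Real.smoothTransition.nonneg _)]
      refine mul_le_mul_of_nonneg_right ?_ (norm_nonneg _)
      exact mul_le_of_le_one_right (by positivity) (Real.smoothTransition.le_one _)
    · rw [indicator_of_notMem hy, Real.smoothTransition.zero_of_nonpos
        (mul_nonpos_of_nonneg_of_nonpos (Nat.cast_nonneg k) (by linarith [hz y hy]))]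
      simp
  · refine Eventually.of_forall fun y => ?_
    have h := ((tendsto_smoothTransition_profile (‖x - y‖ ^ 2 / r ^ 2)).const_mul
      (r ^ (d + 1))⁻¹).mul_const (f y)
    convert h using 2
    by_cases hy : y ∈ Metric.ball x r
    · have hlt : ‖x - y‖ ^ 2 / r ^ 2 < 1 := by
        rw [Metric.mem_ball, dist_comm, dist_eq_norm] at hy
        rw [div_lt_one (by positivity)]
        gcongr
      rw [indicator_of_mem hy, indicator_of_mem (show _ ∈ Iio (1 : ℝ) from hlt)]
      simp
    · rw [indicator_of_notMem hy, indicator_of_notMem (show _ ∉ Iio (1 : ℝ) from (hz y hy).not_gt)]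
      simp

lemma mass_eq_moll_one (θ : ℝ → ℝ) : mass d θ = moll θ 1 (fun _ => (1 : ℝ)) (0 : Space d) := by
  rw [moll_const one_pos, smul_eq_mul, mul_one]

lemma tendsto_mass : Tendsto (fun k : ℕ => mass d fun t => Real.smoothTransition (k * (1 - t))) atTop
    (𝓝 (volume.real (Metric.ball (0 : Space d) 1))) := by
  simp_rw [mass_eq_moll_one]
  have := tendsto_moll_ball (d := d) (locallyIntegrable_const (1 : ℝ)) 0 one_pos
  simpa using this

/-- Distributional subharmonicity implies the sub-mean value property on balls. -/
lemma DistSub.le_average {f : Space d → ℝ} (hf : LocallyIntegrable f)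
    (h : DistSub f G) {x : Space d} {r : ℝ} (hr : 0 < r) (hx : Metric.closedBall x r ⊆ G)
    (hc : ContinuousAt f x) : f x ≤ ⨍ y in Metric.ball x r, f y := by
  have h1 := le_of_tendsto_of_tendsto' ((tendsto_mass (d := d)).mul_const (f x))
    (tendsto_moll_ball hf x hr) fun k =>
      h.le_moll (isProfile_smoothTransition (Nat.cast_nonneg k)) hf hr hx hc
  have hv : volume.real (Metric.ball x r) =
      r ^ (d + 1) * volume.real (Metric.ball (0 : Space d) 1) := by
    rw [measureReal_def, Measure.addHaar_ball_of_pos _ x hr, ENNReal.toReal_mul,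
      ENNReal.toReal_ofReal (by positivity), finrank_euclideanSpace, Fintype.card_fin,
      measureReal_def]
  have hω := volume_real_unitBall_pos (d := d)
  rw [setAverage_eq, hv, smul_eq_mul, mul_inv]
  rw [← le_inv_mul_iff₀ hω] at h1
  refine h1.trans (le_of_eq ?_)
  ring

/-- A continuous function with values in `[-1, 1]` that is harmonic where its values lie in
`(-1, 1)` is subharmonic where it is less than `1`. -/
lemma subharmonicOn_of_harmonicOnNhd (hΩ : IsOpen Ω) {f : Space d → ℝ} (hf : ContinuousOn f Ω)
    (hf1 : ∀ x ∈ Ω, |f x| ≤ 1)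
    (hh : InnerProductSpace.HarmonicOnNhd f {x | x ∈ Ω ∧ |f x| < 1}) :
    SubharmonicOn f {x | x ∈ Ω ∧ f x < 1} := by
  have hD := distSub_of_laplacian_nonneg hΩ hf (fun x hx => (abs_le.1 (hf1 x hx)).1) hh.contDiffOn
    fun x hx h1 => ((hh x ⟨hx, h1⟩).2.self_of_nhds).ge
  have hsub : {x | x ∈ Ω ∧ f x < 1} ⊆ Ω := fun x hx => hx.1
  -- Extension by zero gives the global local integrability needed for mollification; test functions
  -- and balls inside `Ω` do not see the change.
  set f₀ := Ω.indicator f with hf₀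
  have heq : ∀ x ∈ Ω, f₀ x = f x := fun x hx => indicator_of_mem hx f
  have hl : LocallyIntegrable f₀ := by
    refine (locallyIntegrable_const (1 : ℝ)).mono ?_ (Eventually.of_forall fun x => ?_)
    · rw [hf₀, aestronglyMeasurable_indicator_iff hΩ.measurableSet]
      exact hf.aestronglyMeasurable hΩ.measurableSet
    · by_cases hx : x ∈ Ω
      · simpa [heq x hx] using hf1 x hx
      · simp [hf₀, hx]
  have hD₀ : DistSub f₀ {x | x ∈ Ω ∧ f x < 1} := by
    intro φ hφ hc hs h0
    refine (hD φ hφ hc hs h0).trans (le_of_eq (integral_congr_ae (Eventually.of_forall fun x => ?_)))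
    by_cases hx : x ∈ tsupport φ
    · simp only [heq x (hs hx).1]
    · simp [laplacian_eq_zero_of_notMem_tsupport hx]
  refine ⟨(hf.mono hsub).upperSemicontinuousOn, fun x r hr hx => ?_⟩
  have hxΩ : Metric.closedBall x r ⊆ Ω := hx.trans hsub
  have hx0 := hxΩ (Metric.mem_closedBall_self hr.le)
  have hev : f =ᶠ[𝓝 x] f₀ := by
    filter_upwards [hΩ.mem_nhds hx0] with y hy using (heq y hy).symm
  refine ⟨((hf.mono hxΩ).integrableOn_compact (isCompact_closedBall x r)).mono_set
    Metric.ball_subset_closedBall, ?_⟩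
  have h := hD₀.le_average hl hr hx ((hf.continuousAt (hΩ.mem_nhds hx0)).congr hev)
  rw [heq x hx0] at h
  refine h.trans (le_of_eq ?_)
  rw [setAverage_eq, setAverage_eq]
  congr 1
  exact setIntegral_congr_fun Metric.isOpen_ball.measurableSet fun y hy =>
    heq y (hxΩ (Metric.ball_subset_closedBall hy))

/-! ### The cylinder -/

lemma isOpen_cylinder (d : ℕ) (R h : ℝ) : IsOpen (cylinder d R h) := by
  have : cylinder d R h = {x | √(∑ i : Fin d, x i.castSucc ^ 2) < R} ∩ {x | |x (Fin.last d)| < h} :=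
    rfl
  rw [this]
  exact (isOpen_lt (by fun_prop) continuous_const).inter
    (isOpen_lt (by fun_prop) continuous_const)

lemma volume_cylinder_ne_top (d : ℕ) (R h : ℝ) : volume (cylinder d R h) ≠ ⊤ := by
  have hsub : cylinder d R h ⊆ Metric.closedBall 0 (Real.sqrt (R ^ 2 + h ^ 2)) := by
    rintro x ⟨h1, h2⟩
    rw [mem_closedBall_zero_iff, EuclideanSpace.norm_eq]
    refine Real.sqrt_le_sqrt ?_
    rw [Fin.sum_univ_castSucc]
    have hs : 0 ≤ ∑ i : Fin d, x i.castSucc ^ 2 := Finset.sum_nonneg fun i _ => sq_nonneg _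
    have h3 := Real.sq_sqrt hs
    have h4 := Real.sqrt_nonneg (∑ i : Fin d, x i.castSucc ^ 2)
    have h5 : x (Fin.last d) ^ 2 ≤ h ^ 2 := sq_le_sq' (by linarith [(abs_lt.1 h2).1])
      (abs_lt.1 h2).2.le
    simp only [Real.norm_eq_abs, sq_abs]
    nlinarith
  exact ((measure_mono hsub).trans_lt (isCompact_closedBall _ _).measure_lt_top).ne

/-- The lower free boundary lies where `V` attains its minimum -1, and crossing it preserves
subharmonicity. -/
lemma IsClassicalSubsolution.distSub (h : IsClassicalSubsolution univ V) :
    DistSub V {x | V x < 1} := by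
  have := distSub_of_laplacian_nonneg isOpen_univ h.continuousOn
    (fun x hx => (abs_le.1 (h.abs_le_one x hx)).1) h.smooth.1
    fun x hx h1 => h.laplacian_nonneg x ⟨hx, h1⟩
  exact this.mono fun x hx => ⟨mem_univ x, hx⟩

lemma IsClassicalSupersolution.distSub_neg (h : IsClassicalSupersolution univ W) :
    DistSub (fun x => -W x) {x | -1 < W x} := by
  have hset : {x | x ∈ univ ∧ |-W x| < 1} = interphase univ W := by
    ext x
    simp [interphase]
  have := distSub_of_laplacian_nonneg (f := fun x => -W x) isOpen_univ h.continuousOn.neg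
    (fun x hx => by linarith [(abs_le.1 (h.abs_le_one x hx)).2])
    (by rw [hset]; exact h.smooth.1.neg) fun x hx h1 => by
      rw [abs_neg] at h1
      change 0 ≤ Δ (-W) x
      rw [InnerProductSpace.laplacian_neg]
      simpa using h.laplacian_nonpos x ⟨hx, h1⟩
  exact this.mono fun x hx => ⟨mem_univ x, by linarith [show -1 < W x from hx]⟩

end

end FreeBdry

/-! ### Application to the cylinder. -/

theorem mainTheorem11 (d : ℕ) :
    ∃ α : Set (FreeBdry.Space d) → ℝ≥0, (∀ D, 0 < α D ∧ α D < 1) ∧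
      ∀ (R h : ℝ), 0 < R → 0 < h →
      ∀ V W : FreeBdry.Space d → ℝ,
        FreeBdry.IsClassicalSubsolution univ V →
        FreeBdry.IsClassicalSupersolution univ W →
        (∀ x, V x ≤ W x) →
      ∀ u : FreeBdry.Space d → ℝ,
        FreeBdry.IsConstrainedMinimizer V W (FreeBdry.cylinder d R h) u →
      ∃ ubar : FreeBdry.Space d → ℝ,
        ubar =ᵐ[volume.restrict (FreeBdry.cylinder d R h)] u ∧
        ContinuousOn ubar (FreeBdry.cylinder d R h) ∧
        (∀ x ∈ FreeBdry.cylinder d R h, V x ≤ ubar x ∧ ubar x ≤ W x) ∧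
        (∀ D : Set (FreeBdry.Space d), IsCompact (closure D) →
          closure D ⊆ FreeBdry.interphase (FreeBdry.cylinder d R h) V ∪
            FreeBdry.interphase (FreeBdry.cylinder d R h) W →
          ∃ C : ℝ≥0, HolderOnWith C (α D) ubar D) ∧
        InnerProductSpace.HarmonicOnNhd ubar {x | x ∈ FreeBdry.cylinder d R h ∧ |ubar x| < 1} ∧
        FreeBdry.SubharmonicOn ubar {x | x ∈ FreeBdry.cylinder d R h ∧ ubar x < 1} ∧
        FreeBdry.SuperharmonicOn ubar {x | x ∈ FreeBdry.cylinder d R h ∧ -1 < ubar x} := by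
  -- The exponent 1/2 comes from balancing the errors $s$ and $|x-y|/s$, and serves every `D`.
  refine ⟨fun _ => 1 / 2, fun _ => ⟨by norm_num, by
    rw [div_lt_one (by norm_num)]; norm_num⟩, ?_⟩
  intro R h _ _ V W hV hW hVW u hu
  set Ω := FreeBdry.cylinder d R h with hΩdef
  have hΩ : IsOpen Ω := FreeBdry.isOpen_cylinder d R h
  have hVc : Continuous V := continuousOn_univ.1 hV.continuousOn
  have hWc : Continuous W := continuousOn_univ.1 hW.continuousOn
  set G := {x | x ∈ Ω ∧ V x < 1 ∧ -1 < W x} with hG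
  have hV1 : ∀ x, |V x| ≤ 1 := fun x => hV.abs_le_one x (mem_univ x)
  have hW1 : ∀ x, |W x| ≤ 1 := fun x => hW.abs_le_one x (mem_univ x)
  have P : FreeBdry.IsObstacleMinimizer Ω G V W u :=
    { isOpen := hΩ
      volume_ne_top := FreeBdry.volume_cylinder_ne_top d R h
      isOpen_sub := hΩ.inter
        ((isOpen_lt hVc continuous_const).inter (isOpen_lt continuous_const hWc))
      subset := fun x hx => hx.1
      continuous_lower := hVc
      continuous_upper := hWc
      abs_lower_le := hV1
      abs_upper_le := hW1
      lower_le_upper := hVW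
      distSub_lower := hV.distSub.mono fun x hx => hx.2.1
      distSub_neg_upper := hW.distSub_neg.mono fun x hx => hx.2.2
      minimizer := hu }
  -- Off `G` either `V = 1`, which forces `W = 1`, or `W = -1`, which forces `V = -1`.
  have hoff : ∀ x ∈ Ω, x ∉ G → V x = W x ∧ |V x| = 1 := by
    intro x hx hxG
    have h1 := abs_le.1 (hV1 x)
    have h2 := abs_le.1 (hW1 x)
    have h3 := hVW x
    by_cases hc : V x < 1
    · have hw : W x = -1 := le_antisymm (not_lt.1 fun h => hxG ⟨hx, hc, h⟩) h2.1
      have hv : V x = -1 := by linarith [h1.1]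
      exact ⟨by rw [hv, hw], by rw [hv]; norm_num⟩
    · have hv : V x = 1 := le_antisymm h1.2 (not_lt.1 hc)
      exact ⟨by linarith [h2.2], by rw [hv]; norm_num⟩
  have heq := fun x hx hxG => (hoff x hx hxG).1
  obtain ⟨θ, hθ, hm⟩ := FreeBdry.exists_normalized_profile d
  have hcont := P.continuousOn_precise hθ hm heq
  have hharm := P.harmonicOnNhd_precise hθ hm heq fun x hx hxG => (hoff x hx hxG).2
  have habs : ∀ x ∈ Ω, |FreeBdry.precise θ Ω G V W u x| ≤ 1 :=
    fun x _ => P.abs_precise_le hθ hm x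
  refine ⟨FreeBdry.precise θ Ω G V W u, P.precise_ae_eq hθ hm heq, hcont,
    fun x _ => P.precise_mem_Icc hθ hm x, fun D hD hDG => ?_, hharm,
    FreeBdry.subharmonicOn_of_harmonicOnNhd hΩ hcont habs hharm, ?_⟩
  · refine P.exists_holderOnWith_precise hθ hm hD fun x hx => ?_
    -- If one obstacle lies strictly between -1 and 1, the ordering `V ≤ W` gives both inequalities
    -- defining `G`.
    rcases hDG hx with ⟨hxΩ, h1⟩ | ⟨hxΩ, h1⟩
    · exact ⟨hxΩ, (abs_lt.1 h1).2, (abs_lt.1 h1).1.trans_le (hVW x)⟩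
    · exact ⟨hxΩ, (hVW x).trans_lt (abs_lt.1 h1).2, (abs_lt.1 h1).1⟩
  · have := FreeBdry.subharmonicOn_of_harmonicOnNhd hΩ
      (f := fun x => -FreeBdry.precise θ Ω G V W u x) hcont.neg
      (fun x hx => by rw [abs_neg]; exact habs x hx) (by simp_rw [abs_neg]; exact hharm.neg)
    simp_rw [neg_lt] at this
    exact this
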